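/- A one-way state generator consists of three uniform quantum polynomial-time (QPT) algorithms: $\mathsf{KeyGen}(1^\lambda)\to k$ outputs a classical key, $\mathsf{StateGen}(k)\to\phi_k$ outputs a (possibly mixed) quantum state, and $\mathsf{Ver}(k',\phi_k)\to\top/\bot$ accepts or rejects. For $\epsilon:\mathbb N\to[0,1]$ it is an $\epsilon$-OWSG if the following two conditions hold. (Correctness) There is a negligible function $\mathsf{negl}$ with $$\Pr[\top\gets\mathsf{Ver}(k,\phi_k):\ k\gets\mathsf{KeyGen}(1^\lambda),\ \phi_k\gets\mathsf{StateGen}(k)]\ge 1-\mathsf{negl}(\lambda).$$ ($\epsilon$-one-wayness) For every QPT adversary $\mathcal A$ and every polynomial $t$, for all sufficiently large $\lambda$, $$\Pr[\top\gets\mathsf{Ver}(k',\phi_k):\ k\gets\mathsf{KeyGen}(1^\lambda),\ \phi_k\gets\mathsf{StateGen}(k),\ k'\gets\mathcal A(1^\lambda,\phi_k^{\otimes t(\lambda)})]\le\epsilon(\lambda),$$ where $\mathsf{Ver}$ is run on a further copy of $\phi_k$. It is a weak OWSG if there is $c\in\mathbb N$ such that it is a $(1-\lambda^{-c})$-OWSG.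 It has $m(\lambda)$-qubit outputs if $\phi_k$ is an $m(\lambda)$-qubit state for every $k$ in the support of $\mathsf{KeyGen}(1^\lambda)$. **Theorem.** There do not exist weak OWSGs with $O(1)$-qubit outputs: for every function $m:\mathbb N\to\mathbb N$ with $m(\lambda)=O(1)$, no weak OWSG has $m(\lambda)$-qubit outputs. -/

import Mathlib

noncomputable section

open Filter Asymptotics
open scoped ComplexOrder

/-! ## A quantum machine model with a step count

A machine has finitely many stacks of classical bits and finitely many stacks of qubits, all
operated on at the top (the head of the list), and a fixed structured program. It is a classical
multi-stack machine that may also create, move, transform and measure qubits. The gate set is the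
universal set `{H, T, CNOT}`. -/

/-- A basis state of the quantum memory: the contents of each stack of qubits. -/
abbrev QStore := ℕ → List Bool

/-- Programs. A numeral names a stack; classical and quantum stacks are numbered separately. -/
inductive Prog : Type
  | skip : Prog
  | seq : Prog → Prog → Prog
  /-- push the bit `b` on the classical stack `s` -/
  | push (s : ℕ) (b : Bool) : Prog
  /-- remove the top bit of the classical stack `s` -/
  | pop (s : ℕ) : Prog
  /-- run the first program if the top bit of the classical stack `s` is `1`,
  otherwise (top bit `0` or `s` empty) the second -/
  | ifTop (s : ℕ) : Prog → Prog → Prog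
  /-- repeat the program as long as the classical stack `s` is nonempty -/
  | loop (s : ℕ) : Prog → Prog
  /-- push a fresh qubit in state `|0⟩` on the quantum stack `r` -/
  | fresh (r : ℕ) : Prog
  /-- Hadamard gate on the top qubit of `r` -/
  | hadamard (r : ℕ) : Prog
  /-- the gate `T = diag(1, exp(iπ/4))` on the top qubit of `r` -/
  | tGate (r : ℕ) : Prog
  /-- controlled NOT, control the top qubit of `r`, target the top qubit of `s` -/
  | cnot (r s : ℕ) : Prog
  /-- move the top qubit of `r` to the top of `s` -/
  | move (r s : ℕ) : Prog
  /-- remove the top qubit of the quantum stack `r`, measure it in the computational basis, and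
  push the outcome on the classical stack `s` -/
  | measure (r s : ℕ) : Prog
  /-- repeat the program as long as the quantum stack `r` is nonempty -/
  | qloop (r : ℕ) : Prog → Prog

/-! ### Kraus operators of the instructions, acting on amplitude functions

Instructions that need a qubit on an empty stack do nothing. -/

namespace Kraus

def fresh (r : ℕ) (ψ : QStore → ℂ) (x : QStore) : ℂ :=
  match x r with
  | false :: l => ψ (Function.update x r l)
  | _ => 0

def hadamard (r : ℕ) (ψ : QStore → ℂ) (x : QStore) : ℂ :=
  match x r with
  | [] => ψ x
  | b :: l =>
      (ψ (Function.update x r (false :: l)) +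
        (if b then -1 else 1) * ψ (Function.update x r (true :: l))) / (Real.sqrt 2 : ℂ)

def tGate (r : ℕ) (ψ : QStore → ℂ) (x : QStore) : ℂ :=
  match x r with
  | true :: _ => Complex.exp (Complex.I * (Real.pi / 4 : ℝ)) * ψ x
  | _ => ψ x

def cnot (r s : ℕ) (ψ : QStore → ℂ) (x : QStore) : ℂ :=
  if r = s then ψ x
  else
    match x r, x s with
    | true :: _, b :: l => ψ (Function.update x s ((!b) :: l))
    | _, _ => ψ x

/-- Moving the top qubit of `r` to `s`; basis states in which `r` is empty are sent to `0`. -/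
def move (r s : ℕ) (ψ : QStore → ℂ) (x : QStore) : ℂ :=
  match x s with
  | [] => 0
  | b :: l =>
      let x' := Function.update x s l
      ψ (Function.update x' r (b :: x' r))

/-- `⟨b|` applied to the top qubit of `r`, which is removed; basis states in which `r` is empty
are sent to `0`. -/
def readTop (r : ℕ) (b : Bool) (ψ : QStore → ℂ) (x : QStore) : ℂ :=
  ψ (Function.update x r (b :: x r))

/-- Projection onto the basis states in which `r` is empty. -/
def isEmpty (r : ℕ) (ψ : QStore → ℂ) (x : QStore) : ℂ :=
  match x r with
  | [] => ψ x
  | _ :: _ => 0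

/-- Projection onto the basis states in which `r` is nonempty. -/
def nonEmpty (r : ℕ) (ψ : QStore → ℂ) (x : QStore) : ℂ :=
  match x r with
  | [] => 0
  | _ :: _ => ψ x

/-- `A ρ A†`, for a linear operator `A` on amplitude functions. -/
def sandwich (A : (QStore → ℂ) → QStore → ℂ) (ρ : Matrix QStore QStore ℂ) :
    Matrix QStore QStore ℂ :=
  fun x y => A (fun x' => star (A (fun y' => star (ρ x' y')) y)) x

end Kraus

/-- A configuration on one classical branch of a computation: the list of programs still to be
executed, the classical stacks, and the unnormalised density operator of the quantum memory, whose
trace is the probability of the branch. -/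
structure Config where
  todo : List Prog
  bits : ℕ → List Bool
  qubits : Matrix QStore QStore ℂ

namespace Config

/-- One step of computation: the list of branches that a configuration leads to. A configuration
with nothing left to do has halted and stays as it is. -/
def step : Config → List Config
  | ⟨[], c, ρ⟩ => [⟨[], c, ρ⟩]
  | ⟨.skip :: R, c, ρ⟩ => [⟨R, c, ρ⟩]
  | ⟨.seq P Q :: R, c, ρ⟩ => [⟨P :: Q :: R, c, ρ⟩]
  | ⟨.push s b :: R, c, ρ⟩ => [⟨R, Function.update c s (b :: c s), ρ⟩]
  | ⟨.pop s :: R, c, ρ⟩ => [⟨R, Function.update c s (c s).tail, ρ⟩]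
  | ⟨.ifTop s P Q :: R, c, ρ⟩ =>
      if (c s).head? = some true then [⟨P :: R, c, ρ⟩] else [⟨Q :: R, c, ρ⟩]
  | ⟨.loop s P :: R, c, ρ⟩ =>
      if c s = [] then [⟨R, c, ρ⟩] else [⟨P :: .loop s P :: R, c, ρ⟩]
  | ⟨.fresh r :: R, c, ρ⟩ => [⟨R, c, Kraus.sandwich (Kraus.fresh r) ρ⟩]
  | ⟨.hadamard r :: R, c, ρ⟩ => [⟨R, c, Kraus.sandwich (Kraus.hadamard r) ρ⟩]
  | ⟨.tGate r :: R, c, ρ⟩ => [⟨R, c, Kraus.sandwich (Kraus.tGate r) ρ⟩]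
  | ⟨.cnot r s :: R, c, ρ⟩ => [⟨R, c, Kraus.sandwich (Kraus.cnot r s) ρ⟩]
  | ⟨.move r s :: R, c, ρ⟩ =>
      [⟨R, c, Kraus.sandwich (Kraus.move r s) ρ⟩,
       ⟨R, c, Kraus.sandwich (Kraus.isEmpty r) ρ⟩]
  | ⟨.measure r s :: R, c, ρ⟩ =>
      [⟨R, Function.update c s (false :: c s), Kraus.sandwich (Kraus.readTop r false) ρ⟩,
       ⟨R, Function.update c s (true :: c s), Kraus.sandwich (Kraus.readTop r true) ρ⟩,
       ⟨R, c, Kraus.sandwich (Kraus.isEmpty r) ρ⟩]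
  | ⟨.qloop r P :: R, c, ρ⟩ =>
      [⟨P :: .qloop r P :: R, c, Kraus.sandwich (Kraus.nonEmpty r) ρ⟩,
       ⟨R, c, Kraus.sandwich (Kraus.isEmpty r) ρ⟩]

/-- All branches after `n` steps. -/
def run (n : ℕ) (C : Config) : List Config :=
  (fun L : List Config => L.flatMap step)^[n] [C]

/-- The probability of a branch: the trace of its density operator. -/
def weight (C : Config) : ℝ := (∑' x : QStore, C.qubits x x).re

end Config

/-! ### States of qubits and inputs -/

/-- An operator on (finite superpositions of) bit strings. -/
abbrev QOp := Matrix (List Bool) (List Bool) ℂ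

/-- `φ` is an operator on `n` qubits: only strings of length `n` occur. -/
def QOp.OnQubits (n : ℕ) (φ : QOp) : Prop :=
  ∀ x y, φ x y ≠ 0 → x.length = n ∧ y.length = n

/-- `φ` is an `n`-qubit (mixed) state: a density operator on `n` qubits. -/
def QOp.IsState (n : ℕ) (φ : QOp) : Prop :=
  φ.OnQubits n ∧ φ.PosSemidef ∧ ∑' x, φ x x = 1

/-- The state of no qubits at all. -/
def QOp.empty : QOp := fun x y => if x = [] ∧ y = [] then 1 else 0

/-- `φ^{⊗ t}` for an operator `φ` on `m` qubits, as an operator on `t * m` qubits. -/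
def QOp.copies (m : ℕ) (φ : QOp) : ℕ → QOp
  | 0 => QOp.empty
  | t + 1 => fun x y => φ (x.take m) (y.take m) * QOp.copies m φ t (x.drop m) (y.drop m)

open Classical in
/-- The initial configuration of a program on the classical input `w` (on classical stack `0`) and
the quantum input `φ` (on quantum stack `0`); all other stacks are empty. -/
def Prog.start (P : Prog) (w : List Bool) (φ : QOp) : Config where
  todo := [P]
  bits := Function.update (fun _ => []) 0 w
  qubits := fun x y =>
    if (∀ r, r ≠ 0 → x r = [] ∧ y r = []) then φ (x 0) (y 0) else 0

/-- A uniform quantum polynomial-time algorithm: one program together with a polynomial that bounds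
its number of steps in the total length of the classical and the quantum input. The bound holds on
every branch of nonzero probability. (By linearity it does not matter whether one asks this for all
density operators `φ` on `n` qubits or for all operators.) -/
structure QPT where
  prog : Prog
  time : Polynomial ℕ
  halts : ∀ (w : List Bool) (n : ℕ) (φ : QOp), φ.OnQubits n →
    ∀ C ∈ (prog.start w φ).run (time.eval (w.length + n)), C.todo = [] ∨ C.qubits = 0

namespace QPT

/-- The final branches on the classical input `w` and the `n`-qubit input `φ`. -/
def final (A : QPT) (w : List Bool) (n : ℕ) (φ : QOp) : List Config :=
  (A.prog.start w φ).run (A.time.eval (w.length + n))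

/-- The expectation of `f y`, where `y` is the classical output (the final contents of classical
stack `0`) on the classical input `w` and the `n`-qubit input `φ`. -/
def expect (A : QPT) (w : List Bool) (n : ℕ) (φ : QOp) (f : List Bool → ℝ) : ℝ :=
  ((A.final w n φ).map fun C => C.weight * f (C.bits 0)).sum

/-- The quantum output (the final contents of quantum stack `0`) on the classical input `w`, with
no quantum input; everything else is traced out. -/
def outState (A : QPT) (w : List Bool) : QOp := fun x y =>
  ((A.final w 0 QOp.empty).map fun C =>
    ∑' g : {g : QStore // g 0 = []},
      C.qubits (Function.update g.1 0 x) (Function.update g.1 0 y)).sum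

end QPT

/-! ## One-way state generators -/

/-- The unary security parameter `1^n`. -/
def unary (n : ℕ) : List Bool := List.replicate n true

/-- The three algorithms of a one-way state generator. -/
structure StateGenerator where
  keyGen : QPT
  stateGen : QPT
  ver : QPT

namespace StateGenerator

/-- The state `φ_k` that `stateGen` outputs on the key `k`. -/
def state (G : StateGenerator) (k : List Bool) : QOp := G.stateGen.outState k

/-- The probability that `keyGen` outputs `k` on the security parameter `n`. -/
def keyProb (G : StateGenerator) (n : ℕ) (k : List Bool) : ℝ :=
  G.keyGen.expect (unary n) 0 QOp.empty fun y => if y = k then 1 else 0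

/-- The probability that `ver` accepts the string `k'` and the `m`-qubit state `φ`; accepting means
to halt with the bit `1` on top of the output. -/
def acceptProb (G : StateGenerator) (k' : List Bool) (m : ℕ) (φ : QOp) : ℝ :=
  G.ver.expect k' m φ fun y => if y.head? = some true then 1 else 0

/-- `G` has `m(n)`-qubit outputs: for every key `k` in the support of `keyGen`, the state `φ_k` is
an `m(n)`-qubit state. -/
def HasQubitOutputs (G : StateGenerator) (m : ℕ → ℕ) : Prop :=
  ∀ (n : ℕ) (k : List Bool), G.keyProb n k ≠ 0 → (G.state k).IsState (m n)

/-- Correctness: an honestly generated pair of key and state is accepted except with negligible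
probability. -/
def Correct (G : StateGenerator) (m : ℕ → ℕ) : Prop :=
  ∃ ν : ℕ → ℝ, SuperpolynomialDecay atTop (fun n : ℕ => (n : ℝ)) ν ∧
    ∀ n : ℕ, 1 - ν n ≤
      G.keyGen.expect (unary n) 0 QOp.empty fun k => G.acceptProb k (m n) (G.state k)

/-- The probability that the adversary `A`, given `1^n` and `t` copies of `φ_k` for a random key
`k`, outputs a string `k'` that `ver` accepts on a further copy of `φ_k`. -/
def winProb (G : StateGenerator) (m : ℕ → ℕ) (A : QPT) (t n : ℕ) : ℝ :=
  G.keyGen.expect (unary n) 0 QOp.empty fun k =>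
    A.expect (unary n) (t * m n) (QOp.copies (m n) (G.state k) t) fun k' =>
      G.acceptProb k' (m n) (G.state k)

/-- `ε`-one-wayness. -/
def OneWay (G : StateGenerator) (m : ℕ → ℕ) (ε : ℕ → ℝ) : Prop :=
  ∀ (A : QPT) (t : Polynomial ℕ), ∀ᶠ n : ℕ in atTop, G.winProb m A (t.eval n) n ≤ ε n

/-- `G` is an `ε`-OWSG with `m(n)`-qubit outputs. -/
structure IsOWSG (G : StateGenerator) (m : ℕ → ℕ) (ε : ℕ → ℝ) : Prop where
  outputs : G.HasQubitOutputs m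
  correct : G.Correct m
  oneWay : G.OneWay m ε

/-- `G` is a weak OWSG with `m(n)`-qubit outputs: a `(1 - n^{-c})`-OWSG for some `c`. -/
def IsWeakOWSG (G : StateGenerator) (m : ℕ → ℕ) : Prop :=
  ∃ c : ℕ, G.IsOWSG m fun n => 1 - ((n : ℝ) ^ c)⁻¹

end StateGenerator

end

/-! Fix the number `m₀` of qubits and let a(k', k) be the probability that `ver` accepts k' on φ_k.
It is linear in φ_k, which has d = 4^m₀ entries, so a(k', k) = ∑ u_i(k') v_i(k) with d terms
(`AdvData.accept_eq_sum`). The adversary runs up to N rounds. In each it samples k' from `keyGen`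
and tests it on s fresh copies of φ_k; it outputs the first k' that passes all s tests.

Let p be the distribution of keys and M(k) = ∑ p(k') a(k', k)^s the probability that a round finds a
key. A key accepted with probability below 1 - η passes s tests with probability at most (1 - η)^s,
so keys that pass are good unless M(k) is tiny; a tiny M(k) is also the only reason why N rounds
might not suffice. The heart of the proof is that M(k) is rarely tiny: ∑ p(k) a(k, k)^s / M(k) is
the trace of the matrix with entries p(k') a(k', k)^s / M(k). Its entries are nonnegative and its
rows sum to at most 1, so its eigenvalues have modulus at most 1. By the multinomial theorem it
factors through the monomials of degree s in d variables, of which there are at most (s + 1)^d.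
Hence the trace is at most (s + 1)^d (`Matrix.trace_le_of_substochastic`, `sum_div_passProb_le`).

With correctness error ν the adversary fails with probability at most η + ((1 - η)^s + 1/N)(s + 1)^d
+ sν (`sum_win_ge`). For η = n^{-(c+1)}, s = n^{c+2}, N = n^{(c+2)d+c+1} this is eventually below
n^{-c} (`eventually_error_lt`). A bounded `m` takes some value `m₀` infinitely often, and there the
adversary with `m₀` hard-wired contradicts weak one-wayness.

Most of the work is to realise this adversary in the machine model. `Exec` is a weighted Hoare logic
for branching runs. `Prog.call_exec` runs a subroutine on stacks of its own, `Prog.rep_exec`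
provides n^e repetitions, and `AdvData.prog_exec` evaluates the adversary on any input that splits
into blocks. The last is used twice: with copies of φ_k for the success probability, and with matrix
units, to which linearity (`Config.run_eq_paths`) reduces halting on arbitrary inputs. -/

noncomputable section

open scoped ComplexOrder

/-! ## Elementary operations and the linearity of a run -/

/-- Operators on the quantum memory. -/
abbrev QMat := Matrix QStore QStore ℂ

/-- The elementary Kraus operators of the machine. -/
inductive KrausOp : Type
  | id : KrausOp
  | fresh (r : ℕ) : KrausOp
  | hadamard (r : ℕ) : KrausOp
  | tGate (r : ℕ) : KrausOp
  | cnot (r s : ℕ) : KrausOp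
  | move (r s : ℕ) : KrausOp
  | readTop (r : ℕ) (b : Bool) : KrausOp
  | isEmpty (r : ℕ) : KrausOp
  | nonEmpty (r : ℕ) : KrausOp

namespace KrausOp

/-- The action of an elementary Kraus operator on amplitude functions. -/
def act : KrausOp → (QStore → ℂ) → QStore → ℂ
  | id => fun ψ => ψ
  | fresh r => Kraus.fresh r
  | hadamard r => Kraus.hadamard r
  | tGate r => Kraus.tGate r
  | cnot r s => Kraus.cnot r s
  | move r s => Kraus.move r s
  | readTop r b => Kraus.readTop r b
  | isEmpty r => Kraus.isEmpty r
  | nonEmpty r => Kraus.nonEmpty r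

theorem act_add (o : KrausOp) (ψ χ : QStore → ℂ) : o.act (ψ + χ) = o.act ψ + o.act χ := by
  funext x
  cases o <;> simp only [act, Kraus.fresh, Kraus.hadamard, Kraus.tGate, Kraus.cnot, Kraus.move,
    Kraus.readTop, Kraus.isEmpty, Kraus.nonEmpty, Pi.add_apply] <;> (repeat' split) <;> (try simp) <;>
    ring

theorem act_smul (o : KrausOp) (a : ℂ) (ψ : QStore → ℂ) : o.act (a • ψ) = a • o.act ψ := by
  funext x
  cases o <;> simp only [act, Kraus.fresh, Kraus.hadamard, Kraus.tGate, Kraus.cnot, Kraus.move,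
    Kraus.readTop, Kraus.isEmpty, Kraus.nonEmpty, Pi.smul_apply, smul_eq_mul] <;> (repeat' split) <;>
    (try simp) <;> ring

/-- Conjugation `ρ ↦ A ρ A†` by an elementary Kraus operator, as a linear map. -/
def conj (o : KrausOp) : QMat →ₗ[ℂ] QMat where
  toFun := Kraus.sandwich o.act
  map_add' ρ σ := by
    funext x y
    have h : ∀ x', (fun y' => star ((ρ + σ) x' y')) =
        (fun y' => star (ρ x' y')) + fun y' => star (σ x' y') := by
      intro x'; funext y'; simp
    have h2 : (fun x' => star (o.act (fun y' => star ((ρ + σ) x' y')) y)) =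
        (fun x' => star (o.act (fun y' => star (ρ x' y')) y)) +
        fun x' => star (o.act (fun y' => star (σ x' y')) y) := by
      funext x'; rw [h, act_add]; simp
    simp only [Kraus.sandwich, Matrix.add_apply]
    have := congrFun (o.act_add (fun x' => star (o.act (fun y' => star (ρ x' y')) y))
      (fun x' => star (o.act (fun y' => star (σ x' y')) y))) x
    rw [← h2] at this
    exact this
  map_smul' a ρ := by
    funext x y
    have h : ∀ x', (fun y' => star ((a • ρ) x' y')) = star a • (fun y' => star (ρ x' y')) := by
      intro x'; funext y'; simp
    have h2 : (fun x' => star (o.act (fun y' => star ((a • ρ) x' y')) y)) =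
        a • (fun x' => star (o.act (fun y' => star (ρ x' y')) y)) := by
      funext x'; rw [h, act_smul]; simp
    have := congrFun (o.act_smul a (fun x' => star (o.act (fun y' => star (ρ x' y')) y))) x
    rw [← h2] at this
    exact this

theorem conj_apply (o : KrausOp) (ρ : QMat) : o.conj ρ = Kraus.sandwich o.act ρ := rfl

theorem conj_id (ρ : QMat) : KrausOp.id.conj ρ = ρ := by
  funext x y; simp [conj_apply, Kraus.sandwich, act]

end KrausOp

namespace Config

/-- The branches of one step, with the operators applied to the quantum memory. -/
def branches : List Prog → (ℕ → List Bool) → List (List Prog × (ℕ → List Bool) × KrausOp)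
  | [], c => [([], c, .id)]
  | .skip :: R, c => [(R, c, .id)]
  | .seq P Q :: R, c => [(P :: Q :: R, c, .id)]
  | .push s b :: R, c => [(R, Function.update c s (b :: c s), .id)]
  | .pop s :: R, c => [(R, Function.update c s (c s).tail, .id)]
  | .ifTop s P Q :: R, c =>
      if (c s).head? = some true then [(P :: R, c, .id)] else [(Q :: R, c, .id)]
  | .loop s P :: R, c => if c s = [] then [(R, c, .id)] else [(P :: .loop s P :: R, c, .id)]
  | .fresh r :: R, c => [(R, c, .fresh r)]
  | .hadamard r :: R, c => [(R, c, .hadamard r)]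
  | .tGate r :: R, c => [(R, c, .tGate r)]
  | .cnot r s :: R, c => [(R, c, .cnot r s)]
  | .move r s :: R, c => [(R, c, .move r s), (R, c, .isEmpty r)]
  | .measure r s :: R, c =>
      [(R, Function.update c s (false :: c s), .readTop r false),
       (R, Function.update c s (true :: c s), .readTop r true),
       (R, c, .isEmpty r)]
  | .qloop r P :: R, c => [(P :: .qloop r P :: R, c, .nonEmpty r), (R, c, .isEmpty r)]

/-- Apply an operation of a branch to a density operator. -/
def applyBranch (ρ : QMat) (b : List Prog × (ℕ → List Bool) × KrausOp) : Config :=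
  ⟨b.1, b.2.1, b.2.2.conj ρ⟩

/-- Control flow and Kraus operators of a step depend only on the program and the classical memory,
never on `ρ`. This makes runs linear. -/
theorem step_eq (L : List Prog) (c : ℕ → List Bool) (ρ : QMat) :
    step ⟨L, c, ρ⟩ = (branches L c).map (applyBranch ρ) := by
  cases L with
  | nil => simp [step, branches, applyBranch, KrausOp.conj_id]
  | cons P R =>
    cases P <;> simp only [step, branches] <;> (try split) <;>
      simp [applyBranch, KrausOp.conj_id] <;> (try simp [KrausOp.conj_apply, KrausOp.act])

theorem run_succ (n : ℕ) (C : Config) : run (n + 1) C = (step C).flatMap (run n) := by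
  -- Iteration distributes over the branches of a list, so the first step of a run can be split off.
  have h : ∀ (n : ℕ) (L : List Config),
      (fun L : List Config => L.flatMap step)^[n] L = L.flatMap (run n) := by
    intro n
    induction n with
    | zero => intro L; exact (List.flatMap_singleton' L).symm
    | succ n ih =>
      intro L
      rw [Function.iterate_succ_apply, ih, List.flatMap_assoc]
      congr 1
      funext C
      simp only [run]
      rw [Function.iterate_succ_apply, ih]
      simp
  simp only [run]
  rw [Function.iterate_succ_apply, h]
  simp

theorem run_zero (C : Config) : run 0 C = [C] := rfl

/-- The branches of a run, with the linear maps applied to the quantum memory. -/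
def paths : ℕ → List Prog → (ℕ → List Bool) → List (List Prog × (ℕ → List Bool) × (QMat →ₗ[ℂ] QMat))
  | 0, L, c => [(L, c, LinearMap.id)]
  | n + 1, L, c => (branches L c).flatMap fun b =>
      (paths n b.1 b.2.1).map fun p => (p.1, p.2.1, p.2.2.comp b.2.2.conj)

/-- The list of paths is the same for every `ρ`, so runs on different operators can be compared path
by path. -/
theorem run_eq_paths (n : ℕ) (L : List Prog) (c : ℕ → List Bool) (ρ : QMat) :
    run n ⟨L, c, ρ⟩ = (paths n L c).map fun p => ⟨p.1, p.2.1, p.2.2 ρ⟩ := by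
  induction n generalizing L c ρ with
  | zero => simp [run_zero, paths]
  | succ n ih =>
    rw [run_succ, step_eq, paths, List.map_flatMap, List.flatMap_map]
    congr 1
    funext b
    rw [applyBranch, ih, List.map_map]
    rfl

end Config

end

noncomputable section

open scoped ComplexOrder

/-! ## Stack bounds, trace, positivity -/

/-- All stacks from `W` on are empty and all stacks have length at most `B`. -/
def StackBound (W B : ℕ) (x : ℕ → List Bool) : Prop :=
  (∀ s, W ≤ s → x s = []) ∧ ∀ s, (x s).length ≤ B

theorem StackBound.mono {W B W' B' : ℕ} {x : ℕ → List Bool} (h : StackBound W B x) (hW : W ≤ W')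
    (hB : B ≤ B') : StackBound W' B' x :=
  ⟨fun s hs => h.1 s (hW.trans hs), fun s => (h.2 s).trans hB⟩

theorem StackBound.update {W B : ℕ} {x : ℕ → List Bool} (h : StackBound W B x) {s : ℕ}
    {l : List Bool} (hs : s < W) (hl : l.length ≤ B) : StackBound W B (Function.update x s l) := by
  constructor
  · intro t ht
    rw [Function.update_of_ne (by omega)]
    exact h.1 t ht
  · intro t
    by_cases hts : t = s
    · subst hts; simpa using hl
    · rw [Function.update_of_ne hts]; exact h.2 t

/-- Traces are infinite sums over basis states; bounded stacks supply the finite supports that make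
them summable. -/
theorem StackBound.finite (W B : ℕ) : {x : ℕ → List Bool | StackBound W B x}.Finite := by
  have hf : {l : List Bool | l.length ≤ B}.Finite := List.finite_length_le Bool B
  have : (Set.pi Set.univ fun _ : Fin W => {l : List Bool | l.length ≤ B}).Finite :=
    Set.Finite.pi fun _ => hf
  refine Set.Finite.of_finite_image (f := fun x (i : Fin W) => x i) (this.subset ?_) ?_
  · rintro _ ⟨x, hx, rfl⟩ i _
    exact hx.2 i
  · intro x hx y hy hxy
    funext s
    by_cases hs : s < W
    · exact congrFun hxy ⟨s, hs⟩
    · rw [hx.1 s (by omega), hy.1 s (by omega)]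

/-- The operator `ρ` only involves basis states satisfying `p`. -/
def QMat.SupportedOn (ρ : QMat) (p : QStore → Prop) : Prop :=
  ∀ x y, ρ x y ≠ 0 → p x ∧ p y

theorem QMat.SupportedOn.mono {ρ : QMat} {p q : QStore → Prop} (h : ρ.SupportedOn p)
    (hpq : ∀ x, p x → q x) : ρ.SupportedOn q :=
  fun x y hxy => ⟨hpq x (h x y hxy).1, hpq y (h x y hxy).2⟩

theorem QMat.SupportedOn.finite_diag {ρ : QMat} {p : QStore → Prop} (h : ρ.SupportedOn p)
    (hp : {x | p x}.Finite) : (Function.support fun x => ρ x x).Finite :=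
  hp.subset fun x hx => (h x x hx).1

/-- The trace of an operator on the quantum memory. -/
def QMat.tr (ρ : QMat) : ℂ := ∑' x, ρ x x

/-- The operator `v v†`. -/
def QMat.rankOne (v : QStore → ℂ) : QMat := fun x y => v x * star (v y)

namespace KrausOp

/-- A bound on the stacks that occur in an elementary operator. -/
def width : KrausOp → ℕ
  | id => 0
  | fresh r | hadamard r | tGate r | readTop r _ | isEmpty r | nonEmpty r => r + 1
  | cnot r s | move r s => max r s + 1

/-- An amplitude of the image comes from amplitudes at stores that differ only below `o.width`,
where a stack has lost at most one qubit. Supports therefore grow by at most one qubit per stack and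
step. -/
theorem exists_of_act_ne_zero (o : KrausOp) (ψ : QStore → ℂ) (x : QStore) (h : o.act ψ x ≠ 0) :
    ∃ y, ψ y ≠ 0 ∧ ∀ s, (x s).length ≤ (y s).length + 1 ∧ (o.width ≤ s → x s = y s) := by
  have self : ψ x ≠ 0 → ∃ y, ψ y ≠ 0 ∧
      ∀ s, (x s).length ≤ (y s).length + 1 ∧ (o.width ≤ s → x s = y s) :=
    fun hx => ⟨x, hx, fun s => ⟨by omega, fun _ => rfl⟩⟩
  have upd : ∀ r l, r < o.width → (x r).length ≤ l.length + 1 → ψ (Function.update x r l) ≠ 0 →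
      ∃ y, ψ y ≠ 0 ∧ ∀ s, (x s).length ≤ (y s).length + 1 ∧ (o.width ≤ s → x s = y s) := by
    intro r l hr hl hx
    refine ⟨_, hx, fun s => ?_⟩
    by_cases hs : s = r
    · subst hs
      simp only [Function.update_self]
      exact ⟨hl, fun h => absurd h (by omega)⟩
    · simp [hs]
  cases o with
  | id => exact self h
  | fresh r =>
    simp only [act, Kraus.fresh] at h
    split at h
    · rename_i l hl
      exact upd r l (by simp [width]) (by simp [hl]) h
    · exact absurd rfl h
  | hadamard r =>
    simp only [act, Kraus.hadamard] at h
    split at h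
    · exact self h
    · rename_i b l hl
      by_cases h0 : ψ (Function.update x r (false :: l)) = 0
      · by_cases h1 : ψ (Function.update x r (true :: l)) = 0
        · simp [h0, h1] at h
        · exact upd r _ (by simp [width]) (by simp [hl]) h1
      · exact upd r _ (by simp [width]) (by simp [hl]) h0
  | tGate r =>
    simp only [act, Kraus.tGate] at h
    split at h
    · exact self (right_ne_zero_of_mul h)
    · exact self h
  | cnot r s =>
    simp only [act, Kraus.cnot] at h
    split at h
    · exact self h
    · split at h
      · rename_i h1 h2
        exact upd s _ (by simp [width]) (by simp [h2]) h
      · exact self h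
  | move r s =>
    simp only [act, Kraus.move] at h
    split at h
    · exact absurd rfl h
    · rename_i b l hl
      refine ⟨_, h, fun t => ?_⟩
      by_cases h1 : t = r
      · subst h1
        by_cases h2 : t = s
        · subst h2
          simp [hl]
        · simp [h2, width]
          omega
      · by_cases h2 : t = s
        · subst h2
          simp [h1, hl, width]
        · simp [h1, h2]
  | readTop r b => exact upd r _ (by simp [width]) (by simp; omega) h
  | isEmpty r =>
    simp only [act, Kraus.isEmpty] at h
    split at h
    · exact self h
    · exact absurd rfl h
  | nonEmpty r =>
    simp only [act, Kraus.nonEmpty] at h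
    split at h
    · exact absurd rfl h
    · exact self h

theorem exists_of_conj_ne_zero (o : KrausOp) (ρ : QMat) (x y : QStore) (h : o.conj ρ x y ≠ 0) :
    ∃ x' y', ρ x' y' ≠ 0 ∧
      (∀ s, (x s).length ≤ (x' s).length + 1 ∧ (o.width ≤ s → x s = x' s)) ∧
      ∀ s, (y s).length ≤ (y' s).length + 1 ∧ (o.width ≤ s → y s = y' s) := by
  obtain ⟨x', hx', h1⟩ := o.exists_of_act_ne_zero _ x h
  obtain ⟨y', hy', h2⟩ := o.exists_of_act_ne_zero _ y (star_ne_zero.mp hx')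
  exact ⟨x', y', star_ne_zero.mp hy', h1, h2⟩

theorem conj_supportedOn {o : KrausOp} {ρ : QMat} {W B : ℕ} (ho : o.width ≤ W)
    (h : ρ.SupportedOn (StackBound W B)) : (o.conj ρ).SupportedOn (StackBound W (B + 1)) := by
  intro x y hxy
  obtain ⟨x', y', hne, hx, hy⟩ := o.exists_of_conj_ne_zero ρ x y hxy
  obtain ⟨h1, h2⟩ := h x' y' hne
  constructor
  · exact ⟨fun s hs => by rw [(hx s).2 (by omega), h1.1 s hs],
      fun s => by have := (hx s).1; have := h1.2 s; omega⟩
  · exact ⟨fun s hs => by rw [(hy s).2 (by omega), h2.1 s hs],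
      fun s => by have := (hy s).1; have := h2.2 s; omega⟩

theorem conj_rankOne (o : KrausOp) (v : QStore → ℂ) :
    o.conj (QMat.rankOne v) = QMat.rankOne (o.act v) := by
  funext x y
  have h1 : ∀ x', (fun y' => star (v x' * star (v y'))) = star (v x') • v := by
    intro x'; funext y'; simp
  have h2 : (fun x' => star (o.act (fun y' => star (v x' * star (v y'))) y)) =
      star (o.act v y) • v := by
    funext x'
    rw [h1, act_smul]
    simp [mul_comm]
  change o.act (fun x' => star (o.act (fun y' => star (v x' * star (v y'))) y)) x = _
  rw [h2, act_smul]
  simp [mul_comm, QMat.rankOne]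

end KrausOp

/-- `ρ` is a finite sum of operators `v v†`. -/
def QMat.IsGram (ρ : QMat) : Prop :=
  ∃ (n : ℕ) (v : Fin n → QStore → ℂ), ρ = ∑ i, QMat.rankOne (v i)

/-- A (v v†) A† = (A v)(A v)†. Positivity in this form passes through every elementary operator
without a discussion of adjoints on infinitely many basis states. -/
theorem QMat.IsGram.conj {ρ : QMat} (h : ρ.IsGram) (o : KrausOp) : (o.conj ρ).IsGram := by
  obtain ⟨n, v, rfl⟩ := h
  refine ⟨n, fun i => o.act (v i), ?_⟩
  rw [map_sum]
  exact Finset.sum_congr rfl fun i _ => o.conj_rankOne (v i)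

theorem QMat.IsGram.diag_nonneg {ρ : QMat} (h : ρ.IsGram) (x : QStore) : 0 ≤ ρ x x := by
  obtain ⟨n, v, rfl⟩ := h
  rw [Matrix.sum_apply]
  exact Finset.sum_nonneg fun i _ => mul_star_self_nonneg _

theorem QMat.IsGram.tr_nonneg {ρ : QMat} (h : ρ.IsGram) {p : QStore → Prop}
    (hρ : ρ.SupportedOn p) (hp : {x | p x}.Finite) : 0 ≤ ρ.tr := by
  rw [QMat.tr, tsum_eq_sum' (s := (hρ.finite_diag hp).toFinset) (by simp)]
  exact Finset.sum_nonneg fun x _ => h.diag_nonneg x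

end

/-! ### Trace identities for the elementary operators. -/

noncomputable section

open scoped ComplexOrder

namespace KrausOp

theorem tr_isEmpty_add_nonEmpty (r : ℕ) {ρ : QMat} {p : QStore → Prop} (hρ : ρ.SupportedOn p)
    (hp : {x | p x}.Finite) : ((isEmpty r).conj ρ).tr + ((nonEmpty r).conj ρ).tr = ρ.tr := by
  have hfin := hρ.finite_diag hp
  unfold QMat.tr
  rw [← Summable.tsum_add]
  · congr 1
    funext x
    simp only [conj_apply, Kraus.sandwich, act, Kraus.isEmpty, Kraus.nonEmpty]
    cases x r <;> simp
  all_goals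
    refine summable_of_hasFiniteSupport (hfin.subset fun x hx => ?_)
    simp only [conj_apply, Kraus.sandwich, act, Kraus.isEmpty, Kraus.nonEmpty,
      Function.mem_support] at hx ⊢
    cases h : x r <;> simp_all

theorem nonEmpty_diag (r : ℕ) (ρ : QMat) (x : QStore) :
    (nonEmpty r).conj ρ x x = if x r = [] then 0 else ρ x x := by
  simp only [conj_apply, Kraus.sandwich, act, Kraus.nonEmpty]
  cases x r <;> simp

/-- Popping from `r` and pushing on `s` is a bijection between the stores nonempty at `r` and those
nonempty at `s`, with the reverse move as its inverse, also when `r = s`. It carries one diagonal to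
the other. -/
theorem tr_move (r s : ℕ) (ρ : QMat) : ((move r s).conj ρ).tr = ((nonEmpty r).conj ρ).tr := by
  unfold QMat.tr
  have h1 : ∀ (a b : ℕ) (x : QStore), x a ≠ [] → ∀ y, y =
      Function.update (Function.update x a (x a).tail) b
        ((x a).headI :: (Function.update x a (x a).tail) b) →
      y b ≠ [] ∧ Function.update (Function.update y b (y b).tail) a
        ((y b).headI :: (Function.update y b (y b).tail) a) = x := by
    intro a b x hx y hy
    have hb : y b = (x a).headI :: (Function.update x a (x a).tail) b := by rw [hy]; simp
    have hab : Function.update y b (y b).tail = Function.update x a (x a).tail := by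
      rw [hb, hy]
      simp
    refine ⟨by rw [hb]; simp, ?_⟩
    rw [hab, hb]
    simp only [List.headI, Function.update_self, Function.update_idem]
    cases h : x a with
    | nil => exact absurd h hx
    | cons c l => rw [List.tail_cons, ← h]; simp
  let g : {x : QStore // x r ≠ []} → {x : QStore // x s ≠ []} := fun x =>
    ⟨Function.update (Function.update x.1 r (x.1 r).tail) s
      ((x.1 r).headI :: (Function.update x.1 r (x.1 r).tail) s), (h1 r s x.1 x.2 _ rfl).1⟩
  let g' : {x : QStore // x s ≠ []} → {x : QStore // x r ≠ []} := fun x =>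
    ⟨Function.update (Function.update x.1 s (x.1 s).tail) r
      ((x.1 s).headI :: (Function.update x.1 s (x.1 s).tail) r), (h1 s r x.1 x.2 _ rfl).1⟩
  let e : {x : QStore // x s ≠ []} ≃ {x : QStore // x r ≠ []} :=
    { toFun := g'
      invFun := g
      left_inv := fun x => Subtype.ext (h1 s r x.1 x.2 _ rfl).2
      right_inv := fun x => Subtype.ext (h1 r s x.1 x.2 _ rfl).2 }
  have hm : ∀ x : QStore, (move r s).conj ρ x x =
      if x s = [] then 0 else
        ρ (Function.update (Function.update x s (x s).tail) r
            ((x s).headI :: (Function.update x s (x s).tail) r))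
          (Function.update (Function.update x s (x s).tail) r
            ((x s).headI :: (Function.update x s (x s).tail) r)) := by
    intro x
    simp only [conj_apply, Kraus.sandwich, act, Kraus.move]
    cases x s <;> simp
  rw [← tsum_subtype_eq_of_support_subset (s := {x : QStore | x s ≠ []}),
    ← tsum_subtype_eq_of_support_subset (s := {x : QStore | x r ≠ []})]
  · refine (e.tsum_eq (fun x => (nonEmpty r).conj ρ x.1 x.1)).symm.trans ?_ |>.symm
    refine tsum_congr fun x => ?_
    rw [hm, nonEmpty_diag, if_neg x.2, if_neg (e x).2]
    rfl
  · intro x hx h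
    exact hx (by simp only [nonEmpty_diag]; exact if_pos h)
  · intro x hx h
    exact hx (by simp only [hm]; exact if_pos h)

theorem tr_fresh (r : ℕ) (ρ : QMat) : ((fresh r).conj ρ).tr = ρ.tr := by
  unfold QMat.tr
  have hinj : Function.Injective fun y : QStore => Function.update y r (false :: y r) := by
    intro y z h
    funext s
    by_cases hs : s = r
    · subst hs
      simpa using congrFun h s
    · simpa [hs] using congrFun h s
  rw [← hinj.tsum_eq]
  · refine tsum_congr fun y => ?_
    simp [conj_apply, Kraus.sandwich, act, Kraus.fresh]
  · intro x hx
    simp only [conj_apply, Kraus.sandwich, act, Kraus.fresh, Function.mem_support] at hx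
    split at hx
    · rename_i l hl
      exact ⟨Function.update x r l, by simp [← hl]⟩
    · exact absurd rfl hx

theorem tr_tGate (r : ℕ) (ρ : QMat) : ((tGate r).conj ρ).tr = ρ.tr := by
  unfold QMat.tr
  refine tsum_congr fun x => ?_
  simp only [conj_apply, Kraus.sandwich, act, Kraus.tGate]
  split
  · have : Complex.exp (Complex.I * (Real.pi / 4 : ℝ)) *
        star (Complex.exp (Complex.I * (Real.pi / 4 : ℝ))) = 1 := by
      rw [Complex.star_def, Complex.mul_conj, Complex.normSq_eq_norm_sq, mul_comm,
        Complex.norm_exp_ofReal_mul_I]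
      simp
    rw [star_mul', star_star, ← mul_assoc, this, one_mul]
  · simp

theorem tr_cnot (r s : ℕ) (ρ : QMat) : ((cnot r s).conj ρ).tr = ρ.tr := by
  unfold QMat.tr
  by_cases hrs : r = s
  · refine tsum_congr fun x => ?_
    simp [conj_apply, Kraus.sandwich, act, Kraus.cnot, hrs]
  -- The gate permutes basis states by an involution, since the control is on a different stack than
  -- the target.
  let f : QStore → QStore := fun x => match x r, x s with
    | true :: _, b :: l => Function.update x s ((!b) :: l)
    | _, _ => x
  have hf : Function.Involutive f := by
    intro x
    by_cases h : ∃ l b l', x r = true :: l ∧ x s = b :: l'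
    · obtain ⟨l, b, l', h1, h2⟩ := h
      have e : f x = Function.update x s ((!b) :: l') := by simp only [f, h1, h2]
      have e1 : f x r = true :: l := by rw [e, Function.update_of_ne hrs, h1]
      have e2 : f x s = (!b) :: l' := by rw [e, Function.update_self]
      have e3 : f (f x) = Function.update (f x) s ((!!b) :: l') := by
        conv_lhs => rw [show f (f x) = (match f x r, f x s with
          | true :: _, b :: l => Function.update (f x) s ((!b) :: l)
          | _, _ => f x) from rfl, e1, e2]
      rw [e3, e, Bool.not_not, Function.update_idem, ← h2, Function.update_eq_self]
    · have e : f x = x := by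
        simp only [f]
        split
        · rename_i h1 h2
          exact absurd ⟨_, _, _, h1, h2⟩ h
        · rfl
      rw [e, e]
  rw [← (hf.toPerm f).tsum_eq (fun x => ρ x x)]
  refine tsum_congr fun x => ?_
  change _ = ρ (f x) (f x)
  simp only [conj_apply, Kraus.sandwich, act, Kraus.cnot, hrs, f, if_false]
  cases h1 : x r with
  | nil => simp
  | cons a l =>
    cases a with
    | false => simp
    | true =>
      cases h2 : x s <;> simp

/-- Flipping the top bit of `r` pairs up basis states, and the gate preserves the sum of the two
diagonal entries of a pair. Summing over all states gives twice the trace on both sides. -/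
theorem tr_hadamard (r : ℕ) {ρ : QMat} {W B : ℕ} (hρ : ρ.SupportedOn (StackBound W B))
    (hW : r < W) : ((hadamard r).conj ρ).tr = ρ.tr := by
  have hfin := hρ.finite_diag (StackBound.finite W B)
  let f : QStore → QStore := fun x => match x r with
    | [] => x
    | b :: l => Function.update x r ((!b) :: l)
  have f_nil : ∀ x : QStore, x r = [] → f x = x := by
    intro x h
    simp only [f, h]
  have f_cons : ∀ (x : QStore) b l, x r = b :: l → f x = Function.update x r ((!b) :: l) := by
    intro x b l h
    simp only [f, h]
  have hf : Function.Involutive f := by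
    intro x
    cases h : x r with
    | nil => rw [f_nil x h, f_nil x h]
    | cons b l => rw [f_cons x b l h, f_cons _ (!b) l (by simp)]; simp [← h]
  have key : ∀ x, (hadamard r).conj ρ x x + (hadamard r).conj ρ (f x) (f x) =
      ρ x x + ρ (f x) (f x) := by
    have h2 : ((Real.sqrt 2 : ℝ) : ℂ) * (Real.sqrt 2 : ℝ) = 2 := by
      rw [← Complex.ofReal_mul, Real.mul_self_sqrt (by norm_num)]
      norm_num
    have h0 : ((Real.sqrt 2 : ℝ) : ℂ) ≠ 0 := by
      intro h
      rw [h] at h2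
      norm_num at h2
    intro x
    simp only [conj_apply, Kraus.sandwich, act]
    cases h : x r with
    | nil => simp [f_nil x h, Kraus.hadamard, h]
    | cons b l =>
      have hx : x = Function.update x r (b :: l) := by simp [← h]
      rw [f_cons x b l h]
      generalize hA : ρ (Function.update x r (false :: l)) (Function.update x r (false :: l)) = A
      generalize hB : ρ (Function.update x r (false :: l)) (Function.update x r (true :: l)) = B
      generalize hC : ρ (Function.update x r (true :: l)) (Function.update x r (false :: l)) = C
      generalize hD : ρ (Function.update x r (true :: l)) (Function.update x r (true :: l)) = D
      have e1 : ρ x x + ρ (Function.update x r ((!b) :: l)) (Function.update x r ((!b) :: l)) =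
          A + D := by
        conv_lhs => rw [hx]
        cases b <;> simp [hA, hD, add_comm]
      rw [e1]
      cases b <;>
      · simp [Kraus.hadamard, h, hA, hB, hC, hD]
        field_simp
        linear_combination (-A - D) * h2
  unfold QMat.tr
  have hs1 : Summable fun x => ρ x x := summable_of_hasFiniteSupport hfin
  have hs2 : Summable fun x => (hadamard r).conj ρ x x :=
    summable_of_hasFiniteSupport
      ((conj_supportedOn (o := hadamard r) hW hρ).finite_diag (StackBound.finite W (B + 1)))
  have h1 := (hf.toPerm f).tsum_eq (fun x => ρ x x)
  have h2 := (hf.toPerm f).tsum_eq (fun x => (hadamard r).conj ρ x x)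
  have h3 := ((hf.toPerm f).summable_iff (f := fun x => ρ x x)).mpr hs1
  have h4 := ((hf.toPerm f).summable_iff (f := fun x => (hadamard r).conj ρ x x)).mpr hs2
  have h5 : ∑' x, ((hadamard r).conj ρ x x + (hadamard r).conj ρ (f x) (f x)) =
    ∑' x, (ρ x x + ρ (f x) (f x)) := tsum_congr key
  have h6 := Summable.tsum_add hs2 h4
  have h7 := Summable.tsum_add hs1 h3
  change (∑' x, ((hadamard r).conj ρ x x + (hadamard r).conj ρ (f x) (f x))) =
    _ + ∑' x, (hadamard r).conj ρ (f x) (f x) at h6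
  change (∑' x, (ρ x x + ρ (f x) (f x))) = _ + ∑' x, ρ (f x) (f x) at h7
  rw [h6, h7] at h5
  change (∑' x, (hadamard r).conj ρ (f x) (f x)) = _ at h2
  change (∑' x, ρ (f x) (f x)) = _ at h1
  rw [h1, h2] at h5
  linear_combination h5 / 2

/-- The outcome `b` collects exactly the diagonal entries at stores whose stack `r` has top bit `b`.
-/
theorem tr_readTop (r : ℕ) {ρ : QMat} {p : QStore → Prop} (hρ : ρ.SupportedOn p)
    (hp : {x | p x}.Finite) :
    ((readTop r false).conj ρ).tr + ((readTop r true).conj ρ).tr = ((nonEmpty r).conj ρ).tr := by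
  have hfin := hρ.finite_diag hp
  have h : ∀ b, ((readTop r b).conj ρ).tr =
      ∑' x : QStore, if (x r).head? = some b then ρ x x else 0 := by
    intro b
    unfold QMat.tr
    have hinj : Function.Injective fun y : QStore => Function.update y r (b :: y r) := by
      intro y z h
      funext s
      by_cases hs : s = r
      · subst hs
        simpa using congrFun h s
      · simpa [hs] using congrFun h s
    symm
    rw [← hinj.tsum_eq]
    · refine tsum_congr fun y => ?_
      simp [conj_apply, Kraus.sandwich, act, Kraus.readTop]
    · intro x hx
      simp only [Function.mem_support] at hx
      split at hx
      · rename_i hl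
        obtain ⟨l, hl⟩ := List.head?_eq_some_iff.mp hl
        exact ⟨Function.update x r l, by simp [← hl]⟩
      · exact absurd rfl hx
  rw [h, h]
  unfold QMat.tr
  rw [← Summable.tsum_add]
  · refine tsum_congr fun x => ?_
    rw [nonEmpty_diag]
    rcases x r with _ | ⟨_ | _, l⟩ <;> simp
  all_goals
    refine summable_of_hasFiniteSupport (hfin.subset fun x hx => ?_)
    simp only [Function.mem_support] at hx ⊢
    split at hx
    · exact hx
    · exact absurd rfl hx

end KrausOp

end

/-! ### Bounded configurations; trace and positivity along runs. -/

noncomputable section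

open scoped ComplexOrder

/-- A bound on the stacks that occur in a program. -/
def Prog.width : Prog → ℕ
  | .skip => 0
  | .seq P Q => max P.width Q.width
  | .push s _ | .pop s => s + 1
  | .ifTop s P Q => max (s + 1) (max P.width Q.width)
  | .loop s P => max (s + 1) P.width
  | .fresh r | .hadamard r | .tGate r => r + 1
  | .cnot r s | .move r s | .measure r s => max r s + 1
  | .qloop r P => max (r + 1) P.width

namespace Config

/-- All stacks of a configuration satisfy `StackBound W B`, and so do those of its program. -/
structure Bounded (W B : ℕ) (C : Config) : Prop where
  todo : ∀ P ∈ C.todo, P.width ≤ W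
  bits : StackBound W B C.bits
  qubits : QMat.SupportedOn C.qubits (StackBound W B)

theorem branches_bounded {W B : ℕ} {L : List Prog} {c : ℕ → List Bool}
    (hL : ∀ P ∈ L, P.width ≤ W) (hc : StackBound W B c) :
    ∀ b ∈ branches L c, (∀ P ∈ b.1, P.width ≤ W) ∧ StackBound W (B + 1) b.2.1 ∧
      b.2.2.width ≤ W := by
  have hc' : StackBound W (B + 1) c := hc.mono le_rfl (by omega)
  have hpush : ∀ s b, s < W → StackBound W (B + 1) (Function.update c s (b :: c s)) :=
    fun s b hs => hc'.update hs (by have := hc.2 s; simp; omega)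
  have hpop : ∀ s, s < W → StackBound W (B + 1) (Function.update c s (c s).tail) :=
    fun s hs => hc'.update hs (by have := hc.2 s; simp; omega)
  intro b hb
  cases L with
  | nil =>
    simp only [branches, List.mem_singleton] at hb
    subst hb
    exact ⟨by simp, hc', by simp [KrausOp.width]⟩
  | cons P R =>
    have hP := hL P (by simp)
    have hR : ∀ Q ∈ R, Q.width ≤ W := fun Q hQ => hL Q (by simp [hQ])
    cases P <;> simp only [branches, Prog.width, max_le_iff] at hb hP
    case ifTop =>
      split at hb <;> simp only [List.mem_singleton] at hb <;> subst hb <;>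
        simp_all [KrausOp.width]
    case loop =>
      split at hb <;> simp only [List.mem_singleton] at hb <;> subst hb <;>
        simp_all [KrausOp.width, Prog.width]
    case push s b' =>
      simp only [List.mem_singleton] at hb
      subst hb
      exact ⟨hR, hpush s b' hP, by simp [KrausOp.width]⟩
    all_goals
      simp only [List.mem_cons, List.not_mem_nil, or_false] at hb
      rcases hb with rfl | rfl | rfl <;>
        simp_all [KrausOp.width, Prog.width]

theorem Bounded.applyBranch {W B : ℕ} {L : List Prog} {c : ℕ → List Bool} {ρ : QMat}
    (h : Bounded W B ⟨L, c, ρ⟩) {b} (hb : b ∈ branches L c) :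
    Bounded W (B + 1) (applyBranch ρ b) := by
  obtain ⟨h1, h2, h3⟩ := branches_bounded h.todo h.bits b hb
  exact ⟨h1, h2, KrausOp.conj_supportedOn h3 h.qubits⟩

theorem mem_run_succ {n : ℕ} {L : List Prog} {c : ℕ → List Bool} {ρ : QMat} {C' : Config} :
    C' ∈ run (n + 1) ⟨L, c, ρ⟩ ↔ ∃ b ∈ branches L c, C' ∈ run n (applyBranch ρ b) := by
  rw [run_succ, step_eq]
  simp

theorem Bounded.run {W B : ℕ} {C : Config} (h : Bounded W B C) (n : ℕ) :
    ∀ C' ∈ C.run n, Bounded W (B + n) C' := by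
  induction n generalizing C B with
  | zero => simpa [run_zero] using h
  | succ n ih =>
    intro C' hC'
    obtain ⟨b, hb, h'⟩ := mem_run_succ.mp hC'
    have := ih (h.applyBranch hb) C' h'
    rwa [Nat.add_assoc, Nat.add_comm 1] at this

theorem sum_run_succ (n : ℕ) (L : List Prog) (c : ℕ → List Bool) (ρ : QMat) (g : Config → ℂ) :
    ((run (n + 1) ⟨L, c, ρ⟩).map g).sum =
      ((branches L c).map fun b => ((run n (applyBranch ρ b)).map g).sum).sum := by
  rw [run_succ, step_eq, List.flatMap_map, List.map_flatMap, List.flatMap_def,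
    List.sum_flatten, List.map_map]
  rfl

/-- The Kraus operators of each instruction are complete, including the branch for an empty stack.
Thus total probability is conserved. -/
theorem sum_branches_tr {W B : ℕ} {L : List Prog} {c : ℕ → List Bool} {ρ : QMat}
    (h : Bounded W B ⟨L, c, ρ⟩) :
    ((branches L c).map fun b => (b.2.2.conj ρ).tr).sum = ρ.tr := by
  have hfin := StackBound.finite W B
  have hρ := h.qubits
  cases L with
  | nil => simp [branches, KrausOp.conj_id]
  | cons P R =>
    have hP := h.todo P (by simp)
    cases P <;> simp only [branches]
    case ifTop => split <;> simp [KrausOp.conj_id]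
    case loop => split <;> simp [KrausOp.conj_id]
    case fresh r => simp [KrausOp.tr_fresh]
    case hadamard r => simp [KrausOp.tr_hadamard r hρ hP]
    case tGate r => simp [KrausOp.tr_tGate]
    case cnot r s => simp [KrausOp.tr_cnot]
    case move r s =>
      simp [KrausOp.tr_move, ← KrausOp.tr_isEmpty_add_nonEmpty r hρ hfin, add_comm]
    case measure r s =>
      have := KrausOp.tr_readTop r hρ hfin
      simp [← KrausOp.tr_isEmpty_add_nonEmpty r hρ hfin, ← this]
      ring
    case qloop r P =>
      simp [← KrausOp.tr_isEmpty_add_nonEmpty r hρ hfin, add_comm]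
    all_goals simp [KrausOp.conj_id]

theorem sum_run_tr {W B : ℕ} {C : Config} (h : Bounded W B C) (n : ℕ) :
    ((C.run n).map fun C => QMat.tr C.qubits).sum = QMat.tr C.qubits := by
  induction n generalizing C B with
  | zero => simp [run_zero]
  | succ n ih =>
    obtain ⟨L, c, ρ⟩ := C
    rw [sum_run_succ, ← sum_branches_tr h]
    congr 1
    refine List.map_congr_left fun b hb => ?_
    exact ih (h.applyBranch hb)

theorem isGram_run {C : Config} (h : QMat.IsGram C.qubits) (n : ℕ) :
    ∀ C' ∈ C.run n, QMat.IsGram C'.qubits := by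
  induction n generalizing C with
  | zero => simpa [run_zero] using h
  | succ n ih =>
    intro C' hC'
    obtain ⟨b, hb, h'⟩ := mem_run_succ.mp hC'
    exact ih (C := applyBranch C.qubits b) (h.conj _) C' h'

theorem run_zero_qubits {C : Config} (h : C.qubits = 0) (n : ℕ) :
    ∀ C' ∈ C.run n, C'.qubits = 0 := by
  obtain ⟨L, c, ρ⟩ := C
  change ρ = 0 at h
  subst h
  rw [run_eq_paths]
  intro C' hC'
  obtain ⟨p, _, rfl⟩ := List.mem_map.mp hC'
  simp

theorem run_halted (c : ℕ → List Bool) (ρ : QMat) (n : ℕ) : run n ⟨[], c, ρ⟩ = [⟨[], c, ρ⟩] := by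
  induction n with
  | zero => rfl
  | succ n ih => rw [run_succ]; simp [step, ih]

end Config

open Config

/-! ## Weighted executions -/

/-- `Exec R Q T C v`: within `T` steps all branches of `C` with nonzero operator reach the program
list `R`, in situations where the postcondition `Q` holds, and the values that `Q` assigns to these
sum up to `v`. -/
inductive Exec (R : List Prog) (Q : (ℕ → List Bool) → QMat → ℂ → Prop) : ℕ → Config → ℂ → Prop
  | done {T c ρ v} : Q c ρ v → Exec R Q T ⟨R, c, ρ⟩ v
  -- A branch with zero operator may be abandoned anywhere, in accordance with the halting clause of
  -- `QPT`.
  | zero {T L c} : Exec R Q T ⟨L, c, 0⟩ 0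
  | step {T L c ρ} (F : List Prog × (ℕ → List Bool) × KrausOp → ℂ) :
      (∀ b ∈ branches L c, Exec R Q T (applyBranch ρ b) (F b)) →
      Exec R Q (T + 1) ⟨L, c, ρ⟩ ((branches L c).map F).sum

namespace Exec

variable {R R' : List Prog} {Q Q' : (ℕ → List Bool) → QMat → ℂ → Prop} {T T' : ℕ} {C : Config}
  {v : ℂ}

theorem mono (h : Exec R Q T C v) (hT : T ≤ T') : Exec R Q T' C v := by
  induction h generalizing T' with
  | done h => exact done h
  | zero => exact zero
  | step F _ ih =>
    obtain ⟨T', rfl⟩ := Nat.exists_eq_add_of_le' (Nat.le_of_add_left_le hT)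
    exact step F fun b hb => ih b hb (by omega)

theorem bind (h : Exec R Q T C v)
    (h' : ∀ c ρ v, Q c ρ v → Exec R' Q' T' ⟨R, c, ρ⟩ v) : Exec R' Q' (T + T') C v := by
  induction h with
  | done h => exact (h' _ _ _ h).mono (by omega)
  | zero => exact zero
  | step F _ ih =>
    rw [Nat.add_right_comm]
    exact step F ih

theorem imp (h : Exec R Q T C v) (h' : ∀ c ρ v, Q c ρ v → Q' c ρ v) : Exec R Q' T C v :=
  h.bind (T' := 0) fun c ρ v hQ => done (h' c ρ v hQ)

/-- Subroutines leave a scalar multiple `a • ρ` behind; this allows the rest of the program to be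
analysed for `ρ` alone. -/
theorem smul {L : List Prog} {c : ℕ → List Bool} {ρ : QMat} (h : Exec R Q T ⟨L, c, ρ⟩ v) (a : ℂ)
    (hQ : ∀ (c : ℕ → List Bool) (ρ : QMat) (v : ℂ), Q c ρ v → Q c (a • ρ) (a * v)) : Exec R Q T ⟨L, c, a • ρ⟩ (a * v) := by
  generalize hC : Config.mk L c ρ = C at h
  induction h generalizing L c ρ with
  | done h => cases hC; exact done (hQ _ _ _ h)
  | zero => cases hC; simpa using zero
  | step F _ ih =>
    cases hC
    rw [← List.sum_map_mul_left]
    refine step (fun b => a * F b) fun b hb => ?_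
    have := ih b hb (L := b.1) (c := b.2.1) (ρ := b.2.2.conj _) rfl
    simpa [applyBranch] using this

theorem one {L L' : List Prog} {c c' : ℕ → List Bool} {ρ : QMat} {o : KrausOp}
    (hb : branches L c = [(L', c', o)]) (h : Exec R Q T ⟨L', c', o.conj ρ⟩ v) :
    Exec R Q (T + 1) ⟨L, c, ρ⟩ v := by
  have := step (R := R) (Q := Q) (T := T) (L := L) (c := c) (ρ := ρ) (fun _ => v) (by
    intro b h'
    rw [hb, List.mem_singleton] at h'
    subst h'
    exact h)
  simpa [hb] using this

theorem one' {L L' : List Prog} {c c' : ℕ → List Bool} {ρ : QMat}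
    (hb : branches L c = [(L', c', .id)]) (h : Exec R Q T ⟨L', c', ρ⟩ v) :
    Exec R Q (T + 1) ⟨L, c, ρ⟩ v :=
  one hb (by rwa [KrausOp.conj_id])

/-- In `Exec.step` values are attached to branches and not to positions in the list, so the two
branches have to be distinct to carry different values. -/
theorem two {L L1 L2 : List Prog} {c c1 c2 : ℕ → List Bool} {ρ : QMat} {o1 o2 : KrausOp}
    {v1 v2 : ℂ} (hb : branches L c = [(L1, c1, o1), (L2, c2, o2)])
    (h1 : Exec R Q T ⟨L1, c1, o1.conj ρ⟩ v1) (h2 : Exec R Q T ⟨L2, c2, o2.conj ρ⟩ v2)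
    (hne : (L1, c1, o1) ≠ (L2, c2, o2)) :
    Exec R Q (T + 1) ⟨L, c, ρ⟩ (v1 + v2) := by
  classical
  have := step (R := R) (Q := Q) (T := T) (L := L) (c := c) (ρ := ρ)
    (fun b => if b = (L1, c1, o1) then v1 else v2) (by
    intro b h'
    rw [hb] at h'
    simp only [List.mem_cons, List.not_mem_nil, or_false] at h'
    rcases h' with rfl | rfl
    · simpa [applyBranch] using h1
    · simpa [hne.symm, applyBranch] using h2)
  simpa [hb, hne.symm] using this

/-- Entry into the logic: a halting run becomes a derivation. By `hg` the unfinished branches, whose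
operator is zero, contribute nothing. -/
theorem of_run {C : Config} (g : Config → ℂ) (hg : ∀ C, C.qubits = 0 → g C = 0)
    (h : ∀ C' ∈ C.run T, C'.todo = [] ∨ C'.qubits = 0) :
    Exec [] (fun c ρ v => ⟨[], c, ρ⟩ ∈ C.run T ∧ v = g ⟨[], c, ρ⟩) T C ((C.run T).map g).sum := by
  induction T generalizing C with
  | zero =>
    obtain ⟨L, c, ρ⟩ := C
    simp only [run_zero, List.mem_singleton, forall_eq, List.map_cons, List.map_nil,
      List.sum_cons, List.sum_nil, add_zero] at h ⊢
    rcases h with h | h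
    · change L = [] at h
      subst h
      exact done ⟨rfl, rfl⟩
    · rw [hg _ h]
      change ρ = 0 at h
      subst h
      exact zero
  | succ T ih =>
    obtain ⟨L, c, ρ⟩ := C
    rw [sum_run_succ]
    refine step _ fun b hb => ?_
    refine (ih fun C' hC' => h C' (mem_run_succ.mpr ⟨b, hb, hC'⟩)).imp ?_
    rintro c' ρ' v ⟨h1, h2⟩
    exact ⟨mem_run_succ.mpr ⟨b, hb, h1⟩, h2⟩

/-- Exit from the logic: a single derivation yields both halting and the expected value. -/
theorem to_run {g : Config → ℂ} (hg : ∀ C, C.qubits = 0 → g C = 0)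
    (h : Exec [] (fun c ρ v => v = g ⟨[], c, ρ⟩) T C v) :
    (∀ C' ∈ C.run T, C'.todo = [] ∨ C'.qubits = 0) ∧ ((C.run T).map g).sum = v := by
  induction h with
  | done h =>
    rw [run_halted]
    simp [h]
  | zero =>
    rename_i T L c
    have h0 := run_zero_qubits (C := ⟨L, c, 0⟩) rfl T
    refine ⟨fun C' hC' => Or.inr (h0 C' hC'), ?_⟩
    apply List.sum_eq_zero
    intro x hx
    obtain ⟨C', hC', rfl⟩ := List.mem_map.mp hx
    exact hg _ (h0 C' hC')
  | step F _ ih =>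
    refine ⟨fun C' hC' => ?_, ?_⟩
    · obtain ⟨b, hb, h'⟩ := mem_run_succ.mp hC'
      exact (ih b hb).1 C' h'
    · rw [sum_run_succ]
      congr 1
      exact List.map_congr_left fun b hb => (ih b hb).2

end Exec

end

noncomputable section

open scoped ComplexOrder

open Config

/-! ## Relocation of programs -/

/-- The program `P` with all stacks moved up by `K`. -/
def Prog.shift (K : ℕ) : Prog → Prog
  | .skip => .skip
  | .seq P Q => .seq (P.shift K) (Q.shift K)
  | .push s b => .push (s + K) b
  | .pop s => .pop (s + K)
  | .ifTop s P Q => .ifTop (s + K) (P.shift K) (Q.shift K)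
  | .loop s P => .loop (s + K) (P.shift K)
  | .fresh r => .fresh (r + K)
  | .hadamard r => .hadamard (r + K)
  | .tGate r => .tGate (r + K)
  | .cnot r s => .cnot (r + K) (s + K)
  | .move r s => .move (r + K) (s + K)
  | .measure r s => .measure (r + K) (s + K)
  | .qloop r P => .qloop (r + K) (P.shift K)

theorem Prog.shift_injective (K : ℕ) : Function.Injective (Prog.shift K) := by
  intro P
  induction P with
  | seq P Q ihP ihQ =>
    intro P' h
    cases P' <;> simp only [Prog.shift, reduceCtorEq, Prog.seq.injEq] at h ⊢
    exact ⟨ihP h.1, ihQ h.2⟩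
  | ifTop s P Q ihP ihQ =>
    intro P' h
    cases P' <;> simp only [Prog.shift, reduceCtorEq, Prog.ifTop.injEq] at h ⊢
    exact ⟨by omega, ihP h.2.1, ihQ h.2.2⟩
  | loop s P ih =>
    intro P' h
    cases P' <;> simp only [Prog.shift, reduceCtorEq, Prog.loop.injEq] at h ⊢
    exact ⟨by omega, ih h.2⟩
  | qloop s P ih =>
    intro P' h
    cases P' <;> simp only [Prog.shift, reduceCtorEq, Prog.qloop.injEq] at h ⊢
    exact ⟨by omega, ih h.2⟩
  | _ =>
    intro P' h
    cases P' <;> simp_all [Prog.shift]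

/-- An elementary operator with all stacks moved up by `K`. -/
def KrausOp.shift (K : ℕ) : KrausOp → KrausOp
  | .id => .id
  | .fresh r => .fresh (r + K)
  | .hadamard r => .hadamard (r + K)
  | .tGate r => .tGate (r + K)
  | .cnot r s => .cnot (r + K) (s + K)
  | .move r s => .move (r + K) (s + K)
  | .readTop r b => .readTop (r + K) b
  | .isEmpty r => .isEmpty (r + K)
  | .nonEmpty r => .nonEmpty (r + K)

theorem KrausOp.shift_injective (K : ℕ) : Function.Injective (KrausOp.shift K) := by
  intro o o' h
  cases o <;> cases o' <;> simp_all [KrausOp.shift]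

/-- The stacks from `K` on, renumbered. -/
def stacksFrom (K : ℕ) (x : ℕ → List Bool) : ℕ → List Bool := fun s => x (s + K)

/-- The stacks below `K` from `x` and those from `K` on from `z`. -/
def joinStacks (K : ℕ) (x z : ℕ → List Bool) : ℕ → List Bool :=
  fun s => if s < K then x s else z (s - K)

/-- The stacks below `K`, with all others emptied. -/
def stacksBelow (K : ℕ) (x : ℕ → List Bool) : ℕ → List Bool := joinStacks K x fun _ => []

theorem stacksFrom_joinStacks (K : ℕ) (x z : ℕ → List Bool) :
    stacksFrom K (joinStacks K x z) = z := by
  funext s; simp [stacksFrom, joinStacks]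

theorem stacksBelow_joinStacks (K : ℕ) (x z : ℕ → List Bool) :
    stacksBelow K (joinStacks K x z) = stacksBelow K x := by
  funext s; simp only [stacksBelow, joinStacks]; split <;> rfl

theorem joinStacks_stacksFrom (K : ℕ) (x : ℕ → List Bool) :
    joinStacks K x (stacksFrom K x) = x := by
  funext s
  simp only [joinStacks, stacksFrom]
  split
  · rfl
  · rw [Nat.sub_add_cancel (by omega)]

theorem joinStacks_update (K : ℕ) (x z : ℕ → List Bool) (s : ℕ) (l : List Bool) :
    joinStacks K x (Function.update z s l) = Function.update (joinStacks K x z) (s + K) l := by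
  funext t
  by_cases h : t = s + K
  · subst h; simp [joinStacks]
  · rw [Function.update_of_ne h]
    simp only [joinStacks]
    split
    · rfl
    · rw [Function.update_of_ne (by omega)]

theorem joinStacks_injective (K : ℕ) (x : ℕ → List Bool) : Function.Injective (joinStacks K x) := by
  intro z z' h
  rw [← stacksFrom_joinStacks K x z, h, stacksFrom_joinStacks]

theorem joinStacks_add (K : ℕ) (x z : ℕ → List Bool) (s : ℕ) : joinStacks K x z (s + K) = z s := by
  simp [joinStacks]

/-- The tensor product of an operator on the stacks from `K` on and one on the stacks below. -/
def QMat.tensor (K : ℕ) (ρ σ : QMat) : QMat := fun x y =>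
  ρ (stacksFrom K x) (stacksFrom K y) * σ (stacksBelow K x) (stacksBelow K y)

namespace KrausOp

/-- The shifted operator never looks below `K`, so it acts on each slice with fixed lower stacks
separately. -/
theorem act_shift (K : ℕ) (o : KrausOp) (ψ : QStore → ℂ) (x : QStore) :
    (o.shift K).act ψ x = o.act (fun z => ψ (joinStacks K x z)) (stacksFrom K x) := by
  have h : ∀ s, stacksFrom K x s = x (s + K) := fun s => rfl
  cases o <;> simp only [shift, act, Kraus.fresh, Kraus.hadamard, Kraus.tGate, Kraus.cnot,
      Kraus.move, Kraus.readTop, Kraus.isEmpty, Kraus.nonEmpty, h, joinStacks_stacksFrom,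
      joinStacks_update, Nat.add_right_cancel_iff]
  case move r s =>
    cases x (s + K) with
    | nil => rfl
    | cons b l =>
      simp only
      congr 3
      by_cases hrs : r = s
      · subst hrs; simp
      · rw [Function.update_of_ne (by omega), Function.update_of_ne hrs, h]

theorem conj_tensor (K : ℕ) (o : KrausOp) (ρ σ : QMat) :
    (o.shift K).conj (QMat.tensor K ρ σ) = QMat.tensor K (o.conj ρ) σ := by
  funext x y
  have hx : ∀ x z : QStore, stacksFrom K (joinStacks K x z) = z := stacksFrom_joinStacks K
  have hb : ∀ x z : QStore, stacksBelow K (joinStacks K x z) = stacksBelow K x :=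
    stacksBelow_joinStacks K
  set a := σ (stacksBelow K x) (stacksBelow K y) with ha
  have h1 : ∀ z, (fun w => star (QMat.tensor K ρ σ (joinStacks K x z) (joinStacks K y w))) =
      star a • fun w => star (ρ z w) := by
    intro z
    funext w
    simp only [QMat.tensor, hx, hb, ← ha, star_mul', Pi.smul_apply, smul_eq_mul]
    ring
  have h2 : (fun z => star ((o.shift K).act
      (fun y' => star (QMat.tensor K ρ σ (joinStacks K x z) y')) y)) =
      a • fun z => star (o.act (fun w => star (ρ z w)) (stacksFrom K y)) := by
    funext z
    rw [act_shift, h1, act_smul]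
    simp
  calc (o.shift K).conj (QMat.tensor K ρ σ) x y
      = (o.shift K).act (fun x' => star ((o.shift K).act
          (fun y' => star (QMat.tensor K ρ σ x' y')) y)) x := rfl
    _ = o.act (a • fun z => star (o.act (fun w => star (ρ z w)) (stacksFrom K y)))
          (stacksFrom K x) := by rw [act_shift, h2]
    _ = _ := by
      rw [act_smul]
      exact mul_comm _ _

end KrausOp

namespace Config

theorem branches_append (P : Prog) (L R : List Prog) (c : ℕ → List Bool) :
    branches (P :: L ++ R) c = (branches (P :: L) c).map fun b => (b.1 ++ R, b.2) := by
  cases P <;> simp only [branches, List.cons_append] <;> (try split) <;> rfl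

theorem branches_shift (K : ℕ) (P : Prog) (L : List Prog) (x a : ℕ → List Bool) :
    branches ((P :: L).map (Prog.shift K)) (joinStacks K x a) = (branches (P :: L) a).map
      fun b => (b.1.map (Prog.shift K), joinStacks K x b.2.1, b.2.2.shift K) := by
  cases P <;> simp only [branches, List.map_cons, Prog.shift, joinStacks_add, joinStacks_update,
    KrausOp.shift, List.map_nil] <;> split <;> rfl

end Config

namespace Exec

variable {R : List Prog} {Q : (ℕ → List Bool) → QMat → ℂ → Prop} {T : ℕ} {v : ℂ}

/-- Injectivity of `e` allows the values to be pulled back from the relabelled branches to the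
original ones. -/
theorem step_map {L L' : List Prog} {c c' : ℕ → List Bool} {ρ : QMat}
    {e : List Prog × (ℕ → List Bool) × KrausOp → List Prog × (ℕ → List Bool) × KrausOp}
    (he : Function.Injective e) (hb : branches L' c' = (branches L c).map e)
    (F : List Prog × (ℕ → List Bool) × KrausOp → ℂ)
    (h : ∀ b ∈ branches L c, Exec R Q T (applyBranch ρ (e b)) (F b)) :
    Exec R Q (T + 1) ⟨L', c', ρ⟩ ((branches L c).map F).sum := by
  have : Nonempty (List Prog × (ℕ → List Bool) × KrausOp) := ⟨([], c, .id)⟩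
  have hinv := Function.leftInverse_invFun he
  have : ((branches L c).map F).sum = ((branches L' c').map (F ∘ Function.invFun e)).sum := by
    rw [hb, List.map_map]
    congr 1
    refine List.map_congr_left fun b _ => ?_
    simp [hinv b]
  rw [this]
  refine step _ fun b' hb' => ?_
  rw [hb] at hb'
  obtain ⟨b, hbm, rfl⟩ := List.mem_map.mp hb'
  simpa [hinv b] using h b hbm

theorem append {L : List Prog} {c : ℕ → List Bool} {ρ : QMat} (h : Exec [] Q T ⟨L, c, ρ⟩ v)
    (R : List Prog) : Exec R Q T ⟨L ++ R, c, ρ⟩ v := by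
  generalize hC : Config.mk L c ρ = C at h
  induction h generalizing L c ρ with
  | done h => cases hC; exact done h
  | zero => cases hC; exact zero
  | @step _ L₁ c₁ ρ₁ F _ ih =>
    cases hC
    cases L₁ with
    -- A halted configuration idles, whereas `[] ++ R` would already start on `R`. The idle step is
    -- dropped and only the time bound is relaxed.
    | nil =>
      simp only [branches, List.map_cons, List.map_nil, List.sum_cons, List.sum_nil, add_zero]
      refine Exec.mono ?_ (Nat.le_succ _)
      have := ih ([], c₁, .id) (by simp [branches]) (L := []) (c := c₁) (ρ := KrausOp.id.conj _) rfl
      rwa [KrausOp.conj_id] at this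
    | cons P L =>
      refine step_map (e := fun b => (b.1 ++ R, b.2)) ?_ (branches_append P L R c₁) F fun b hb => ?_
      · rintro ⟨a, b⟩ ⟨a', b'⟩ h
        simpa using h
      · exact ih b hb (L := b.1) (c := b.2.1) (ρ := b.2.2.conj _) rfl

theorem shift {L : List Prog} {a : ℕ → List Bool} {ρ : QMat} (h : Exec [] Q T ⟨L, a, ρ⟩ v)
    (K : ℕ) (x : ℕ → List Bool) (σ : QMat) :
    Exec [] (fun c ρ' v => ∃ a' ρA, Q a' ρA v ∧ c = joinStacks K x a' ∧ ρ' = QMat.tensor K ρA σ) T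
      ⟨L.map (Prog.shift K), joinStacks K x a, QMat.tensor K ρ σ⟩ v := by
  generalize hC : Config.mk L a ρ = C at h
  induction h generalizing L a ρ with
  | done h => cases hC; exact done ⟨_, _, h, rfl, rfl⟩
  | zero =>
    cases hC
    have : QMat.tensor K 0 σ = 0 := by funext x y; simp [QMat.tensor]
    rw [this]
    exact zero
  | @step _ L₁ a₁ ρ₁ F _ ih =>
    cases hC
    cases L₁ with
    | nil =>
      simp only [branches, List.map_cons, List.map_nil, List.sum_cons, List.sum_nil, add_zero]
      refine Exec.mono ?_ (Nat.le_succ _)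
      have := ih ([], a₁, .id) (by simp [branches]) (L := []) (a := a₁) (ρ := KrausOp.id.conj _) rfl
      rwa [KrausOp.conj_id] at this
    | cons P L =>
      refine step_map ?_ (branches_shift K P L x a₁) F fun b hb => ?_
      · rintro ⟨L1, c1, o1⟩ ⟨L2, c2, o2⟩ h
        simp only [Prod.mk.injEq] at h ⊢
        exact ⟨(Prog.shift_injective K).list_map h.1, joinStacks_injective K x h.2.1,
          KrausOp.shift_injective K h.2.2⟩
      · have := ih b hb (L := b.1) (a := b.2.1) (ρ := b.2.2.conj _) rfl
        rwa [← KrausOp.conj_tensor] at this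

end Exec

end

noncomputable section

open scoped ComplexOrder

open Config

/-! ## Classical programs -/

/-- From the classical memory `c` the program `P` reaches `c'` within `T` steps, without branching
or touching the quantum memory. -/
def Prog.Det (P : Prog) (T : ℕ) (c c' : ℕ → List Bool) : Prop :=
  ∀ (R R' : List Prog) (Q : (ℕ → List Bool) → QMat → ℂ → Prop) (T' : ℕ) (ρ : QMat) (v : ℂ),
    Exec R' Q T' ⟨R, c', ρ⟩ v → Exec R' Q (T' + T) ⟨P :: R, c, ρ⟩ v

namespace Prog.Det

variable {P P' : Prog} {T T' : ℕ} {c c' c'' : ℕ → List Bool} {s : ℕ}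

theorem mono (h : P.Det T c c') (hT : T ≤ T') : P.Det T' c c' :=
  fun R R' Q T1 ρ v h' => (h R R' Q T1 ρ v h').mono (by omega)

theorem skip (c : ℕ → List Bool) : Prog.skip.Det 1 c c :=
  fun _ _ _ _ _ _ h => Exec.one' rfl h

theorem push (s : ℕ) (b : Bool) (c : ℕ → List Bool) :
    (Prog.push s b).Det 1 c (Function.update c s (b :: c s)) :=
  fun _ _ _ _ _ _ h => Exec.one' rfl h

theorem pop (s : ℕ) (c : ℕ → List Bool) :
    (Prog.pop s).Det 1 c (Function.update c s (c s).tail) :=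
  fun _ _ _ _ _ _ h => Exec.one' rfl h

theorem seq (h : P.Det T c c') (h' : P'.Det T' c' c'') :
    (Prog.seq P P').Det (T' + T + 1) c c'' :=
  fun _ _ _ T1 _ _ hR => Exec.one' (T := T1 + (T' + T)) rfl
    ((h _ _ _ _ _ _ (h' _ _ _ _ _ _ hR)).mono (by omega))

theorem ifTop_pos (hs : (c s).head? = some true) (h : P.Det T c c') :
    (Prog.ifTop s P P').Det (T + 1) c c' :=
  fun _ _ _ _ _ _ hR => Exec.one' (by simp [branches, hs]) (h _ _ _ _ _ _ hR)

theorem ifTop_neg (hs : (c s).head? ≠ some true) (h : P'.Det T c c') :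
    (Prog.ifTop s P P').Det (T + 1) c c' :=
  fun _ _ _ _ _ _ hR => Exec.one' (by simp [branches, hs]) (h _ _ _ _ _ _ hR)

theorem loop_nil (hs : c s = []) : (Prog.loop s P).Det 1 c c :=
  fun _ _ _ _ _ _ hR => Exec.one' (by simp [branches, hs]) hR

theorem loop_cons (hs : c s ≠ []) (h : P.Det T c c') (h' : (Prog.loop s P).Det T' c' c'') :
    (Prog.loop s P).Det (T' + T + 1) c c'' :=
  fun R _ _ T1 _ _ hR => Exec.one' (T := T1 + (T' + T)) (L' := P :: .loop s P :: R) (c' := c)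
    (by simp [branches, hs]) ((h _ _ _ _ _ _ (h' _ _ _ _ _ _ hR)).mono (by omega))

end Prog.Det

/-- Empty the classical stack `s`. -/
def Prog.clear (s : ℕ) : Prog := .loop s (.pop s)

theorem Prog.clear_det (s : ℕ) (c : ℕ → List Bool) :
    (Prog.clear s).Det (2 * (c s).length + 1) c (Function.update c s []) := by
  generalize hl : c s = l
  induction l generalizing c with
  | nil =>
    have : Function.update c s [] = c := by rw [← hl]; simp
    rw [this]
    exact Det.loop_nil hl
  | cons b l ih =>
    have := ih (Function.update c s (c s).tail) (by simp [hl])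
    rw [Function.update_idem] at this
    exact (Det.loop_cons (by simp [hl]) (Det.pop s c) this).mono (by simp; omega)

/-- Empty the classical stacks `1, …, n`. -/
def Prog.clearAll : ℕ → Prog
  | 0 => .skip
  | n + 1 => .seq (Prog.clearAll n) (.clear (n + 1))

theorem Prog.clearAll_det (n B : ℕ) (c : ℕ → List Bool) (hB : ∀ s, (c s).length ≤ B) :
    (Prog.clearAll n).Det (n * (2 * B + 2) + 1) c
      fun s => if 1 ≤ s ∧ s ≤ n then [] else c s := by
  induction n with
  | zero =>
    have : (fun s => if 1 ≤ s ∧ s ≤ 0 then [] else c s) = c := by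
      funext s; rw [if_neg (by omega)]
    rw [this]
    exact (Det.skip c).mono (by omega)
  | succ n ih =>
    have h := Prog.clear_det (n + 1) fun s => if 1 ≤ s ∧ s ≤ n then [] else c s
    have he : Function.update (fun s => if 1 ≤ s ∧ s ≤ n then [] else c s) (n + 1) [] =
        fun s => if 1 ≤ s ∧ s ≤ n + 1 then [] else c s := by
      funext s
      by_cases hs : s = n + 1
      · subst hs; simp
      · rw [Function.update_of_ne hs]
        congr 1
        simp only [eq_iff_iff]
        omega
    rw [he] at h
    refine (ih.seq h).mono ?_
    have := hB (n + 1)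
    rw [Nat.add_mul, one_mul]
    simp only [show ¬(1 ≤ n + 1 ∧ n + 1 ≤ n) by omega, if_false]
    omega

/-! ## Discarding qubits -/

/-- Measure away all qubits of the quantum stack `r`, with the classical stack `s` as scratch. -/
def Prog.discard (r s : ℕ) : Prog := .qloop r (.seq (.measure r s) (.pop s))

/-- Measure away all qubits of the quantum stacks `0, …, n - 1`. -/
def Prog.discardAll (s : ℕ) : ℕ → Prog
  | 0 => .skip
  | n + 1 => .seq (Prog.discardAll s n) (.discard n s)

theorem KrausOp.conj_isEmpty_apply (r : ℕ) (ρ : QMat) (x y : QStore) :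
    (KrausOp.isEmpty r).conj ρ x y = if x r = [] ∧ y r = [] then ρ x y else 0 := by
  simp only [conj_apply, Kraus.sandwich, act, Kraus.isEmpty]
  cases x r <;> cases y r <;> simp

theorem KrausOp.conj_nonEmpty_apply (r : ℕ) (ρ : QMat) (x y : QStore) :
    (KrausOp.nonEmpty r).conj ρ x y = if x r ≠ [] ∧ y r ≠ [] then ρ x y else 0 := by
  simp only [conj_apply, Kraus.sandwich, act, Kraus.nonEmpty]
  cases x r <;> cases y r <;> simp

theorem KrausOp.conj_readTop_apply (r : ℕ) (b : Bool) (ρ : QMat) (x y : QStore) :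
    (KrausOp.readTop r b).conj ρ x y =
      ρ (Function.update x r (b :: x r)) (Function.update y r (b :: y r)) := by
  simp [conj_apply, Kraus.sandwich, act, Kraus.readTop]

/-- Each outcome is popped again, so all branches return to the same classical memory, and measuring
conserves the trace. Hence a value proportional to the trace is unaffected. -/
theorem Prog.discard_exec {r s : ℕ} {p : QStore → Prop} (hp : {x | p x}.Finite)
    (hpop : ∀ x b, p (Function.update x r (b :: x r)) → p x) (c : ℕ → List Bool) (V : ℂ)
    (R : List Prog) (B : ℕ) (ρ : QMat)
    (hρ : ρ.SupportedOn fun x => p x ∧ (x r).length ≤ B) :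
    Exec R (fun c' ρ' v => c' = c ∧ (ρ'.SupportedOn fun x => p x ∧ x r = []) ∧ v = ρ'.tr * V)
      (4 * B + 1) ⟨.discard r s :: R, c, ρ⟩ (ρ.tr * V) := by
  have hfin : {x | p x}.Finite := hp
  have hρp : ρ.SupportedOn p := hρ.mono fun x hx => hx.1
  induction B generalizing ρ with
  | zero =>
    rw [← KrausOp.tr_isEmpty_add_nonEmpty r hρp hfin,
      add_comm ((KrausOp.isEmpty r).conj ρ).tr, add_mul]
    have h0 : (KrausOp.nonEmpty r).conj ρ = 0 := by
      funext x y
      rw [KrausOp.conj_nonEmpty_apply]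
      split
      · rename_i h
        by_contra hne
        exact h.1 (List.length_eq_zero_iff.mp (Nat.le_zero.mp (hρ x y hne).1.2))
      · rfl
    refine Exec.two (by rfl) ?_ (Exec.done ⟨rfl, ?_, rfl⟩) (by simp)
    · rw [h0]
      simpa [QMat.tr] using Exec.zero
    · intro x y hxy
      rw [KrausOp.conj_isEmpty_apply] at hxy
      obtain ⟨⟨hx, hy⟩, hne⟩ := ite_ne_right_iff.mp hxy
      exact ⟨⟨(hρp x y hne).1, hx⟩, (hρp x y hne).2, hy⟩
  | succ B ih =>
    rw [← KrausOp.tr_isEmpty_add_nonEmpty r hρp hfin,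
      add_comm ((KrausOp.isEmpty r).conj ρ).tr, add_mul]
    -- Four steps per qubit: `qloop`, `seq`, `measure` and `pop`.
    refine Exec.two (T := 4 * B + 4) (by rfl) ?_ (Exec.done ⟨rfl, ?_, rfl⟩) (by simp)
    · set σ := (KrausOp.nonEmpty r).conj ρ with hσ
      have hσs : σ.SupportedOn fun x => p x ∧ (x r).length ≤ B + 1 := by
        intro x y hxy
        rw [hσ, KrausOp.conj_nonEmpty_apply] at hxy
        exact hρ x y (ite_ne_right_iff.mp hxy).2
      have hσp : σ.SupportedOn p := hσs.mono fun x hx => hx.1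
      -- Inside the loop the stack is nonempty, so the third branch of `measure` vanishes.
      have hσe : (KrausOp.isEmpty r).conj σ = 0 := by
        funext x y
        rw [hσ, KrausOp.conj_isEmpty_apply, KrausOp.conj_nonEmpty_apply]
        split
        · rename_i h; simp [h.1]
        · rfl
      have hσσ : (KrausOp.nonEmpty r).conj σ = σ := by
        funext x y
        rw [hσ, KrausOp.conj_nonEmpty_apply, KrausOp.conj_nonEmpty_apply]
        split <;> rfl
      refine Exec.one' (T := 4 * B + 3) rfl ?_
      have htr : σ.tr * V = ((branches (.measure r s :: .pop s :: .discard r s :: R) c).map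
          fun b => (b.2.2.conj σ).tr * V).sum := by
        conv_lhs => rw [← hσσ, ← KrausOp.tr_readTop r hσp hfin]
        simp [branches, hσe, QMat.tr, add_mul]
      have hread : ∀ b, Exec R
          (fun c' ρ' v => c' = c ∧ (ρ'.SupportedOn fun x => p x ∧ x r = []) ∧ v = ρ'.tr * V)
          (4 * B + 2) ⟨.pop s :: .discard r s :: R, Function.update c s (b :: c s),
            (KrausOp.readTop r b).conj σ⟩ (((KrausOp.readTop r b).conj σ).tr * V) := by
        intro b
        have hsup : ((KrausOp.readTop r b).conj σ).SupportedOn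
            fun x => p x ∧ (x r).length ≤ B := by
          intro x y hxy
          rw [KrausOp.conj_readTop_apply] at hxy
          obtain ⟨h1, h2⟩ := hσs _ _ hxy
          simp only [Function.update_self, List.length_cons, Nat.add_le_add_iff_right] at h1 h2
          exact ⟨⟨hpop x b h1.1, h1.2⟩, hpop y b h2.1, h2.2⟩
        have := Prog.Det.pop s (Function.update c s (b :: c s))
        simp only [Function.update_self, List.tail_cons, Function.update_idem,
          Function.update_eq_self] at this
        exact this _ _ _ _ _ _ (ih _ hsup (hsup.mono fun x hx => hx.1))
      rw [htr]
      refine Exec.step _ fun b hb => ?_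
      simp only [branches, List.mem_cons, List.not_mem_nil, or_false] at hb
      rcases hb with rfl | rfl | rfl
      · exact hread false
      · exact hread true
      · simp only [applyBranch, hσe]
        simpa [QMat.tr] using Exec.zero
    · intro x y hxy
      rw [KrausOp.conj_isEmpty_apply] at hxy
      obtain ⟨⟨hx, hy⟩, hne⟩ := ite_ne_right_iff.mp hxy
      exact ⟨⟨(hρp x y hne).1, hx⟩, (hρp x y hne).2, hy⟩

theorem Prog.discardAll_exec {s W B : ℕ} (c : ℕ → List Bool) (V : ℂ) (n : ℕ) (R : List Prog)
    (ρ : QMat) (hρ : ρ.SupportedOn (StackBound W B)) :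
    Exec R (fun c' ρ' v => c' = c ∧
        (ρ'.SupportedOn fun x => StackBound W B x ∧ ∀ r < n, x r = []) ∧ v = ρ'.tr * V)
      (n * (4 * B + 2) + 1) ⟨Prog.discardAll s n :: R, c, ρ⟩ (ρ.tr * V) := by
  induction n generalizing R with
  | zero =>
    refine Exec.one' rfl (Exec.done ⟨rfl, hρ.mono fun x hx => ⟨hx, ?_⟩, rfl⟩)
    intro r hr
    omega
  | succ n ih =>
    have := (ih (.discard n s :: R)).bind (R' := R) (T' := 4 * B + 1)
      (Q' := fun c' ρ' v => c' = c ∧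
        (ρ'.SupportedOn fun x => StackBound W B x ∧ ∀ r < n + 1, x r = []) ∧ v = ρ'.tr * V) ?_
    · refine Exec.one' (T := n * (4 * B + 2) + 1 + (4 * B + 1)) rfl this |>.mono ?_
      ring_nf
      omega
    · rintro c' ρ' v ⟨rfl, hρ', rfl⟩
      refine (Prog.discard_exec (p := fun x => StackBound W B x ∧ ∀ r < n, x r = []) ?_ ?_ c' V R B
        ρ' (hρ'.mono fun x hx => ⟨hx, hx.1.2 n⟩)).imp ?_
      · exact (StackBound.finite W B).subset fun x hx => hx.1
      · rintro x b ⟨h1, h2⟩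
        refine ⟨⟨fun t ht => ?_, fun t => ?_⟩, fun t ht => ?_⟩
        · have h3 := h1.1 t ht
          by_cases htn : t = n
          · subst htn; simp at h3
          · rwa [Function.update_of_ne htn] at h3
        · have h3 := h1.2 t
          by_cases htn : t = n
          · subst htn
            simp only [Function.update_self, List.length_cons] at h3
            omega
          · rwa [Function.update_of_ne htn] at h3
        · have h3 := h2 t ht
          rwa [Function.update_of_ne (by omega)] at h3
      · rintro c'' ρ'' v ⟨rfl, h, rfl⟩
        refine ⟨rfl, h.mono fun x hx => ⟨hx.1.1, fun t ht => ?_⟩, rfl⟩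
        rcases Nat.lt_succ_iff_lt_or_eq.mp ht with h' | h'
        · exact hx.1.2 t h'
        · rw [h']; exact hx.2

end

noncomputable section

open scoped ComplexOrder Classical

open Config

/-! ## Subroutines -/

/-- The operator `φ` on the quantum stack `0`, with all other stacks empty. -/
def QMat.place (φ : QOp) : QMat := fun x y =>
  if (∀ r, r ≠ 0 → x r = [] ∧ y r = []) then φ (x 0) (y 0) else 0

/-- The classical memory with `w` on stack `0`. -/
def bitsOf (w : List Bool) : ℕ → List Bool := Function.update (fun _ => []) 0 w

theorem Prog.start_eq (P : Prog) (w : List Bool) (φ : QOp) :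
    P.start w φ = ⟨[P], bitsOf w, QMat.place φ⟩ := rfl

theorem QMat.place_supportedOn {φ : QOp} {n : ℕ} (hφ : φ.OnQubits n) :
    (QMat.place φ).SupportedOn (StackBound 1 n) := by
  intro x y hxy
  obtain ⟨h1, h2⟩ := ite_ne_right_iff.mp hxy
  obtain ⟨h3, h4⟩ := hφ _ _ h2
  constructor
  · refine ⟨fun s hs => (h1 s (by omega)).1, fun s => ?_⟩
    by_cases hs : s = 0
    · subst hs; exact h3.le
    · rw [(h1 s hs).1]; simp
  · refine ⟨fun s hs => (h1 s (by omega)).2, fun s => ?_⟩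
    by_cases hs : s = 0
    · subst hs; exact h4.le
    · rw [(h1 s hs).2]; simp

theorem bitsOf_stackBound (w : List Bool) : StackBound 1 w.length (bitsOf w) := by
  constructor
  · intro s hs
    rw [bitsOf, Function.update_of_ne (by omega)]
  · intro s
    by_cases hs : s = 0
    · subst hs; simp [bitsOf]
    · simp [bitsOf, hs]

theorem Prog.start_bounded (P : Prog) (w : List Bool) {φ : QOp} {n : ℕ} (hφ : φ.OnQubits n) :
    Config.Bounded (max P.width 1) (w.length + n) (P.start w φ) where
  todo := by
    intro Q hQ
    rw [Prog.start_eq, List.mem_singleton] at hQ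
    subst hQ
    exact le_max_left _ _
  bits := (bitsOf_stackBound w).mono (le_max_right _ _) (by omega)
  qubits := (QMat.place_supportedOn hφ).mono fun _ hx => hx.mono (le_max_right _ _) (by omega)

theorem QMat.place_empty_apply (x y : QStore) :
    QMat.place QOp.empty x y = if x = (fun _ => []) ∧ y = (fun _ => []) then 1 else 0 := by
  have h : ∀ z : QStore, z = (fun _ => []) ↔ (∀ r, r ≠ 0 → z r = []) ∧ z 0 = [] := by
    intro z
    constructor
    · rintro rfl; simp
    · rintro ⟨h1, h2⟩
      funext r
      by_cases hr : r = 0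
      · rw [hr, h2]
      · exact h1 r hr
  simp only [QMat.place, QOp.empty]
  rw [h, h]
  by_cases h1 : ∀ r, r ≠ 0 → x r = [] ∧ y r = []
  · rw [if_pos h1]
    congr 1
    simp only [eq_iff_iff]
    constructor
    · rintro ⟨h2, h3⟩
      exact ⟨⟨fun r hr => (h1 r hr).1, h2⟩, fun r hr => (h1 r hr).2, h3⟩
    · rintro ⟨h2, h3⟩
      exact ⟨h2.2, h3.2⟩
  · rw [if_neg h1, if_neg]
    rintro ⟨h2, h3⟩
    exact h1 fun r hr => ⟨h2.1 r hr, h3.1 r hr⟩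

theorem QMat.tr_place (φ : QOp) : (QMat.place φ).tr = ∑' x, φ x x := by
  unfold QMat.tr
  have hinj : Function.Injective bitsOf := by
    intro w w' h
    simpa [bitsOf] using congrFun h 0
  rw [← hinj.tsum_eq]
  · refine tsum_congr fun w => ?_
    rw [QMat.place, if_pos]
    · simp [bitsOf]
    · intro r hr
      simp [bitsOf, hr]
  · intro x hx
    obtain ⟨h1, h2⟩ := ite_ne_right_iff.mp hx
    refine ⟨x 0, ?_⟩
    funext r
    by_cases hr : r = 0
    · subst hr; simp [bitsOf]
    · simp [bitsOf, hr, (h1 r hr).1]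

theorem QMat.tr_place_empty : (QMat.place QOp.empty).tr = 1 := by
  rw [QMat.tr_place, tsum_eq_single []]
  · simp [QOp.empty]
  · intro l hl
    simp [QOp.empty, hl]

theorem QOp.empty_onQubits : QOp.empty.OnQubits 0 := by
  intro x y h
  obtain ⟨⟨rfl, rfl⟩, _⟩ := ite_ne_right_iff.mp h
  exact ⟨rfl, rfl⟩

theorem QMat.tr_smul (a : ℂ) (ρ : QMat) : QMat.tr (a • ρ) = a * ρ.tr := by
  unfold QMat.tr
  rw [← tsum_mul_left]
  rfl

theorem QMat.tr_zero : QMat.tr 0 = 0 := by simp [QMat.tr]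

/-- The expectation of `g y` for the output `y` after `T` steps, as a complex number. -/
def Prog.expectC (P : Prog) (w : List Bool) (φ : QOp) (T : ℕ) (g : List Bool → ℂ) : ℂ :=
  (((P.start w φ).run T).map fun C => QMat.tr C.qubits * g (C.bits 0)).sum

/-- Run `P` and then clean up all stacks except for the classical stack `0`. -/
def Prog.sub (P : Prog) : Prog :=
  .seq P (.seq (Prog.discardAll (max P.width 1) (max P.width 1)) (Prog.clearAll (max P.width 1)))

/-- A bound on the running time of `P.sub` in terms of a bound `W` on the stacks in `P`, a bound
`T` on the running time of `P` and the total length `n` of the inputs. -/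
def subTime (W n T : ℕ) : ℕ :=
  T + (W * (4 * (n + T) + 2) + W * (2 * (n + T) + 2) + 4)

/-- After the clean-up only the empty store is left, so the operator is determined by one entry,
which is its trace and hence the weight of the branch. All that survives of a subroutine is its
output and a scalar, and its stacks are ready for the next call once the output is cleared. -/
theorem Prog.sub_exec (P : Prog) (w : List Bool) {φ : QOp} {n T : ℕ} (hφ : φ.OnQubits n)
    (hT : ∀ C ∈ (P.start w φ).run T, C.todo = [] ∨ C.qubits = 0) (g : List Bool → ℂ) :
    Exec [] (fun c ρ v => ∃ (out : List Bool) (a : ℂ), out.length ≤ w.length + n + T ∧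
        c = bitsOf out ∧ ρ = a • QMat.place QOp.empty ∧ v = a * g out)
      (subTime (max P.width 1) (w.length + n) T) ⟨[P.sub], bitsOf w, QMat.place φ⟩
      (P.expectC w φ T g) := by
  -- The inputs lie on stack `0` even if `P` never mentions it, hence the maximum with `1`.
  set W := max P.width 1 with hW
  set B := w.length + n + T with hB
  have hrun := (Exec.of_run (fun C => QMat.tr C.qubits * g (C.bits 0))
    (fun C hC => by simp [hC, QMat.tr_zero]) hT).append
    [.seq (Prog.discardAll W W) (Prog.clearAll W)]
  refine (Exec.one' (T := T + (W * (4 * B + 2) + W * (2 * B + 2) + 3)) rfl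
    (hrun.bind ?_)).mono (by rw [subTime, ← hB]; omega)
  rintro c ρ v ⟨hC, rfl⟩
  obtain ⟨-, hbits, hqubits⟩ := (P.start_bounded w hφ).run T _ hC
  change StackBound W B c at hbits
  change QMat.SupportedOn ρ (StackBound W B) at hqubits
  refine Exec.one' (T := W * (4 * B + 2) + 1 + (W * (2 * B + 2) + 1)) rfl
    ((Prog.discardAll_exec c (g (c 0)) W [Prog.clearAll W] ρ hqubits).bind ?_)
    |>.mono (by omega)
  rintro c' ρ' v ⟨rfl, hsup, rfl⟩
  refine (Prog.clearAll_det W B c' hbits.2 [] _ _ 0 ρ' _ (Exec.done ?_)).mono (by omega)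
  have hρ' : ρ' = ρ' (fun _ => []) (fun _ => []) • QMat.place QOp.empty := by
    funext x y
    rw [Matrix.smul_apply, QMat.place_empty_apply]
    have hz : ∀ z, (StackBound W B z ∧ ∀ r < W, z r = []) → z = fun _ => [] := by
      rintro z ⟨h1, h2⟩
      funext r
      by_cases hr : r < W
      · exact h2 r hr
      · exact h1.1 r (by omega)
    split
    · rename_i h
      rw [h.1, h.2]
      simp
    · rename_i h
      by_contra hne
      simp only [smul_zero] at hne
      exact h ⟨hz x (hsup x y hne).1, hz y (hsup x y hne).2⟩
  refine ⟨c' 0, ρ' (fun _ => []) (fun _ => []), hbits.2 0, ?_, hρ', ?_⟩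
  · funext s
    by_cases hs : s = 0
    · subst hs; simp [bitsOf]
    · by_cases hsW : s ≤ W
      · rw [if_pos ⟨by omega, hsW⟩]
        simp [bitsOf, hs]
      · rw [if_neg (by omega), hbits.1 s (by omega)]
        simp [bitsOf, hs]
  · conv_lhs => rw [hρ', QMat.tr_smul, QMat.tr_place_empty, mul_one]

/-- Calling a subroutine that lives on the stacks from `K` on. -/
theorem Prog.call_exec (P : Prog) (K : ℕ) (w : List Bool) {φ : QOp} {n T : ℕ}
    (hφ : φ.OnQubits n) (hT : ∀ C ∈ (P.start w φ).run T, C.todo = [] ∨ C.qubits = 0)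
    (g : List Bool → ℂ) (c : ℕ → List Bool) (hc : stacksFrom K c = bitsOf w) (σ : QMat)
    (R : List Prog) :
    Exec R (fun c' ρ v => ∃ (out : List Bool) (a : ℂ), out.length ≤ w.length + n + T ∧
        c' = Function.update c K out ∧ ρ = a • QMat.tensor K (QMat.place QOp.empty) σ ∧
        v = a * g out)
      (subTime (max P.width 1) (w.length + n) T)
      ⟨P.sub.shift K :: R, c, QMat.tensor K (QMat.place φ) σ⟩ (P.expectC w φ T g) := by
  have h := ((P.sub_exec w hφ hT g).shift K c σ).append R
  rw [← hc, joinStacks_stacksFrom] at h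
  refine h.imp ?_
  rintro c' ρ v ⟨_, _, ⟨out, a, hl, rfl, rfl, rfl⟩, rfl, rfl⟩
  refine ⟨out, a, hl, ?_, ?_, rfl⟩
  · rw [bitsOf, joinStacks_update, Nat.zero_add]
    funext s
    by_cases hs : s = K
    · subst hs; simp
    · rw [Function.update_of_ne hs, Function.update_of_ne hs]
      simp only [joinStacks]
      split
      · rfl
      · have := congrFun hc (s - K)
        rw [stacksFrom, Nat.sub_add_cancel (by omega), bitsOf,
          Function.update_of_ne (by omega)] at this
        exact this.symm
  · funext x y
    simp [QMat.tensor, mul_assoc]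

end

noncomputable section

open scoped ComplexOrder

open Config

/-! ## Copying and nested counting loops -/

/-- Push the bit `b` on each of the stacks in `ts`. -/
def Prog.pushAll (b : Bool) : List ℕ → Prog
  | [] => .skip
  | t :: ts => .seq (.push t b) (Prog.pushAll b ts)

theorem Prog.pushAll_det (b : Bool) {ts : List ℕ} (hts : ts.Nodup) (c : ℕ → List Bool) :
    (Prog.pushAll b ts).Det (2 * ts.length + 1) c fun i => if i ∈ ts then b :: c i else c i := by
  induction ts generalizing c with
  | nil => simpa [pushAll] using Det.skip c
  | cons t ts ih =>
    rw [List.nodup_cons] at hts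
    have := (Det.push t b c).seq (ih hts.2 (Function.update c t (b :: c t)))
    have he : (fun i => if i ∈ ts then b :: Function.update c t (b :: c t) i
        else Function.update c t (b :: c t) i) = fun i => if i ∈ t :: ts then b :: c i else c i := by
      funext i
      by_cases hi : i = t
      · subst hi; simp [hts.1]
      · simp [hi]
    rw [he] at this
    exact this.mono (by simp; omega)

/-- Empty the stack `s`, pushing its bits one by one on each of the stacks in `ts`. -/
def Prog.spread (s : ℕ) (ts : List ℕ) : Prog :=
  .loop s (.seq (.ifTop s (.pushAll true ts) (.pushAll false ts)) (.pop s))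

theorem Prog.spread_det {s : ℕ} {ts : List ℕ} (hts : ts.Nodup) (hs : s ∉ ts)
    (c : ℕ → List Bool) :
    (Prog.spread s ts).Det ((c s).length * (2 * ts.length + 5) + 1) c
      fun i => if i = s then [] else if i ∈ ts then (c s).reverse ++ c i else c i := by
  generalize hl : c s = l
  induction l generalizing c with
  | nil =>
    have : (fun i => if i = s then [] else if i ∈ ts then ([] : List Bool).reverse ++ c i else c i) =
        c := by
      funext i
      by_cases hi : i = s
      · subst hi; simp [hl]
      · simp [hi]
    rw [this]
    exact (Det.loop_nil hl).mono (by simp)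
  | cons b l ih =>
    have h1 : (Prog.ifTop s (.pushAll true ts) (.pushAll false ts)).Det (2 * ts.length + 2) c
        fun i => if i ∈ ts then b :: c i else c i := by
      cases b with
      | true => exact Det.ifTop_pos (by simp [hl]) (pushAll_det true hts c)
      | false => exact Det.ifTop_neg (by simp [hl]) (pushAll_det false hts c)
    have h2 := h1.seq (Det.pop s _)
    have h3 := ih (Function.update (fun i => if i ∈ ts then b :: c i else c i) s
      (if s ∈ ts then b :: c s else c s).tail) (by simp [hs, hl])
    have he : (fun i => if i = s then [] else if i ∈ ts then
        l.reverse ++ Function.update (fun i => if i ∈ ts then b :: c i else c i) s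
          (if s ∈ ts then b :: c s else c s).tail i
        else Function.update (fun i => if i ∈ ts then b :: c i else c i) s
          (if s ∈ ts then b :: c s else c s).tail i) =
        fun i => if i = s then [] else if i ∈ ts then (b :: l).reverse ++ c i else c i := by
      funext i
      by_cases hi : i = s
      · simp [hi]
      · by_cases hi' : i ∈ ts <;> simp [hi, hi']
    rw [he] at h3
    refine (Det.loop_cons (by simp [hl]) h2 h3).mono ?_
    rw [List.length_cons, Nat.add_mul]
    omega

theorem Prog.spread_singleton_det {s t : ℕ} (hst : s ≠ t) (c : ℕ → List Bool) :
    (Prog.spread s [t]).Det ((c s).length * 7 + 1) c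
      (Function.update (Function.update c t ((c s).reverse ++ c t)) s []) := by
  have h := Prog.spread_det (List.nodup_singleton t) (by simpa using hst) c
  have he : (fun i => if i = s then [] else if i ∈ [t] then (c s).reverse ++ c i else c i) =
      Function.update (Function.update c t ((c s).reverse ++ c t)) s [] := by
    funext i
    by_cases hi : i = s
    · simp [hi]
    · by_cases hi' : i = t
      · subst hi'; simp [hi]
      · simp [hi, hi']
  rw [he] at h
  exact h

/-- The counter of the `j`-th nested loop. -/
def ctr (j : ℕ) : ℕ := 7 + 2 * j

/-- The stack that remembers the counter of the `j`-th nested loop. -/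
def ctrAux (j : ℕ) : ℕ := 8 + 2 * j

/-- Nested loops around `B`, one for each level in `js`. The number of repetitions of each loop is
the length of its counter, and the counter is restored at the end. -/
def Prog.rep (B : Prog) : List ℕ → Prog
  | [] => B
  | j :: js => .seq
      (.loop (ctr j)
        (.seq (.seq (.ifTop (ctr j) (.push (ctrAux j) true) (.push (ctrAux j) false))
          (.pop (ctr j))) (Prog.rep B js)))
      (.spread (ctrAux j) [ctr j])

/-- A bound on the running time of nested loops. -/
def repTime (n T : ℕ) : ℕ → ℕ
  | 0 => T
  | k + 1 => n * (repTime n T k + 6) + (n * 7 + 3)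

/-- `Q i` is the invariant with `i` repetitions left. `S` contains the counter stacks, which the
body has to preserve and which `Q` must not depend on. Each level multiplies the number of
repetitions by `n`, so a fixed program achieves any fixed power of `n`. -/
theorem Prog.rep_exec {B : Prog} {n T : ℕ} {Q : ℕ → (ℕ → List Bool) → QMat → ℂ → Prop}
    {S : Set ℕ}
    (hbody : ∀ i R c ρ v, Q (i + 1) c ρ v →
      Exec R (fun c' ρ' v' => Q i c' ρ' v' ∧ ∀ s ∈ S, c' s = c s) T ⟨B :: R, c, ρ⟩ v)
    (hupd : ∀ i c ρ v s l, s ∈ S → Q i c ρ v → Q i (Function.update c s l) ρ v)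
    (js : List ℕ) (hjs : js.Nodup) (hS : ∀ j ∈ js, ctr j ∈ S ∧ ctrAux j ∈ S)
    (i : ℕ) (R : List Prog) (c : ℕ → List Bool) (ρ : QMat) (v : ℂ)
    (hc : ∀ j ∈ js, (c (ctr j)).length = n ∧ c (ctrAux j) = [])
    (hQ : Q (i + n ^ js.length) c ρ v) :
    Exec R (fun c' ρ' v' => Q i c' ρ' v' ∧ ∀ s ∈ S, c' s = c s) (repTime n T js.length)
      ⟨Prog.rep B js :: R, c, ρ⟩ v := by
  induction js generalizing i R c ρ v with
  | nil => exact hbody i R c ρ v (by simpa using hQ)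
  | cons j js ih =>
    rw [List.nodup_cons] at hjs
    have hj := hS j (by simp)
    have hne : ctr j ≠ ctrAux j := by simp only [ctr, ctrAux]; omega
    have hdis : ∀ j' ∈ js, ctr j' ≠ ctr j ∧ ctr j' ≠ ctrAux j ∧ ctrAux j' ≠ ctr j ∧
        ctrAux j' ≠ ctrAux j := by
      intro j' hj'
      have : j' ≠ j := fun h => hjs.1 (h ▸ hj')
      simp only [ctr, ctrAux]
      omega
    -- Generalised for induction: `l` is the unused part of the counter and `acc` what has already
    -- been moved to the auxiliary stack.
    have hloop : ∀ (l acc : List Bool) (i : ℕ) (R : List Prog) (c : ℕ → List Bool) (ρ : QMat)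
        (v : ℂ), c (ctr j) = l → c (ctrAux j) = acc →
        (∀ j ∈ js, (c (ctr j)).length = n ∧ c (ctrAux j) = []) →
        Q (i + l.length * n ^ js.length) c ρ v →
        Exec R (fun c' ρ' v' => Q i c' ρ' v' ∧ c' (ctr j) = [] ∧
            c' (ctrAux j) = l.reverse ++ acc ∧
            ∀ s ∈ S, s ≠ ctr j → s ≠ ctrAux j → c' s = c s)
          (l.length * (repTime n T js.length + 6) + 1)
          ⟨.loop (ctr j)
            (.seq (.seq (.ifTop (ctr j) (.push (ctrAux j) true) (.push (ctrAux j) false))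
            (.pop (ctr j))) (Prog.rep B js)) :: R, c, ρ⟩ v := by
      intro l
      induction l with
      | nil =>
        intro acc i R c ρ v hl hacc hc hQ
        refine (Det.loop_nil hl _ _ _ 0 _ _ (Exec.done ⟨by simpa using hQ, hl, by simpa using hacc,
          fun _ _ _ _ => rfl⟩)).mono (by omega)
      | cons b l ihl =>
        intro acc i R c ρ v hl hacc hc hQ
        set c₁ := Function.update (Function.update c (ctrAux j) (b :: acc)) (ctr j) l with hc₁
        have hstep : (Prog.seq (.ifTop (ctr j) (.push (ctrAux j) true) (.push (ctrAux j) false))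
            (.pop (ctr j))).Det 4 c c₁ := by
          have h1 : (Prog.ifTop (ctr j) (.push (ctrAux j) true) (.push (ctrAux j) false)).Det 2 c
              (Function.update c (ctrAux j) (b :: acc)) := by
            rw [← hacc]
            cases b with
            | true => exact Det.ifTop_pos (by simp [hl]) (Det.push _ _ _)
            | false => exact Det.ifTop_neg (by simp [hl]) (Det.push _ _ _)
          have h2 := h1.seq (Det.pop (ctr j) _)
          rw [Function.update_of_ne hne, hl] at h2
          exact h2
        have hQ₁ : Q (i + l.length * n ^ js.length + n ^ js.length) c₁ ρ v := by
          refine hupd _ _ _ _ _ _ hj.1 (hupd _ _ _ _ _ _ hj.2 ?_)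
          rw [List.length_cons, Nat.add_mul, one_mul, ← Nat.add_assoc] at hQ
          exact hQ
        have hc₁' : ∀ j' ∈ js, (c₁ (ctr j')).length = n ∧ c₁ (ctrAux j') = [] := by
          intro j' hj'
          obtain ⟨h1, h2, h3, h4⟩ := hdis j' hj'
          rw [hc₁, Function.update_of_ne h1, Function.update_of_ne h2, Function.update_of_ne h3,
            Function.update_of_ne h4]
          exact hc j' hj'
        set X := Prog.loop (ctr j)
            (.seq (.seq (.ifTop (ctr j) (.push (ctrAux j) true) (.push (ctrAux j) false))
            (.pop (ctr j))) (Prog.rep B js)) with hX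
        have hrep := ih hjs.2 (fun j' hj' => hS j' (by simp [hj'])) _ (X :: R) c₁ ρ v hc₁' hQ₁
        have hmain := hstep _ _ _ _ _ _ (hrep.bind (R' := R)
          (T' := l.length * (repTime n T js.length + 6) + 1)
          (Q' := fun c' ρ' v' => Q i c' ρ' v' ∧ c' (ctr j) = [] ∧
            c' (ctrAux j) = (b :: l).reverse ++ acc ∧
            ∀ s ∈ S, s ≠ ctr j → s ≠ ctrAux j → c' s = c s) (by
          rintro c₂ ρ₂ v₂ ⟨hQ₂, hc₂⟩
          have e1 : c₂ (ctr j) = l := by rw [hc₂ _ hj.1, hc₁]; simp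
          have e2 : c₂ (ctrAux j) = b :: acc := by rw [hc₂ _ hj.2, hc₁]; simp [hne.symm]
          refine (ihl (b :: acc) i R c₂ ρ₂ v₂ e1 e2 ?_ hQ₂).imp ?_
          · intro j' hj'
            have := hS j' (by simp [hj'])
            rw [hc₂ _ this.1, hc₂ _ this.2]
            exact hc₁' j' hj'
          · rintro c' ρ' v' ⟨h1, h2, h3, h4⟩
            refine ⟨h1, h2, by simp [h3], fun s hs hs1 hs2 => ?_⟩
            rw [h4 s hs hs1 hs2, hc₂ s hs, hc₁, Function.update_of_ne hs1,
              Function.update_of_ne hs2]))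
        refine (Exec.one' (c' := c) (T := l.length * (repTime n T js.length + 6) + 1 +
            repTime n T js.length + 5)
          (by simp only [hX, branches, hl]; rfl) (Exec.one' rfl (hmain.mono ?_))).mono ?_
        · omega
        · rw [List.length_cons, Nat.add_mul]
          omega
    have h := (hloop (c (ctr j)) [] i (.spread (ctrAux j) [ctr j] :: R) c ρ v rfl (hc j (by simp)).2
      (fun j' hj' => hc j' (by simp [hj'])) (by
        rw [(hc j (by simp)).1, ← Nat.pow_succ']; exact hQ)).bind (R' := R) (T' := n * 7 + 1)
      (Q' := fun c' ρ' v' => Q i c' ρ' v' ∧ ∀ s ∈ S, c' s = c s) (by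
      rintro c' ρ' v' ⟨h1, h2, h3, h4⟩
      -- The auxiliary stack holds the counter in reverse; spreading reverses once more and restores
      -- it.
      have hdet := spread_singleton_det hne.symm c'
      rw [h3, h2] at hdet
      simp only [List.append_nil, List.reverse_reverse, List.length_reverse,
        (hc j (by simp)).1] at hdet
      refine (hdet R R _ 0 ρ' v' (Exec.done ⟨hupd _ _ _ _ _ _ hj.2 (hupd _ _ _ _ _ _ hj.1 h1),
        fun s hs => ?_⟩)).mono (by omega)
      by_cases hs2 : s = ctrAux j
      · rw [hs2, Function.update_self, (hc j (by simp)).2]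
      · rw [Function.update_of_ne hs2]
        by_cases hs1 : s = ctr j
        · rw [hs1, Function.update_self]
        · rw [Function.update_of_ne hs1, h4 s hs hs1 hs2])
    refine (Exec.one' rfl h).mono ?_
    rw [(hc j (by simp)).1]
    simp only [List.length_cons, repTime]
    omega

end

noncomputable section

open scoped ComplexOrder Classical

open Config

/-! ## Moving a block of qubits -/

/-- The program `P` transforms the operator `ρ` into `ρ'` within `T` steps, on the only branch with
a nonzero operator, and does not touch the classical memory. -/
def Prog.QDet (P : Prog) (T : ℕ) (ρ ρ' : QMat) : Prop :=
  ∀ (R R' : List Prog) (Q : (ℕ → List Bool) → QMat → ℂ → Prop) (T' : ℕ) (c : ℕ → List Bool) (v : ℂ),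
    Exec R' Q T' ⟨R, c, ρ'⟩ v → Exec R' Q (T' + T) ⟨P :: R, c, ρ⟩ v

theorem Prog.QDet.skip (ρ : QMat) : Prog.skip.QDet 1 ρ ρ :=
  fun _ _ _ _ _ _ h => Exec.one' rfl h

theorem Prog.QDet.seq {P P' : Prog} {T T' : ℕ} {ρ ρ' ρ'' : QMat} (h : P.QDet T ρ ρ')
    (h' : P'.QDet T' ρ' ρ'') : (Prog.seq P P').QDet (T' + T + 1) ρ ρ'' :=
  fun _ _ _ T1 _ _ hR => Exec.one' (T := T1 + (T' + T)) rfl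
    ((h _ _ _ _ _ _ (h' _ _ _ _ _ _ hR)).mono (by omega))

theorem Prog.QDet.move_pos {r s : ℕ} {ρ ρ' : QMat} (h : (KrausOp.move r s).conj ρ = ρ')
    (h0 : (KrausOp.isEmpty r).conj ρ = 0) : (Prog.move r s).QDet 1 ρ ρ' := by
  intro R R' Q T' c v hR
  rw [← add_zero v]
  exact Exec.two rfl (by rw [h]; exact hR) (by rw [h0]; exact Exec.zero) (by simp)

theorem Prog.QDet.move_neg {r s : ℕ} {ρ ρ' : QMat} (h : (KrausOp.move r s).conj ρ = 0)
    (h0 : (KrausOp.isEmpty r).conj ρ = ρ') : (Prog.move r s).QDet 1 ρ ρ' := by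
  intro R R' Q T' c v hR
  rw [← zero_add v]
  exact Exec.two rfl (by rw [h]; exact Exec.zero) (by rw [h0]; exact hR) (by simp)

theorem KrausOp.conj_move_apply (r s : ℕ) (ρ : QMat) (x y : QStore) :
    (KrausOp.move r s).conj ρ x y = match x s, y s with
      | b :: l, b' :: l' =>
        ρ (Function.update (Function.update x s l) r (b :: (Function.update x s l) r))
          (Function.update (Function.update y s l') r (b' :: (Function.update y s l') r))
      | _, _ => 0 := by
  simp only [conj_apply, Kraus.sandwich, act, Kraus.move]
  cases x s <;> cases y s <;> simp

/-- The operator `χ` on a string of qubits that is spread over three stacks: the first `i` qubits on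
stack `1` in reverse order, the next `j` on stack `K`, and the remaining ones on stack `0`. -/
def QMat.split (K : ℕ) (χ : QOp) (i j : ℕ) : QMat := fun x y =>
  if ((∀ r, r ≠ 0 → r ≠ 1 → r ≠ K → x r = [] ∧ y r = []) ∧
      ((x 1).length = i ∧ (y 1).length = i) ∧ (x K).length = j ∧ (y K).length = j) then
    χ ((x 1).reverse ++ x K ++ x 0) ((y 1).reverse ++ y K ++ y 0) else 0

section

variable {K : ℕ} {χ : QOp}

theorem QMat.split_zero (hK : 1 < K) : QMat.split K χ 0 0 = QMat.place χ := by
  funext x y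
  simp only [split, place, List.length_eq_zero_iff]
  by_cases h : ∀ r, r ≠ 0 → x r = [] ∧ y r = []
  · have h1 := h 1 (by omega)
    have h2 := h K (by omega)
    rw [if_pos h, if_pos ⟨fun r hr _ _ => h r hr, h1, h2⟩]
    simp [h1, h2]
  · rw [if_neg h, if_neg]
    rintro ⟨h0, h1, h2⟩
    refine h fun r hr => ?_
    by_cases hr1 : r = 1
    · rw [hr1]; exact h1
    · by_cases hrK : r = K
      · rw [hrK]; exact h2
      · exact h0 r hr hr1 hrK

theorem QMat.conj_move_split_fst (hK : 1 < K) (i : ℕ) :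
    (KrausOp.move 0 1).conj (QMat.split K χ i 0) = QMat.split K χ (i + 1) 0 := by
  funext x y
  rw [KrausOp.conj_move_apply]
  have hK0 : K ≠ 0 := by omega
  have hK1 : K ≠ 1 := by omega
  cases hx : x 1 with
  | nil => simp [split, hx]
  | cons b l =>
    cases hy : y 1 with
    | nil => simp [split, hy]
    | cons b' l' =>
      simp only [split, Function.update_self, hx, hy, List.length_cons, Nat.add_right_cancel_iff,
        List.length_eq_zero_iff]
      rw [Function.update_of_ne hK0, Function.update_of_ne hK1, Function.update_of_ne hK0,
        Function.update_of_ne hK1, Function.update_of_ne (by omega : (1 : ℕ) ≠ 0),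
        Function.update_of_ne (by omega : (1 : ℕ) ≠ 0), Function.update_self, Function.update_self,
        Function.update_of_ne (by omega : (0 : ℕ) ≠ 1),
        Function.update_of_ne (by omega : (0 : ℕ) ≠ 1)]
      have hc : (∀ r, r ≠ 0 → r ≠ 1 → r ≠ K →
          Function.update (Function.update x 1 l) 0 (b :: x 0) r = [] ∧
            Function.update (Function.update y 1 l') 0 (b' :: y 0) r = []) ↔
          ∀ r, r ≠ 0 → r ≠ 1 → r ≠ K → x r = [] ∧ y r = [] := by
        refine forall_congr' fun r => forall_congr' fun h0 => forall_congr' fun h1 => ?_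
        rw [Function.update_of_ne h0, Function.update_of_ne h1, Function.update_of_ne h0,
          Function.update_of_ne h1]
      rw [hc]
      refine ite_congr rfl (fun h => ?_) fun _ => rfl
      simp [h.2.2]

theorem QMat.conj_move_split_snd (hK : 1 < K) (i j : ℕ) :
    (KrausOp.move 1 K).conj (QMat.split K χ (i + 1) j) = QMat.split K χ i (j + 1) := by
  funext x y
  rw [KrausOp.conj_move_apply]
  have hK1 : 1 ≠ K := by omega
  have hK0 : 0 ≠ K := by omega
  cases hx : x K with
  | nil => simp [split, hx]
  | cons b l =>
    cases hy : y K with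
    | nil => simp [split, hy]
    | cons b' l' =>
      simp only [split, hx, hy]
      rw [Function.update_self, Function.update_self, Function.update_of_ne hK1.symm,
        Function.update_of_ne hK1.symm, Function.update_self, Function.update_self,
        Function.update_of_ne (by omega : (0 : ℕ) ≠ 1),
        Function.update_of_ne (by omega : (0 : ℕ) ≠ 1), Function.update_of_ne hK1,
        Function.update_of_ne hK1, Function.update_of_ne hK0, Function.update_of_ne hK0]
      have hc : (∀ r, r ≠ 0 → r ≠ 1 → r ≠ K →
          Function.update (Function.update x K l) 1 (b :: x 1) r = [] ∧
            Function.update (Function.update y K l') 1 (b' :: y 1) r = []) ↔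
          ∀ r, r ≠ 0 → r ≠ 1 → r ≠ K → x r = [] ∧ y r = [] := by
        refine forall_congr' fun r => forall_congr' fun h0 => forall_congr' fun h1 =>
          forall_congr' fun h2 => ?_
        rw [Function.update_of_ne h1, Function.update_of_ne h2, Function.update_of_ne h1,
          Function.update_of_ne h2]
      rw [hc]
      refine ite_congr (by simp) (fun _ => ?_) fun _ => rfl
      simp

theorem QMat.conj_move_split_snd_zero (hK : 1 < K) (j : ℕ) :
    (KrausOp.move 1 K).conj (QMat.split K χ 0 j) = 0 := by
  funext x y
  rw [KrausOp.conj_move_apply]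
  have hK1 : 1 ≠ K := by omega
  cases hx : x K with
  | nil => rfl
  | cons b l =>
    cases hy : y K with
    | nil => rfl
    | cons b' l' =>
      simp only [split]
      rw [if_neg]
      · rfl
      · rintro ⟨-, ⟨h, -⟩, -⟩
        simp at h

theorem QMat.conj_isEmpty_split_fst (i : ℕ) {L : ℕ} (hχ : χ.OnQubits L) (hi : i < L) :
    (KrausOp.isEmpty 0).conj (QMat.split K χ i 0) = 0 := by
  funext x y
  rw [KrausOp.conj_isEmpty_apply]
  split
  · rename_i h
    by_contra hne
    obtain ⟨h1, h2⟩ := ite_ne_right_iff.mp hne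
    have := (hχ _ _ h2).1
    simp [h.1, h1.2.1.1, h1.2.2.1] at this
    omega
  · rfl

theorem QMat.conj_isEmpty_split_fst_self {L : ℕ} (hχ : χ.OnQubits L) :
    (KrausOp.isEmpty 0).conj (QMat.split K χ L 0) = QMat.split K χ L 0 := by
  funext x y
  rw [KrausOp.conj_isEmpty_apply]
  split
  · rfl
  · rename_i h
    by_contra hne
    obtain ⟨h1, h2⟩ := ite_ne_right_iff.mp (Ne.symm hne)
    obtain ⟨h3, h4⟩ := hχ _ _ h2
    simp [h1.2.1, h1.2.2] at h3 h4
    exact h ⟨h3, h4⟩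

theorem QMat.split_eq_zero {i L : ℕ} (hχ : χ.OnQubits L) (hi : L < i) :
    QMat.split K χ i 0 = 0 := by
  funext x y
  by_contra hne
  obtain ⟨h1, h2⟩ := ite_ne_right_iff.mp hne
  have := (hχ _ _ h2).1
  simp [h1.2.1, h1.2.2] at this
  omega

theorem QMat.conj_isEmpty_split_snd (i j : ℕ) :
    (KrausOp.isEmpty 1).conj (QMat.split K χ (i + 1) j) = 0 := by
  funext x y
  rw [KrausOp.conj_isEmpty_apply]
  split
  · rename_i h
    simp [split, h.1]
  · rfl

theorem QMat.conj_isEmpty_split_snd_self (j : ℕ) :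
    (KrausOp.isEmpty 1).conj (QMat.split K χ 0 j) = QMat.split K χ 0 j := by
  funext x y
  rw [KrausOp.conj_isEmpty_apply]
  split
  · rfl
  · rename_i h
    rw [split, if_neg]
    rintro ⟨-, h1, -⟩
    exact h ⟨List.length_eq_zero_iff.mp h1.1, List.length_eq_zero_iff.mp h1.2⟩

/-- Move the top `n` qubits of `r` to `s` one by one. -/
def Prog.moves (r s : ℕ) : ℕ → Prog
  | 0 => .skip
  | n + 1 => .seq (.move r s) (Prog.moves r s n)

/-- Once stack `0` is exhausted the remaining moves do nothing, which is the reason for the minimum.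
-/
theorem Prog.moves_fst_qdet (hK : 1 < K) {L : ℕ} (hχ : χ.OnQubits L) (n i : ℕ) (hi : i ≤ L) :
    (Prog.moves 0 1 n).QDet (2 * n + 1) (QMat.split K χ i 0)
      (QMat.split K χ (min (i + n) L) 0) := by
  induction n generalizing i with
  | zero =>
    rw [show i + 0 = i from rfl, min_eq_left hi]
    exact QDet.skip _
  | succ n ih =>
    rcases hi.lt_or_eq with h | rfl
    · have := (QDet.move_pos (QMat.conj_move_split_fst hK i)
        (QMat.conj_isEmpty_split_fst i hχ h)).seq (ih (i + 1) h)
      rw [show i + 1 + n = i + (n + 1) by omega] at this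
      exact this
    · have := (QDet.move_neg (r := 0) (s := 1) ((QMat.conj_move_split_fst hK i).trans
        (QMat.split_eq_zero hχ (Nat.lt_succ_self i)))
        (QMat.conj_isEmpty_split_fst_self hχ)).seq (ih i le_rfl)
      rw [min_eq_right (by omega)] at this ⊢
      exact this

theorem Prog.moves_snd_qdet (hK : 1 < K) (n i j : ℕ) (hi : i ≤ n) :
    (Prog.moves 1 K n).QDet (2 * n + 1) (QMat.split K χ i j) (QMat.split K χ 0 (i + j)) := by
  induction n generalizing i j with
  | zero =>
    obtain rfl := Nat.le_zero.mp hi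
    rw [show 0 + j = j from Nat.zero_add j]
    exact QDet.skip _
  | succ n ih =>
    cases i with
    | zero =>
      exact (QDet.move_neg (QMat.conj_move_split_snd_zero hK j)
        (QMat.conj_isEmpty_split_snd_self j)).seq (ih 0 j (by omega))
    | succ i =>
      have := (QDet.move_pos (QMat.conj_move_split_snd hK i j)
        (QMat.conj_isEmpty_split_snd i j)).seq (ih i (j + 1) (by omega))
      rw [show i + (j + 1) = i + 1 + j by omega] at this
      exact this

/-- Split off the first `m` qubits, or all if there are fewer: `χ = φ ⊗ ψ`. -/
def QOp.Splits (m : ℕ) (χ φ ψ : QOp) : Prop :=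
  -- `L` may be smaller than `m`, because the adversary has to halt on inputs of every length.
  ∃ L, χ.OnQubits L ∧ φ.OnQubits (min m L) ∧ ∀ u u' x y, u.length = min m L →
    u'.length = min m L → χ (u ++ x) (u' ++ y) = φ u u' * ψ x y

/-- Move the first `m` qubits of stack `0` to stack `K`. -/
def Prog.takeBlock (K m : ℕ) : Prog := .seq (.moves 0 1 m) (.moves 1 K m)

/-- The detour over stack `1` reverses the block twice, so it reaches `K` in its original order.
With stack `1` empty again, `QMat.split` is the tensor product by `QOp.Splits`. -/
theorem Prog.takeBlock_qdet (hK : 1 < K) {m : ℕ} {φ ψ : QOp} (h : QOp.Splits m χ φ ψ) :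
    (Prog.takeBlock K m).QDet (4 * m + 3) (QMat.place χ)
      (QMat.tensor K (QMat.place φ) (QMat.place ψ)) := by
  obtain ⟨L, hχ, hφ, hs⟩ := h
  have h1 := Prog.moves_fst_qdet hK hχ m 0 (Nat.zero_le _)
  have h2 := Prog.moves_snd_qdet (χ := χ) hK m (min (0 + m) L) 0 (by omega)
  rw [QMat.split_zero hK] at h1
  have h3 := h1.seq h2
  rw [show 0 + m = m from Nat.zero_add m, show min m L + 0 = min m L from rfl] at h3
  have he : QMat.split K χ 0 (min m L) = QMat.tensor K (QMat.place φ) (QMat.place ψ) := by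
    funext x y
    simp only [QMat.split, QMat.tensor, QMat.place, stacksFrom, stacksBelow, joinStacks,
      List.length_eq_zero_iff, Nat.zero_add, if_pos (show 0 < K by omega)]
    by_cases hA : ∀ r, r ≠ 0 → x (r + K) = [] ∧ y (r + K) = []
    · by_cases hB : ∀ r, r ≠ 0 → (if r < K then x r else []) = [] ∧ (if r < K then y r else []) = []
      · rw [if_pos hA, if_pos hB]
        have h1 := hB 1 (by omega)
        rw [if_pos hK, if_pos hK] at h1
        by_cases hl : (x K).length = min m L ∧ (y K).length = min m L
        · have hout : ∀ r, r ≠ 0 → r ≠ 1 → r ≠ K → x r = [] ∧ y r = [] := by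
            intro r h0 h1 hrK
            rcases lt_or_gt_of_ne hrK with h | h
            · have := hB r h0
              rwa [if_pos h, if_pos h] at this
            · have := hA (r - K) (by omega)
              rwa [Nat.sub_add_cancel h.le] at this
          rw [if_pos ⟨hout, h1, hl⟩, h1.1, h1.2, List.reverse_nil, List.nil_append,
            List.nil_append, hs _ _ _ _ hl.1 hl.2]
        · rw [if_neg fun h => hl h.2.2]
          have : φ (x K) (y K) = 0 := by
            by_contra hne
            exact hl (hφ _ _ hne)
          rw [this, zero_mul]
      · rw [if_neg hB, mul_zero, if_neg]
        rintro ⟨h0, h1, -⟩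
        refine hB fun r hr => ?_
        split
        · by_cases hr1 : r = 1
          · rw [hr1]; exact h1
          · exact h0 r hr hr1 (by omega)
        · exact ⟨rfl, rfl⟩
    · rw [if_neg hA, zero_mul, if_neg]
      rintro ⟨h0, -⟩
      exact hA fun r hr => h0 (r + K) (by omega) (by omega) (by omega)
  rw [he] at h3
  refine fun R R' Q T' c v hR => (h3 R R' Q T' c v hR).mono (by omega)

/-- Allows the empty area of a subroutine to be added before a call and dropped after it. -/
theorem QMat.tensor_place_empty (hK : 0 < K) (ψ : QOp) :
    QMat.tensor K (QMat.place QOp.empty) (QMat.place ψ) = QMat.place ψ := by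
  funext x y
  rw [tensor, place_empty_apply]
  simp only [place, stacksBelow, joinStacks, hK, if_true]
  by_cases hA : stacksFrom K x = (fun _ => []) ∧ stacksFrom K y = fun _ => []
  · rw [if_pos hA, one_mul]
    congr 1
    simp only [eq_iff_iff]
    refine forall_congr' fun r => forall_congr' fun hr => ?_
    split
    · rfl
    · have h1 := congrFun hA.1 (r - K)
      have h2 := congrFun hA.2 (r - K)
      rw [stacksFrom, Nat.sub_add_cancel (by omega)] at h1 h2
      simp [h1, h2]
  · rw [if_neg hA, zero_mul, if_neg]
    intro h
    refine hA ⟨?_, ?_⟩ <;> funext r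
    · exact (h (r + K) (by omega)).1
    · exact (h (r + K) (by omega)).2

end

end

noncomputable section

open scoped ComplexOrder Classical

open Config

/-! ## The adversary -/

/-- The ingredients of the adversary: key generation and verification, the number of qubits of a
state, and the exponents of the number of tests in a round and of the number of rounds. -/
structure AdvData where
  keyGen : QPT
  ver : QPT
  m : ℕ
  e₁ : ℕ
  e₂ : ℕ

/-- Copy the stack `s` to `t` in reverse order, with the help of `u`. -/
def Prog.copyTo (s t u : ℕ) : Prog := .seq (.spread s [t, u]) (.spread u [s])

/-- Spreading reverses: `s` is restored from `u` by a second reversal, while `t` keeps a reversed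
copy. The adversary therefore stores its classical input and candidate keys in reverse. -/
theorem Prog.copyTo_det {s t u : ℕ} (hst : s ≠ t) (hsu : s ≠ u) (htu : t ≠ u)
    {c : ℕ → List Bool} (ht : c t = []) (hu : c u = []) :
    (Prog.copyTo s t u).Det ((c s).length * 16 + 3) c (Function.update c t (c s).reverse) := by
  have h1 := spread_det (s := s) (ts := [t, u]) (by simp [htu]) (by simp [hst, hsu]) c
  have h2 := spread_singleton_det hsu.symm
    fun i => if i = s then [] else if i ∈ [t, u] then (c s).reverse ++ c i else c i
  have h3 := h1.seq h2
  have he : Function.update (Function.update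
      (fun i => if i = s then [] else if i ∈ [t, u] then (c s).reverse ++ c i else c i) s
      (((fun i => if i = s then [] else if i ∈ [t, u] then (c s).reverse ++ c i else c i) u).reverse
        ++ (fun i => if i = s then [] else if i ∈ [t, u] then (c s).reverse ++ c i else c i) s))
      u [] = Function.update c t (c s).reverse := by
    funext i
    by_cases hiu : i = u
    · subst hiu; simp [hu, htu.symm]
    · by_cases his : i = s
      · subst his; simp [hsu, hsu.symm, hst, hu]
      · by_cases hit : i = t
        · subst hit; simp [hiu, his, ht]
        · simp [hiu, his, hit]
  rw [he] at h3
  refine h3.mono ?_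
  simp [hsu.symm, hu]
  omega

namespace AdvData

variable (D : AdvData)

/-- The first stack that belongs to the subroutines. -/
def base : ℕ := 7 + 2 * (D.e₁ + D.e₂)

/-- The program that tests the candidate key on one further copy of the state. -/
def test : Prog :=
  .seq (.copyTo 2 D.base 3) (.seq (.takeBlock D.base D.m) (.seq (D.ver.prog.sub.shift D.base)
    -- The failure flag is pushed at most once, so a single `pop` lowers it. Testing continues after
    -- a failure, so every attempt consumes the same number of blocks.
    (.seq (.ifTop D.base .skip (.ifTop 5 .skip (.push 5 true))) (.clear D.base))))

/-- The program that samples a candidate key and tests it many times. -/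
def attempt : Prog :=
  .seq (.copyTo 1 D.base 3) (.seq (D.keyGen.prog.sub.shift D.base) (.seq (.spread D.base [2])
    (.seq (Prog.rep D.test (List.range D.e₁))
      (.ifTop 5 (.seq (.pop 5) (.clear 2)) (.push 4 true)))))

/-- One round: an attempt, unless a key has been accepted before. -/
def round : Prog := .ifTop 4 .skip D.attempt

/-- The program of the adversary. -/
def prog : Prog :=
  .seq (.spread 0 (1 :: (List.range (D.e₁ + D.e₂)).map ctr))
    (.seq (Prog.rep D.round ((List.range D.e₂).map (D.e₁ + ·))) (.spread 2 [0]))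

/-- The classical memory of the adversary between its subroutines. -/
def mem (rw key d f : List Bool) (κ : ℕ → List Bool) : ℕ → List Bool := fun s =>
  -- Stack `1` holds the reversed input, `2` the reversed candidate key, `4` the flag for an
  -- accepted key, `5` the flag for a failed test. Loop counters and their auxiliary stacks start at
  -- `7`, and `3` is scratch space for copying. Stacks from `base` on belong to the subroutines.
  if s = 1 then rw else if s = 2 then key else if s = 4 then d else if s = 5 then f else
    if 7 ≤ s ∧ s < D.base then κ s else []

/-- The expected value of a series of tests of the key `k` on the states `φ b`, where the value is
`F` if all tests are passed and `V` otherwise. -/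
def testValue (φ : ℕ → QOp) (ℓ : ℕ → ℕ) (F V : ℂ) (b₀ : ℕ) (k : List Bool) : ℕ → Bool → ℂ
  | 0, failed => if failed then V else F
  -- Blocks are numbered from the end: `φ b` is split off while `b + 1` blocks remain.
  | j + 1, failed => D.ver.prog.expectC k (φ (b₀ + j)) (D.ver.time.eval (k.length + ℓ (b₀ + j)))
      fun out => testValue φ ℓ F V b₀ k j (if out.head? = some true then failed else true)

/-- The expected value of a series of rounds with `s` tests each, where the value is `F k` if the
key `k` is accepted and `F []` if no key is. -/
def roundValue (φ : ℕ → QOp) (ℓ : ℕ → ℕ) (F : List Bool → ℂ) (w : List Bool) (s : ℕ) : ℕ → ℂ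
  | 0 => F []
  | i + 1 => D.keyGen.prog.expectC w QOp.empty (D.keyGen.time.eval w.length) fun k =>
      D.testValue φ ℓ (F k) (roundValue φ ℓ F w s i) (i * s) k s false

/-- A bound on the length of the candidate keys. -/
def keyBound (n : ℕ) : ℕ := n + D.keyGen.time.eval n

/-- A bound on the running time of a test. -/
def testTime (n : ℕ) : ℕ :=
  subTime (max D.ver.prog.width 1) (D.keyBound n + D.m)
    (D.ver.time.eval (D.keyBound n + D.m)) +
  (D.keyBound n * 16 + 4 * D.m +
    2 * (D.keyBound n + D.m + D.ver.time.eval (D.keyBound n + D.m)) + 20)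

end AdvData

theorem Polynomial.eval_nat_mono (p : Polynomial ℕ) {a b : ℕ} (h : a ≤ b) :
    p.eval a ≤ p.eval b := by
  rw [Polynomial.eval_eq_sum, Polynomial.eval_eq_sum]
  exact Finset.sum_le_sum fun i _ => Nat.mul_le_mul_left _ (Nat.pow_le_pow_left h i)

theorem subTime_mono {W n n' T T' : ℕ} (hn : n ≤ n') (hT : T ≤ T') :
    subTime W n T ≤ subTime W n' T' := by
  unfold subTime
  gcongr

/-! ### Correctness of a single test. -/

namespace AdvData

variable (D : AdvData)

theorem update_mem {rw key d f : List Bool} {κ : ℕ → List Bool} {s : ℕ} (h7 : 7 ≤ s)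
    (hs : s < D.base) (l : List Bool) :
    Function.update (D.mem rw key d f κ) s l = D.mem rw key d f (Function.update κ s l) := by
  funext i
  by_cases hi : i = s
  · subst hi
    simp only [mem, Function.update_self]
    rw [if_neg (by omega), if_neg (by omega), if_neg (by omega), if_neg (by omega), if_pos ⟨h7, hs⟩]
  · simp only [mem, Function.update_of_ne hi]

theorem mem_counter (rw key d f : List Bool) (κ : ℕ → List Bool) {s : ℕ} (h7 : 7 ≤ s)
    (hs : s < D.base) : D.mem rw key d f κ s = κ s := by
  simp only [mem]
  rw [if_neg (by omega), if_neg (by omega), if_neg (by omega), if_neg (by omega), if_pos ⟨h7, hs⟩]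

theorem mem_base (rw key d f : List Bool) (κ : ℕ → List Bool) (s : ℕ) :
    D.mem rw key d f κ (s + D.base) = [] := by
  have : 7 ≤ D.base := by simp [base]
  simp only [mem]
  rw [if_neg (by omega), if_neg (by omega), if_neg (by omega), if_neg (by omega), if_neg (by omega)]

theorem stacksFrom_update_mem (rw key d f : List Bool) (κ : ℕ → List Bool) (w : List Bool) :
    stacksFrom D.base (Function.update (D.mem rw key d f κ) D.base w) = bitsOf w := by
  funext s
  rw [stacksFrom, bitsOf]
  by_cases hs : s = 0
  · subst hs; simp
  · rw [Function.update_of_ne (by omega), Function.update_of_ne hs, mem_base]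

/-- The call of `ver` consumes the block `φ (b₀ + j)`, and its expectation is the outer `expectC` in
`testValue`. What follows only records the verdict in the failure flag. -/
theorem test_exec {χ φ : ℕ → QOp} {ℓ : ℕ → ℕ}
    (hχ : ∀ b, QOp.Splits D.m (χ (b + 1)) (φ b) (χ b)) (hφ : ∀ b, (φ b).OnQubits (ℓ b))
    (hℓ : ∀ b, ℓ b ≤ D.m) (F V : ℂ) (b₀ : ℕ) (rw k : List Bool) (n : ℕ)
    (hk : k.length ≤ D.keyBound n) (j : ℕ) (failed : Bool) (κ : ℕ → List Bool) (R : List Prog) :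
    Exec R (fun c ρ v => ∃ (failed : Bool) (a : ℂ),
        c = D.mem rw k.reverse [] (if failed then [true] else []) κ ∧
        ρ = a • QMat.place (χ (b₀ + j)) ∧ v = a * D.testValue φ ℓ F V b₀ k j failed)
      (D.testTime n)
      ⟨D.test :: R, D.mem rw k.reverse [] (if failed then [true] else []) κ,
        QMat.place (χ (b₀ + (j + 1)))⟩ (D.testValue φ ℓ F V b₀ k (j + 1) failed) := by
  have hb7 : 7 ≤ D.base := by simp [base]
  set K := D.base with hK
  set c₀ := D.mem rw k.reverse [] (if failed then [true] else []) κ with hc₀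
  have hc2 : c₀ 2 = k.reverse := by simp [hc₀, mem]
  have hc5 : c₀ 5 = if failed then [true] else [] := by simp [hc₀, mem]
  have hcK : c₀ K = [] := by
    have := D.mem_base rw k.reverse [] (if failed then [true] else []) κ 0
    rwa [Nat.zero_add] at this
  have hc3 : c₀ 3 = [] := by simp [hc₀, mem]
  have hcopy := Prog.copyTo_det (s := 2) (t := K) (u := 3) (by omega) (by omega) (by omega) hcK hc3
  rw [hc2, List.reverse_reverse, List.length_reverse] at hcopy
  have hhalt := D.ver.halts k (ℓ (b₀ + j)) (φ (b₀ + j)) (hφ _)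
  have hcall := Prog.call_exec D.ver.prog K k (hφ (b₀ + j)) hhalt
    (fun out => D.testValue φ ℓ F V b₀ k j (if out.head? = some true then failed else true))
    (Function.update c₀ K k) (D.stacksFrom_update_mem _ _ _ _ _ _) (QMat.place (χ (b₀ + j)))
  have htime : D.ver.time.eval (k.length + ℓ (b₀ + j)) ≤
      D.ver.time.eval (D.keyBound n + D.m) :=
    Polynomial.eval_nat_mono _ (Nat.add_le_add hk (hℓ _))
  set B := D.keyBound n + D.m + D.ver.time.eval (D.keyBound n + D.m) with hB
  have hpost : ∀ (out : List Bool) (a : ℂ), out.length ≤ B →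
      Exec R (fun c ρ v => ∃ (failed : Bool) (a : ℂ),
        c = D.mem rw k.reverse [] (if failed then [true] else []) κ ∧
        ρ = a • QMat.place (χ (b₀ + j)) ∧ v = a * D.testValue φ ℓ F V b₀ k j failed)
      (2 * B + 10)
      ⟨.seq (.ifTop K .skip (.ifTop 5 .skip (.push 5 true))) (.clear K) :: R,
        Function.update c₀ K out, a • QMat.place (χ (b₀ + j))⟩
      (a * D.testValue φ ℓ F V b₀ k j (if out.head? = some true then failed else true)) := by
    intro out a hout
    have hset : ∀ failed' : Bool,
        Function.update (D.mem rw k.reverse [] (if failed' then [true] else []) κ) K [] =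
        D.mem rw k.reverse [] (if failed' then [true] else []) κ := by
      intro failed'
      rw [Function.update_eq_self_iff]
      have := D.mem_base rw k.reverse [] (if failed' then [true] else []) κ 0
      rw [Nat.zero_add] at this
      exact this.symm
    have hflag : (Prog.ifTop K .skip (.ifTop 5 .skip (.push 5 true))).Det 3
        (Function.update c₀ K out) (Function.update
          (D.mem rw k.reverse [] (if (if out.head? = some true then failed else true) then [true]
            else []) κ) K out) := by
      by_cases hacc : out.head? = some true
      · rw [if_pos hacc]
        exact (Prog.Det.ifTop_pos (by simpa using hacc) (Prog.Det.skip _)).mono (by omega)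
      · rw [if_neg hacc]
        refine Prog.Det.ifTop_neg (by simpa using hacc) ?_
        have h5 : (Function.update c₀ K out) 5 = if failed then [true] else [] := by
          rw [Function.update_of_ne (by omega), hc5]
        cases failed with
        | true => exact Prog.Det.ifTop_pos (by simp [h5]) (Prog.Det.skip _)
        | false =>
          have hpush := Prog.Det.push 5 true (Function.update c₀ K out)
          rw [h5] at hpush
          have he : Function.update (Function.update c₀ K out) 5 [true] =
              Function.update (D.mem rw k.reverse [] [true] κ) K out := by
            funext i
            by_cases hi : i = 5
            · subst hi
              rw [Function.update_self, Function.update_of_ne (by omega)]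
              simp [mem]
            · rw [Function.update_of_ne hi]
              by_cases hiK : i = K
              · subst hiK; simp
              · rw [Function.update_of_ne hiK, Function.update_of_ne hiK]
                simp [hc₀, mem, hi]
          simp only [Bool.false_eq_true, if_false] at hpush
          rw [he] at hpush
          exact Prog.Det.ifTop_neg (by simp [h5]) hpush
    have hclear := Prog.clear_det K (Function.update
          (D.mem rw k.reverse [] (if (if out.head? = some true then failed else true) then [true]
            else []) κ) K out)
    rw [Function.update_idem, hset, Function.update_self] at hclear
    exact ((hflag.seq hclear) R R _ 0 _ _ (Exec.done ⟨_, a, rfl, rfl, rfl⟩)).mono (by omega)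
  have hmain := (hcall (.seq (.ifTop K .skip (.ifTop 5 .skip (.push 5 true))) (.clear K) :: R)).bind
    (R' := R) (T' := 2 * B + 10)
    (Q' := fun c ρ v => ∃ (failed : Bool) (a : ℂ),
        c = D.mem rw k.reverse [] (if failed then [true] else []) κ ∧
        ρ = a • QMat.place (χ (b₀ + j)) ∧ v = a * D.testValue φ ℓ F V b₀ k j failed) (by
    rintro c ρ v ⟨out, a, hout, rfl, rfl, rfl⟩
    rw [Function.update_idem, QMat.tensor_place_empty (by omega)]
    refine hpost out a (hout.trans ?_)
    have := hℓ (b₀ + j)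
    omega)
  have htake := Prog.takeBlock_qdet (K := K) (by omega) (hχ (b₀ + j))
  have hseq := hcopy (.seq (.takeBlock K D.m) (.seq (D.ver.prog.sub.shift K)
    (.seq (.ifTop K .skip (.ifTop 5 .skip (.push 5 true))) (.clear K))) :: R) _ _ _ _ _
    (Exec.one' rfl (htake _ _ _ _ _ _ (Exec.one' rfl hmain)))
  refine (Exec.one' (L := D.test :: R) (c := c₀) rfl hseq).mono ?_
  have := subTime_mono (W := max D.ver.prog.width 1) (Nat.add_le_add hk (hℓ (b₀ + j))) htime
  simp only [testTime, ← hB]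
  omega

end AdvData

end

/-! ### Attempts, rounds and the whole adversary. -/

noncomputable section

open scoped ComplexOrder Classical

open Config

namespace AdvData

variable (D : AdvData)

/-- A bound on the running time of an attempt. -/
def attemptTime (n : ℕ) : ℕ :=
  subTime (max D.keyGen.prog.width 1) n (D.keyGen.time.eval n) +
    (repTime n (D.testTime n) D.e₁ + (16 * n + 9 * D.keyBound n + 20))

/-- Both outcomes leave exactly `χ b₀`, since all tests are carried out whatever their verdicts. -/
theorem attempt_exec {χ φ : ℕ → QOp} {ℓ : ℕ → ℕ}
    (hχ : ∀ b, QOp.Splits D.m (χ (b + 1)) (φ b) (χ b)) (hφ : ∀ b, (φ b).OnQubits (ℓ b))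
    (hℓ : ∀ b, ℓ b ≤ D.m) (F : List Bool → ℂ) (V : ℂ) (b₀ : ℕ) (w : List Bool)
    (κ : ℕ → List Bool)
    (hκ : ∀ j < D.e₁, (κ (ctr j)).length = w.length ∧ κ (ctrAux j) = []) (R : List Prog) :
    Exec R (fun c ρ v =>
        (∃ a : ℂ, c = D.mem w.reverse [] [] [] κ ∧ ρ = a • QMat.place (χ b₀) ∧ v = a * V) ∨
        ∃ (a : ℂ) (k : List Bool), k.length ≤ D.keyBound w.length ∧
          c = D.mem w.reverse k.reverse [true] [] κ ∧ ρ = a • QMat.place (χ b₀) ∧ v = a * F k)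
      (D.attemptTime w.length)
      ⟨D.attempt :: R, D.mem w.reverse [] [] [] κ, QMat.place (χ (b₀ + w.length ^ D.e₁))⟩
      (D.keyGen.prog.expectC w QOp.empty (D.keyGen.time.eval w.length) fun k =>
        D.testValue φ ℓ (F k) V b₀ k (w.length ^ D.e₁) false) := by
  have hb7 : 7 + 2 * D.e₁ ≤ D.base := by simp [base]
  set K := D.base with hK
  set n := w.length with hn
  set Post : (ℕ → List Bool) → QMat → ℂ → Prop := fun c ρ v =>
        (∃ a : ℂ, c = D.mem w.reverse [] [] [] κ ∧ ρ = a • QMat.place (χ b₀) ∧ v = a * V) ∨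
        ∃ (a : ℂ) (k : List Bool), k.length ≤ D.keyBound n ∧
          c = D.mem w.reverse k.reverse [true] [] κ ∧ ρ = a • QMat.place (χ b₀) ∧ v = a * F k
    with hPost
  have hempty : ∀ key d f, D.mem w.reverse key d f κ K = [] := by
    intro key d f
    have := D.mem_base w.reverse key d f κ 0
    rwa [Nat.zero_add] at this
  have hcopy := Prog.copyTo_det (s := 1) (t := K) (u := 3) (by omega) (by omega) (by omega)
    (hempty [] [] []) (by simp [mem])
  rw [show D.mem w.reverse [] [] [] κ 1 = w.reverse by simp [mem], List.reverse_reverse,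
    List.length_reverse, ← hn] at hcopy
  have hhalt := D.keyGen.halts w 0 QOp.empty QOp.empty_onQubits
  rw [Nat.add_zero] at hhalt
  have hcall := Prog.call_exec D.keyGen.prog K w QOp.empty_onQubits hhalt
    (fun k => D.testValue φ ℓ (F k) V b₀ k (n ^ D.e₁) false)
    (Function.update (D.mem w.reverse [] [] [] κ) K w) (D.stacksFrom_update_mem _ _ _ _ _ _)
    (QMat.place (χ (b₀ + n ^ D.e₁)))
  rw [QMat.tensor_place_empty (by omega)] at hcall
  -- after the tests
  have hend : ∀ (k : List Bool) (failed : Bool) (a : ℂ), k.length ≤ D.keyBound n →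
      Exec R Post (2 * D.keyBound n + 6)
        ⟨.ifTop 5 (.seq (.pop 5) (.clear 2)) (.push 4 true) :: R,
          D.mem w.reverse k.reverse [] (if failed then [true] else []) κ,
          a • QMat.place (χ b₀)⟩ (a * D.testValue φ ℓ (F k) V b₀ k 0 failed) := by
    intro k failed a hk
    cases failed with
    | true =>
      have h1 := Prog.Det.pop 5 (D.mem w.reverse k.reverse [] [true] κ)
      have h2 := Prog.clear_det 2 (Function.update (D.mem w.reverse k.reverse [] [true] κ) 5
        ((D.mem w.reverse k.reverse [] [true] κ) 5).tail)
      have h3 := Prog.Det.ifTop_pos (s := 5) (P' := .push 4 true) (by simp [mem]) (h1.seq h2)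
      have he : Function.update (Function.update (D.mem w.reverse k.reverse [] [true] κ) 5
          ((D.mem w.reverse k.reverse [] [true] κ) 5).tail) 2 [] =
          D.mem w.reverse [] [] [] κ := by
        funext i
        by_cases hi2 : i = 2
        · subst hi2; simp [mem]
        · by_cases hi5 : i = 5
          · subst hi5; simp [mem]
          · simp [mem, hi2, hi5]
      rw [he] at h3
      refine (h3 R R Post 0 _ _ (Exec.done (Or.inl ⟨a, rfl, rfl, rfl⟩))).mono ?_
      rw [Function.update_of_ne (by omega), show D.mem w.reverse k.reverse [] [true] κ 2 =
        k.reverse by simp [mem], List.length_reverse]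
      omega
    | false =>
      have h1 := Prog.Det.push 4 true (D.mem w.reverse k.reverse [] [] κ)
      have h3 := Prog.Det.ifTop_neg (s := 5) (P := .seq (.pop 5) (.clear 2)) (by simp [mem]) h1
      have he : Function.update (D.mem w.reverse k.reverse [] [] κ) 4
          (true :: D.mem w.reverse k.reverse [] [] κ 4) =
          D.mem w.reverse k.reverse [true] [] κ := by
        funext i
        by_cases hi : i = 4
        · subst hi; simp [mem]
        · simp [mem, hi]
      rw [he] at h3
      exact (h3 R R Post 0 _ _ (Exec.done (Or.inr ⟨a, k, hk, rfl, rfl, rfl⟩))).mono (by omega)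
  -- the tests
  have htests : ∀ (k : List Bool) (a : ℂ), k.length ≤ D.keyBound n →
      Exec R Post (repTime n (D.testTime n) D.e₁ + (2 * D.keyBound n + 6))
        ⟨Prog.rep D.test (List.range D.e₁) :: .ifTop 5 (.seq (.pop 5) (.clear 2)) (.push 4 true) ::
          R, D.mem w.reverse k.reverse [] [] κ, a • QMat.place (χ (b₀ + n ^ D.e₁))⟩
        (a * D.testValue φ ℓ (F k) V b₀ k (n ^ D.e₁) false) := by
    intro k a hk
    set S : Set ℕ := {s | 7 ≤ s ∧ s < 7 + 2 * D.e₁} with hS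
    -- The loops alter the counters meanwhile, so the invariant allows any `κ'` that agrees with `κ`
    -- outside `S`; the preservation clause of `rep_exec` recovers `κ` at the end.
    have hrep := Prog.rep_exec (B := D.test) (n := n) (T := D.testTime n)
      (Q := fun j c ρ v => ∃ (κ' : ℕ → List Bool) (failed : Bool) (a : ℂ),
        (∀ s, s ∉ S → κ' s = κ s) ∧
        c = D.mem w.reverse k.reverse [] (if failed then [true] else []) κ' ∧
        ρ = a • QMat.place (χ (b₀ + j)) ∧ v = a * D.testValue φ ℓ (F k) V b₀ k j failed)
      (S := S) ?_ ?_ (List.range D.e₁) List.nodup_range ?_ 0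
      (.ifTop 5 (.seq (.pop 5) (.clear 2)) (.push 4 true) :: R)
      (D.mem w.reverse k.reverse [] [] κ) (a • QMat.place (χ (b₀ + n ^ D.e₁)))
      (a * D.testValue φ ℓ (F k) V b₀ k (n ^ D.e₁) false) ?_ ?_
    · rw [List.length_range] at hrep
      refine hrep.bind ?_
      rintro c ρ v ⟨⟨κ', failed, a, hκ', rfl, rfl, rfl⟩, hpres⟩
      have he : D.mem w.reverse k.reverse [] (if failed then [true] else []) κ' =
          D.mem w.reverse k.reverse [] (if failed then [true] else []) κ := by
        funext s
        by_cases hs : s ∈ S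
        · rw [hpres s hs]
          have h2 : s < D.base := by have := hs.2; omega
          rw [D.mem_counter _ _ _ _ _ hs.1 h2, D.mem_counter _ _ _ _ _ hs.1 h2]
        · simp only [mem, hκ' s hs]
      rw [he]
      exact hend k failed a hk
    · rintro j R' c ρ v ⟨κ', failed, a, hκ', rfl, rfl, rfl⟩
      have h := D.test_exec hχ hφ hℓ (F k) V b₀ w.reverse k n hk j failed κ' R'
      have h' := Exec.smul (h.imp (Q' := fun c ρ v => (∃ (κ' : ℕ → List Bool) (failed : Bool)
        (a : ℂ), (∀ s, s ∉ S → κ' s = κ s) ∧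
        c = D.mem w.reverse k.reverse [] (if failed then [true] else []) κ' ∧
        ρ = a • QMat.place (χ (b₀ + j)) ∧ v = a * D.testValue φ ℓ (F k) V b₀ k j failed) ∧
        ∀ s ∈ S, c s = D.mem w.reverse k.reverse [] (if failed then [true] else []) κ' s) ?_) a ?_
      · exact h'
      · rintro c ρ v ⟨failed', a', rfl, rfl, rfl⟩
        refine ⟨⟨κ', failed', a', hκ', rfl, rfl, rfl⟩, fun s hs => ?_⟩
        have h2 : s < D.base := by have := hs.2; omega
        rw [D.mem_counter _ _ _ _ _ hs.1 h2, D.mem_counter _ _ _ _ _ hs.1 h2]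
      · rintro c ρ v ⟨⟨κ'', failed', a', h1, rfl, rfl, rfl⟩, h2⟩
        exact ⟨⟨κ'', failed', a * a', h1, rfl, by rw [mul_smul], by rw [mul_assoc]⟩, h2⟩
    · rintro j c ρ v s l hs ⟨κ', failed, a, hκ', rfl, rfl, rfl⟩
      refine ⟨Function.update κ' s l, failed, a, fun t ht => ?_, ?_, rfl, rfl⟩
      · rw [Function.update_of_ne (by rintro rfl; exact ht hs), hκ' t ht]
      · exact D.update_mem hs.1 (by have := hs.2; omega) l
    · intro j hj
      rw [List.mem_range] at hj
      simp only [hS, ctr, ctrAux, Set.mem_ofPred_eq]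
      omega
    · intro j hj
      rw [List.mem_range] at hj
      have h1 : D.mem w.reverse k.reverse [] [] κ (ctr j) = κ (ctr j) :=
        D.mem_counter _ _ _ _ _ (by simp only [ctr]; omega) (by simp only [ctr]; omega)
      have h2 : D.mem w.reverse k.reverse [] [] κ (ctrAux j) = κ (ctrAux j) :=
        D.mem_counter _ _ _ _ _ (by simp only [ctrAux]; omega) (by simp only [ctrAux]; omega)
      rw [h1, h2]
      exact hκ j hj
    · refine ⟨κ, false, a, fun _ _ => rfl, rfl, ?_, ?_⟩ <;> rw [List.length_range, Nat.zero_add]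
  have hmain := (hcall (.seq (.spread K [2]) (.seq (Prog.rep D.test (List.range D.e₁))
      (.ifTop 5 (.seq (.pop 5) (.clear 2)) (.push 4 true))) :: R)).bind
    (R' := R) (Q' := Post)
    (T' := repTime n (D.testTime n) D.e₁ + (2 * D.keyBound n + 6) + (7 * D.keyBound n + 3)) (by
    rintro c ρ v ⟨k, a, hk, rfl, rfl, rfl⟩
    have hkb : k.length ≤ D.keyBound n := by simpa [keyBound] using hk
    rw [Function.update_idem]
    have hspread := Prog.spread_singleton_det (s := K) (t := 2) (by omega)
      (Function.update (D.mem w.reverse [] [] [] κ) K k)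
    have he : Function.update (Function.update (Function.update (D.mem w.reverse [] [] [] κ) K k) 2
        ((Function.update (D.mem w.reverse [] [] [] κ) K k K).reverse ++
          Function.update (D.mem w.reverse [] [] [] κ) K k 2)) K [] =
        D.mem w.reverse k.reverse [] [] κ := by
      funext i
      by_cases hiK : i = K
      · subst hiK
        rw [Function.update_self, hempty]
      · rw [Function.update_of_ne hiK]
        by_cases hi2 : i = 2
        · subst hi2
          simp [mem, hiK]
        · rw [Function.update_of_ne hi2, Function.update_of_ne hiK]
          simp [mem, hi2]
    rw [he, Function.update_self] at hspread
    refine (Exec.one' rfl (hspread _ _ _ _ _ _ (Exec.one' rfl (htests k a hkb)))).mono ?_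
    omega)
  have hseq := hcopy (.seq (D.keyGen.prog.sub.shift K) (.seq (.spread K [2])
    (.seq (Prog.rep D.test (List.range D.e₁))
      (.ifTop 5 (.seq (.pop 5) (.clear 2)) (.push 4 true)))) :: R) _ _ _ _ _ (Exec.one' rfl hmain)
  refine (Exec.one' (L := D.attempt :: R) rfl hseq).mono ?_
  simp only [attemptTime, Nat.add_zero, ← hn]
  omega

/-- A bound on the running time of the adversary. -/
def totalTime (n : ℕ) : ℕ :=
  repTime n (D.attemptTime n + 2) D.e₂ +
    (n * (2 * (D.e₁ + D.e₂) + 7) + 7 * D.keyBound n + 10)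

/-- The number of unused blocks depends on the round in which a key is accepted, and their trace
enters the value; therefore `hF` is required for every `b`. General `χ` and `φ` cover both copies of
a state and matrix units. -/
theorem prog_exec {χ φ : ℕ → QOp} {ℓ : ℕ → ℕ}
    (hχ : ∀ b, QOp.Splits D.m (χ (b + 1)) (φ b) (χ b)) (hφ : ∀ b, (φ b).OnQubits (ℓ b))
    (hℓ : ∀ b, ℓ b ≤ D.m) (F f : List Bool → ℂ)
    (hF : ∀ b k, (QMat.place (χ b)).tr * f k = F k) (w : List Bool) :
    Exec [] (fun c ρ v => v = ρ.tr * f (c 0)) (D.totalTime w.length)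
      (D.prog.start w (χ (w.length ^ D.e₂ * w.length ^ D.e₁)))
      (D.roundValue φ ℓ F w (w.length ^ D.e₁) (w.length ^ D.e₂)) := by
  set n := w.length with hn
  set s := n ^ D.e₁ with hs
  set S : Set ℕ := {t | 7 + 2 * D.e₁ ≤ t ∧ t < D.base} with hS
  -- Either no key has been accepted and exactly `i * s` blocks remain, or the key `k` is settled
  -- and the remaining rounds are skipped.
  set Q : ℕ → (ℕ → List Bool) → QMat → ℂ → Prop := fun i c ρ v => ∃ κ : ℕ → List Bool,
    (∀ j < D.e₁, (κ (ctr j)).length = n ∧ κ (ctrAux j) = []) ∧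
    ((∃ a : ℂ, c = D.mem w.reverse [] [] [] κ ∧ ρ = a • QMat.place (χ (i * s)) ∧
        v = a * D.roundValue φ ℓ F w s i) ∨
      ∃ (a : ℂ) (k : List Bool) (b : ℕ), k.length ≤ D.keyBound n ∧
        c = D.mem w.reverse k.reverse [true] [] κ ∧ ρ = a • QMat.place (χ b) ∧ v = a * F k) with hQ
  have hmemS : ∀ (key d f key' d' f' : List Bool) (κ : ℕ → List Bool), ∀ t ∈ S,
      D.mem w.reverse key d f κ t = D.mem w.reverse key' d' f' κ t := by
    intro key d f key' d' f' κ t ht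
    have h1 : 7 ≤ t := by have := ht.1; omega
    rw [D.mem_counter _ _ _ _ _ h1 ht.2, D.mem_counter _ _ _ _ _ h1 ht.2]
  have hround : ∀ i R c ρ v, Q (i + 1) c ρ v →
      Exec R (fun c' ρ' v' => Q i c' ρ' v' ∧ ∀ t ∈ S, c' t = c t) (D.attemptTime n + 2)
        ⟨D.round :: R, c, ρ⟩ v := by
    rintro i R c ρ v ⟨κ, hκ, ⟨a, rfl, rfl, rfl⟩ | ⟨a, k, b, hk, rfl, rfl, rfl⟩⟩
    · have h := D.attempt_exec hχ hφ hℓ F (D.roundValue φ ℓ F w s i) (i * s) w κ hκ R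
      rw [← hn, ← hs, ← Nat.succ_mul] at h
      have h' := Exec.smul (h.imp (Q' := fun c' ρ' v' => Q i c' ρ' v' ∧
        ∀ t ∈ S, c' t = D.mem w.reverse [] [] [] κ t) ?_) a ?_
      · refine (Exec.one' (L := D.round :: R) ?_ h').mono (by omega)
        simp only [round, branches]
        rw [if_neg (by simp [mem])]
      · rintro c ρ v (⟨a, rfl, rfl, rfl⟩ | ⟨a, k, hk, rfl, rfl, rfl⟩)
        · exact ⟨⟨κ, hκ, Or.inl ⟨a, rfl, rfl, rfl⟩⟩, fun t ht => rfl⟩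
        · exact ⟨⟨κ, hκ, Or.inr ⟨a, k, _, hk, rfl, rfl, rfl⟩⟩, hmemS _ _ _ _ _ _ κ⟩
      · rintro c ρ v ⟨⟨κ', hκ', ⟨a', rfl, rfl, rfl⟩ | ⟨a', k, b, hk, rfl, rfl, rfl⟩⟩, h2⟩
        · exact ⟨⟨κ', hκ', Or.inl ⟨a * a', rfl, by rw [mul_smul], by rw [mul_assoc]⟩⟩, h2⟩
        · exact ⟨⟨κ', hκ', Or.inr ⟨a * a', k, b, hk, rfl, by rw [mul_smul], by rw [mul_assoc]⟩⟩, h2⟩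
    · refine ((Prog.Det.ifTop_pos (s := 4) (by simp [mem]) (Prog.Det.skip _)) R R _ 0 _ _
        (Exec.done ⟨⟨κ, hκ, Or.inr ⟨a, k, b, hk, rfl, rfl, rfl⟩⟩, fun _ _ => rfl⟩)).mono (by omega)
  have hupd : ∀ i c ρ v t l, t ∈ S → Q i c ρ v → Q i (Function.update c t l) ρ v := by
    rintro i c ρ v t l ht ⟨κ, hκ, h⟩
    have ht1 := ht.1
    refine ⟨Function.update κ t l, fun j hj => ?_, ?_⟩
    · rw [Function.update_of_ne (by simp only [ctr]; omega),
        Function.update_of_ne (by simp only [ctrAux]; omega)]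
      exact hκ j hj
    · rcases h with ⟨a, rfl, h⟩ | ⟨a, k, b, hk, rfl, h⟩
      · exact Or.inl ⟨a, D.update_mem (by omega) ht.2 l, h⟩
      · exact Or.inr ⟨a, k, b, hk, D.update_mem (by omega) ht.2 l, h⟩
  -- initialisation
  set κ₀ : ℕ → List Bool := fun t =>
    if t ∈ (List.range (D.e₁ + D.e₂)).map ctr then w.reverse else [] with hκ₀
  have hctr : ∀ j, j < D.e₁ + D.e₂ → κ₀ (ctr j) = w.reverse := fun j hj =>
    if_pos (List.mem_map.mpr ⟨j, List.mem_range.mpr hj, rfl⟩)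
  have haux : ∀ j, κ₀ (ctrAux j) = [] := by
    intro j
    refine if_neg fun h => ?_
    obtain ⟨i, -, hi⟩ := List.mem_map.mp h
    simp only [ctr, ctrAux] at hi
    omega
  have hnodup : (1 :: (List.range (D.e₁ + D.e₂)).map ctr).Nodup := by
    rw [List.nodup_cons]
    constructor
    · intro h
      obtain ⟨i, -, hi⟩ := List.mem_map.mp h
      simp only [ctr] at hi
      omega
    · exact List.nodup_range.map fun a b h => by simp only [ctr] at h; omega
  have h0 : 0 ∉ 1 :: (List.range (D.e₁ + D.e₂)).map ctr := by
    intro h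
    rcases List.mem_cons.mp h with h | h
    · omega
    · obtain ⟨i, -, hi⟩ := List.mem_map.mp h
      simp only [ctr] at hi
      omega
  have hinit := Prog.spread_det hnodup h0 (bitsOf w)
  have he : (fun i => if i = 0 then [] else if i ∈ 1 :: (List.range (D.e₁ + D.e₂)).map ctr then
      (bitsOf w 0).reverse ++ bitsOf w i else bitsOf w i) = D.mem w.reverse [] [] [] κ₀ := by
    funext i
    have hb : ∀ i, i ≠ 0 → bitsOf w i = [] := fun i hi => by simp [bitsOf, hi]
    have hb0 : bitsOf w 0 = w := by simp [bitsOf]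
    by_cases hi0 : i = 0
    · subst hi0; simp [mem]
    · rw [if_neg hi0, hb i hi0, hb0, List.append_nil]
      by_cases hi1 : i = 1
      · subst hi1; simp [mem]
      · by_cases hi : i ∈ (List.range (D.e₁ + D.e₂)).map ctr
        · rw [if_pos (List.mem_cons_of_mem _ hi)]
          obtain ⟨j, hj, rfl⟩ := List.mem_map.mp hi
          rw [List.mem_range] at hj
          rw [D.mem_counter _ _ _ _ _ (by simp only [ctr]; omega)
            (by simp only [ctr, base]; omega), hctr j hj]
        · rw [if_neg (by simpa [hi1] using hi)]
          have hi' : κ₀ i = [] := if_neg hi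
          simp [mem, hi1, hi']
  rw [he, show bitsOf w 0 = w by simp [bitsOf]] at hinit
  -- the end
  have hend : ∀ (k d : List Bool) (κ : ℕ → List Bool) (a : ℂ) (b : ℕ),
      k.length ≤ D.keyBound n →
      Exec [] (fun c ρ v => v = ρ.tr * f (c 0)) (7 * D.keyBound n + 1)
        ⟨[.spread 2 [0]], D.mem w.reverse k.reverse d [] κ, a • QMat.place (χ b)⟩ (a * F k) := by
    intro k d κ a b hk
    have h := Prog.spread_singleton_det (s := 2) (t := 0) (by omega)
      (D.mem w.reverse k.reverse d [] κ)
    rw [show D.mem w.reverse k.reverse d [] κ 2 = k.reverse by simp [mem], List.reverse_reverse,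
      List.length_reverse, show D.mem w.reverse k.reverse d [] κ 0 = [] by simp [mem],
      List.append_nil] at h
    refine (h [] [] _ 0 _ _ (Exec.done ?_)).mono (by omega)
    rw [QMat.tr_smul, ← hF b, Function.update_of_ne (by omega), Function.update_self, mul_assoc]
  have hrep := Prog.rep_exec (n := n) (Q := Q) (S := S) hround hupd
    ((List.range D.e₂).map (D.e₁ + ·)) (List.nodup_range.map fun a b h => by simpa using h) (by
      intro j hj
      obtain ⟨i, hi, rfl⟩ := List.mem_map.mp hj
      rw [List.mem_range] at hi
      simp only [hS, ctr, ctrAux, base, Set.mem_ofPred_eq]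
      omega) 0 [.spread 2 [0]] (D.mem w.reverse [] [] [] κ₀)
    (QMat.place (χ (n ^ D.e₂ * s))) (D.roundValue φ ℓ F w s (n ^ D.e₂)) (by
      intro j hj
      obtain ⟨i, hi, rfl⟩ := List.mem_map.mp hj
      rw [List.mem_range] at hi
      have hbase : D.base = 7 + 2 * (D.e₁ + D.e₂) := rfl
      have h1 : D.mem w.reverse [] [] [] κ₀ (ctr (D.e₁ + i)) = κ₀ (ctr (D.e₁ + i)) :=
        D.mem_counter _ _ _ _ _ (by simp only [ctr]; omega) (by simp only [ctr]; omega)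
      have h2 : D.mem w.reverse [] [] [] κ₀ (ctrAux (D.e₁ + i)) = κ₀ (ctrAux (D.e₁ + i)) :=
        D.mem_counter _ _ _ _ _ (by simp only [ctrAux]; omega) (by simp only [ctrAux]; omega)
      rw [h1, h2, hctr _ (by omega), haux]
      simp [hn]) (by
      refine ⟨κ₀, fun j hj => ⟨by rw [hctr j (by omega), List.length_reverse], haux j⟩, Or.inl
        ⟨1, rfl, ?_, ?_⟩⟩
      · rw [List.length_map, List.length_range, Nat.zero_add, one_smul]
      · rw [List.length_map, List.length_range, Nat.zero_add, one_mul])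
  rw [List.length_map, List.length_range] at hrep
  have hall := hrep.bind (R' := []) (T' := 7 * D.keyBound n + 1)
    (Q' := fun c ρ v => v = ρ.tr * f (c 0)) (by
    rintro c ρ v ⟨⟨κ, -, ⟨a, rfl, rfl, rfl⟩ | ⟨a, k, b, hk, rfl, rfl, rfl⟩⟩, -⟩
    -- If no key was accepted, stack `2` is empty and the output is `[]`, as in the base case of
    -- `roundValue`.
    · exact hend [] [] κ a _ (Nat.zero_le _)
    · exact hend k [true] κ a b hk)
  rw [Prog.start_eq]
  refine (Exec.one' (L := [D.prog]) rfl (hinit _ _ _ _ _ _ (Exec.one' rfl hall))).mono ?_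
  simp only [totalTime, List.length_cons, List.length_map, List.length_range, ← hn]
  rw [show 2 * (D.e₁ + D.e₂ + 1) + 5 = 2 * (D.e₁ + D.e₂) + 7 by ring]
  omega

end AdvData

end

noncomputable section

open scoped ComplexOrder Classical

open Config

/-! ## The adversary is a polynomial-time algorithm -/

/-- The function `f` is a polynomial with natural coefficients. -/
def IsNatPoly (f : ℕ → ℕ) : Prop := ∃ p : Polynomial ℕ, ∀ n, p.eval n = f n

namespace IsNatPoly

variable {f g : ℕ → ℕ}

theorem const (a : ℕ) : IsNatPoly fun _ => a := ⟨Polynomial.C a, by simp⟩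

theorem id : IsNatPoly fun n => n := ⟨Polynomial.X, by simp⟩

theorem add (hf : IsNatPoly f) (hg : IsNatPoly g) : IsNatPoly fun n => f n + g n := by
  obtain ⟨p, hp⟩ := hf
  obtain ⟨q, hq⟩ := hg
  exact ⟨p + q, by simp [hp, hq]⟩

theorem mul (hf : IsNatPoly f) (hg : IsNatPoly g) : IsNatPoly fun n => f n * g n := by
  obtain ⟨p, hp⟩ := hf
  obtain ⟨q, hq⟩ := hg
  exact ⟨p * q, by simp [hp, hq]⟩

theorem eval (q : Polynomial ℕ) (hf : IsNatPoly f) : IsNatPoly fun n => q.eval (f n) := by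
  obtain ⟨p, hp⟩ := hf
  exact ⟨q.comp p, by simp [hp]⟩

theorem subTime (W : ℕ) (hf : IsNatPoly f) (hg : IsNatPoly g) :
    IsNatPoly fun n => _root_.subTime W (f n) (g n) :=
  hg.add ((((const W).mul (((const 4).mul (hf.add hg)).add (const 2))).add
    ((const W).mul (((const 2).mul (hf.add hg)).add (const 2)))).add (const 4))

theorem repTime (hf : IsNatPoly f) (k : ℕ) : IsNatPoly fun n => _root_.repTime n (f n) k := by
  induction k with
  | zero => exact hf
  | succ k ih => exact (id.mul (ih.add (const 6))).add ((id.mul (const 7)).add (const 3))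

end IsNatPoly

theorem AdvData.isNatPoly_totalTime (D : AdvData) : IsNatPoly D.totalTime := by
  have hkey : IsNatPoly D.keyBound := IsNatPoly.id.add (IsNatPoly.id.eval _)
  have hm : IsNatPoly fun n => D.keyBound n + D.m := hkey.add (IsNatPoly.const _)
  have htest : IsNatPoly D.testTime :=
    (IsNatPoly.subTime _ hm (hm.eval _)).add
      ((((hkey.mul (IsNatPoly.const 16)).add (IsNatPoly.const (4 * D.m))).add
        ((IsNatPoly.const 2).mul (hm.add (hm.eval _)))).add (IsNatPoly.const 20))
  have hatt : IsNatPoly D.attemptTime :=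
    (IsNatPoly.subTime _ IsNatPoly.id (IsNatPoly.id.eval _)).add
      ((htest.repTime _).add ((((IsNatPoly.const 16).mul IsNatPoly.id).add
        ((IsNatPoly.const 9).mul hkey)).add (IsNatPoly.const 20)))
  exact ((hatt.add (IsNatPoly.const 2)).repTime _).add
    (((IsNatPoly.id.mul (IsNatPoly.const _)).add ((IsNatPoly.const 7).mul hkey)).add
      (IsNatPoly.const 10))

/-- The matrix unit `|x⟩⟨y|`. -/
def QOp.unit (x y : List Bool) : QOp := fun a b => if a = x ∧ b = y then 1 else 0

theorem QOp.unit_onQubits {x y : List Bool} {n : ℕ} (hx : x.length = n) (hy : y.length = n) :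
    (QOp.unit x y).OnQubits n := by
  intro a b h
  obtain ⟨⟨rfl, rfl⟩, -⟩ := ite_ne_right_iff.mp h
  exact ⟨hx, hy⟩

theorem QOp.zero_onQubits (n : ℕ) : QOp.OnQubits n 0 := fun _ _ h => absurd rfl h

/-- Cutting both index strings after `m` bits writes a matrix unit as a product, so the analysis for
blocks applies to it. -/
theorem QOp.unit_splits (m : ℕ) {x y : List Bool} (h : x.length = y.length) :
    QOp.Splits m (QOp.unit x y) (QOp.unit (x.take m) (y.take m))
      (QOp.unit (x.drop m) (y.drop m)) := by
  refine ⟨x.length, unit_onQubits rfl h.symm, unit_onQubits (by simp) (by simp [h]), ?_⟩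
  intro u u' a b hu hu'
  have key : ∀ (z u a : List Bool), u.length = min m z.length →
      (u ++ a = z ↔ u = z.take m ∧ a = z.drop m) := by
    intro z u a hu
    constructor
    · rintro rfl
      by_cases hm : m ≤ (u ++ a).length
      · rw [min_eq_left hm] at hu
        subst hu
        simp
      · push Not at hm
        rw [min_eq_right hm.le, List.length_append] at hu
        have ha : a = [] := List.length_eq_zero_iff.mp (by omega)
        subst ha
        simp only [List.append_nil] at hm ⊢
        rw [List.take_of_length_le hm.le, List.drop_eq_nil_of_le hm.le]
        exact ⟨rfl, rfl⟩
    · rintro ⟨rfl, rfl⟩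
      exact List.take_append_drop m z
  simp only [unit, key x u a hu, key y u' b (by rw [hu', h])]
  by_cases h1 : u = x.take m ∧ u' = y.take m
  · by_cases h2 : a = x.drop m ∧ b = y.drop m
    · rw [if_pos h1, if_pos h2, if_pos ⟨⟨h1.1, h2.1⟩, h1.2, h2.2⟩, one_mul]
    · rw [if_neg h2, mul_zero, if_neg]
      rintro ⟨h3, h4⟩
      exact h2 ⟨h3.2, h4.2⟩
  · rw [if_neg h1, zero_mul, if_neg]
    rintro ⟨h3, h4⟩
    exact h1 ⟨h3.1, h4.1⟩

theorem QOp.zero_splits (m : ℕ) (ψ : QOp) : QOp.Splits m 0 0 ψ :=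
  ⟨0, zero_onQubits _, zero_onQubits _, fun _ _ _ _ _ _ => (zero_mul _).symm⟩

theorem Exec.halts {T : ℕ} {C : Config} {f : List Bool → ℂ} {v : ℂ}
    (h : Exec [] (fun c ρ v => v = ρ.tr * f (c 0)) T C v) :
    (∀ C' ∈ C.run T, C'.todo = [] ∨ C'.qubits = 0) ∧
      ((C.run T).map fun C' => QMat.tr C'.qubits * f (C'.bits 0)).sum = v :=
  Exec.to_run (g := fun C' => QMat.tr C'.qubits * f (C'.bits 0))
    (fun C hC => by simp [hC, QMat.tr_zero]) h

/-- Only the running time matters here, so `prog_exec` is applied with all values zero. -/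
theorem AdvData.halts_unit (D : AdvData) (w : List Bool) {x y : List Bool}
    (h : x.length = y.length) {T : ℕ} (hT : D.totalTime w.length ≤ T) :
    ∀ C ∈ (D.prog.start w (QOp.unit x y)).run T, C.todo = [] ∨ C.qubits = 0 := by
  set B := w.length ^ D.e₂ * w.length ^ D.e₁ with hB
  -- `χ b` is what remains when `b` of the `B` blocks are left. Above `B` everything is zero, so the
  -- splitting holds for all `b`.
  set χ : ℕ → QOp := fun b => if b ≤ B then
    QOp.unit (x.drop ((B - b) * D.m)) (y.drop ((B - b) * D.m)) else 0 with hχ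
  set φ : ℕ → QOp := fun b => if b + 1 ≤ B then
    QOp.unit ((x.drop ((B - (b + 1)) * D.m)).take D.m) ((y.drop ((B - (b + 1)) * D.m)).take D.m)
    else 0 with hφ
  have hs : ∀ b, QOp.Splits D.m (χ (b + 1)) (φ b) (χ b) := by
    intro b
    simp only [hχ, hφ]
    by_cases hb : b + 1 ≤ B
    · rw [if_pos hb, if_pos hb, if_pos (by omega)]
      have := QOp.unit_splits D.m (x := x.drop ((B - (b + 1)) * D.m))
        (y := y.drop ((B - (b + 1)) * D.m)) (by simp [h])
      rw [List.drop_drop, List.drop_drop] at this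
      rwa [show (B - (b + 1)) * D.m + D.m = (B - b) * D.m by
        rw [← Nat.succ_mul]; congr 1; omega] at this
    · rw [if_neg hb, if_neg hb]
      exact QOp.zero_splits _ _
  have hφq : ∀ b, (φ b).OnQubits ((x.drop ((B - (b + 1)) * D.m)).take D.m).length := by
    intro b
    simp only [hφ]
    split
    · exact QOp.unit_onQubits rfl (by simp [h])
    · exact QOp.zero_onQubits _
  have hexec := D.prog_exec hs hφq (fun b => by simp) (fun _ => 0) (fun _ => 0) (by simp) w
  rw [← hB, show χ B = QOp.unit x y by simp [hχ]] at hexec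
  exact (Exec.halts (f := fun _ => 0) (hexec.mono hT)).1

theorem QMat.place_eq_sum {φ : QOp} {n : ℕ} (hφ : φ.OnQubits n) :
    QMat.place φ = ∑ x ∈ (List.finite_length_eq Bool n).toFinset,
      ∑ y ∈ (List.finite_length_eq Bool n).toFinset, φ x y • QMat.place (QOp.unit x y) := by
  funext a b
  simp only [Matrix.sum_apply, Matrix.smul_apply]
  by_cases h : ∀ r, r ≠ 0 → a r = [] ∧ b r = []
  · simp only [place, if_pos h, QOp.unit]
    by_cases hne : φ (a 0) (b 0) = 0
    · rw [hne]
      symm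
      refine Finset.sum_eq_zero fun x _ => Finset.sum_eq_zero fun y _ => ?_
      by_cases hxy : a 0 = x ∧ b 0 = y
      · rw [← hxy.1, ← hxy.2, hne, zero_smul]
      · rw [if_neg hxy, smul_zero]
    · obtain ⟨h1, h2⟩ := hφ _ _ hne
      rw [Finset.sum_eq_single (a 0), Finset.sum_eq_single (b 0)]
      · simp
      · intro y _ hy
        rw [if_neg (fun h => hy h.2.symm), smul_zero]
      · intro h; simp [h2] at h
      · intro x _ hx
        refine Finset.sum_eq_zero fun y _ => ?_
        rw [if_neg (fun h => hx h.1.symm), smul_zero]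
      · intro h; simp [h1] at h
  · simp only [place, if_neg h, smul_zero, Finset.sum_const_zero]

/-- An unfinished path sends every matrix unit to zero, hence by linearity every operator on `n`
qubits. -/
theorem AdvData.halts (D : AdvData) (w : List Bool) {n : ℕ} {φ : QOp} (hφ : φ.OnQubits n) {T : ℕ}
    (hT : D.totalTime w.length ≤ T) :
    ∀ C ∈ (D.prog.start w φ).run T, C.todo = [] ∨ C.qubits = 0 := by
  rw [Prog.start_eq, run_eq_paths]
  intro C hC
  obtain ⟨p, hp, rfl⟩ := List.mem_map.mp hC
  by_cases hp1 : p.1 = []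
  · exact Or.inl hp1
  · right
    change p.2.2 (QMat.place φ) = 0
    rw [QMat.place_eq_sum hφ, map_sum]
    refine Finset.sum_eq_zero fun x hx => ?_
    rw [map_sum]
    refine Finset.sum_eq_zero fun y hy => ?_
    simp only [Set.Finite.mem_toFinset, Set.mem_ofPred_eq] at hx hy
    have h := D.halts_unit w (x := x) (y := y) (hx.trans hy.symm) hT
    rw [Prog.start_eq, run_eq_paths] at h
    have h2 := (h _ (List.mem_map.mpr ⟨p, hp, rfl⟩)).resolve_left hp1
    change p.2.2 (QMat.place (QOp.unit x y)) = 0 at h2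
    rw [map_smul, h2, smul_zero]

/-- The adversary as a quantum polynomial-time algorithm. -/
def AdvData.qpt (D : AdvData) : QPT where
  prog := D.prog
  time := D.isNatPoly_totalTime.choose
  halts := fun w n φ hφ => D.halts w hφ (by
    rw [← D.isNatPoly_totalTime.choose_spec]
    exact Polynomial.eval_nat_mono _ (Nat.le_add_right _ _))

theorem AdvData.qpt_time (D : AdvData) (n : ℕ) : D.qpt.time.eval n = D.totalTime n :=
  D.isNatPoly_totalTime.choose_spec n

end

noncomputable section

open scoped ComplexOrder Classical

open Config

/-! ## Expected values as real numbers -/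

/-- A density operator on `n` qubits, in the form in which it enters a computation. -/
structure QOp.IsInput (n : ℕ) (φ : QOp) : Prop where
  onQubits : φ.OnQubits n
  gram : (QMat.place φ).IsGram
  tr_eq_one : (QMat.place φ).tr = 1

theorem QOp.isInput_empty : QOp.IsInput 0 QOp.empty where
  onQubits := QOp.empty_onQubits
  gram := by
    refine ⟨1, fun _ => Pi.single (fun _ => []) 1, ?_⟩
    funext x y
    rw [QMat.place_empty_apply]
    simp only [Finset.univ_unique, Finset.sum_singleton, QMat.rankOne]
    by_cases hx : x = fun _ => [] <;> by_cases hy : y = fun _ => [] <;> simp [hx, hy]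
  tr_eq_one := QMat.tr_place_empty

theorem QOp.IsState.isInput {n : ℕ} {φ : QOp} (h : φ.IsState n) : φ.IsInput n where
  onQubits := h.1
  gram := by
    have : Finite {x : List Bool // x.length = n} := (List.finite_length_eq Bool n).to_subtype
    have := Fintype.ofFinite {x : List Bool // x.length = n}
    -- The decomposition is taken over the finitely many strings of length `n` and extended by zero.
    obtain ⟨N, v, hv⟩ := Matrix.posSemidef_iff_eq_sum_vecMulVec.mp
      (h.2.1.submatrix (Subtype.val : {x : List Bool // x.length = n} → List Bool))
    refine ⟨N, fun i x => if hx : (∀ r, r ≠ 0 → x r = []) ∧ (x 0).length = n then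
      v i ⟨x 0, hx.2⟩ else 0, ?_⟩
    funext x y
    rw [Matrix.sum_apply]
    simp only [QMat.rankOne, QMat.place]
    by_cases hx : (∀ r, r ≠ 0 → x r = []) ∧ (x 0).length = n
    · by_cases hy : (∀ r, r ≠ 0 → y r = []) ∧ (y 0).length = n
      · have := congrFun₂ hv ⟨x 0, hx.2⟩ ⟨y 0, hy.2⟩
        rw [Matrix.sum_apply] at this
        simp only [dif_pos hx, dif_pos hy]
        rw [if_pos fun r hr => ⟨hx.1 r hr, hy.1 r hr⟩]
        exact this
      · simp only [dif_neg hy, star_zero, mul_zero, Finset.sum_const_zero, ite_eq_right_iff]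
        intro h0
        by_contra hne
        exact hy ⟨fun r hr => (h0 r hr).2, (h.1 _ _ hne).2⟩
    · simp only [dif_neg hx, zero_mul, Finset.sum_const_zero, ite_eq_right_iff]
      intro h0
      by_contra hne
      exact hx ⟨fun r hr => (h0 r hr).1, (h.1 _ _ hne).1⟩
  tr_eq_one := by rw [QMat.tr_place, h.2.2]

namespace Prog

theorem expectC_smul (P : Prog) (w : List Bool) (φ : QOp) (T : ℕ) (a : ℂ) (g : List Bool → ℂ) :
    P.expectC w φ T (fun y => a * g y) = a * P.expectC w φ T g := by
  unfold expectC
  rw [← List.sum_map_mul_left]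
  congr 1
  exact List.map_congr_left fun C _ => by ring

theorem expectC_add (P : Prog) (w : List Bool) (φ : QOp) (T : ℕ) (g g' : List Bool → ℂ) :
    P.expectC w φ T (fun y => g y + g' y) = P.expectC w φ T g + P.expectC w φ T g' := by
  unfold expectC
  rw [← List.sum_map_add]
  congr 1
  exact List.map_congr_left fun C _ => by ring

theorem expectC_const (P : Prog) (w : List Bool) {φ : QOp} {n : ℕ} (hφ : φ.OnQubits n) (T : ℕ)
    (a : ℂ) : P.expectC w φ T (fun _ => a) = (QMat.place φ).tr * a := by
  unfold expectC
  rw [List.sum_map_mul_right, sum_run_tr (P.start_bounded w hφ)]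
  rfl

/-- Linearity in `φ` with one coefficient per matrix unit: the origin of the bound 4^m on the rank
of the acceptance matrix. -/
theorem expectC_eq_sum (P : Prog) (w : List Bool) {φ : QOp} {n : ℕ} (hφ : φ.OnQubits n) (T : ℕ)
    (g : List Bool → ℂ) :
    P.expectC w φ T g = ∑ x ∈ (List.finite_length_eq Bool n).toFinset,
      ∑ y ∈ (List.finite_length_eq Bool n).toFinset, φ x y * P.expectC w (QOp.unit x y) T g := by
  have hlist : ∀ (L : List (List Prog × (ℕ → List Bool) × (QMat →ₗ[ℂ] QMat)))
      (S : Finset (List Bool)) (h : (List Prog × (ℕ → List Bool) × (QMat →ₗ[ℂ] QMat)) →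
        List Bool → List Bool → ℂ),
      ∑ x ∈ S, ∑ y ∈ S, φ x y * (L.map fun p => h p x y).sum =
        (L.map fun p => ∑ x ∈ S, ∑ y ∈ S, φ x y * h p x y).sum := by
    intro L S h
    induction L with
    | nil => simp
    | cons p L ih => simp [mul_add, Finset.sum_add_distrib, ih]
  simp only [expectC, start_eq, run_eq_paths, List.map_map, Function.comp_def]
  rw [hlist]
  congr 1
  refine List.map_congr_left fun p hp => ?_
  simp only [← mul_assoc, ← Finset.sum_mul]
  congr 1
  rw [QMat.place_eq_sum hφ]
  have hs : ∀ x ∈ (List.finite_length_eq Bool n).toFinset,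
      ∀ y ∈ (List.finite_length_eq Bool n).toFinset,
      Summable fun z => φ x y * p.2.2 (QMat.place (QOp.unit x y)) z z := by
    intro x hx y hy
    simp only [Set.Finite.mem_toFinset, Set.mem_ofPred_eq] at hx hy
    have hmem : (⟨p.1, p.2.1, p.2.2 (QMat.place (QOp.unit x y))⟩ : Config) ∈
        (P.start w (QOp.unit x y)).run T := by
      rw [start_eq, run_eq_paths]
      exact List.mem_map.mpr ⟨p, hp, rfl⟩
    have hb := ((P.start_bounded w (QOp.unit_onQubits hx hy)).run T _ hmem).qubits
    exact (summable_of_hasFiniteSupport (hb.finite_diag (StackBound.finite _ _))).mul_left _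
  simp only [map_sum, map_smul, QMat.tr, Matrix.sum_apply, Matrix.smul_apply, smul_eq_mul]
  rw [Summable.tsum_finsetSum fun x hx => summable_sum fun y hy => hs x hx y hy]
  refine Finset.sum_congr rfl fun x hx => ?_
  rw [Summable.tsum_finsetSum fun y hy => hs x hx y hy]
  exact Finset.sum_congr rfl fun y hy => tsum_mul_left

end Prog

namespace QPT

variable (A : QPT) (w : List Bool) {n : ℕ} {φ : QOp}

theorem expect_eq_re (n : ℕ) (φ : QOp) (f : List Bool → ℝ) :
    A.expect w n φ f = (A.prog.expectC w φ (A.time.eval (w.length + n)) fun y => (f y : ℂ)).re := by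
  unfold expect final Prog.expectC
  generalize (A.prog.start w φ).run (A.time.eval (w.length + n)) = L
  induction L with
  | nil => simp
  | cons C L ih =>
    rw [List.map_cons, List.sum_cons, List.map_cons, List.sum_cons, ih, Complex.add_re,
      Complex.re_mul_ofReal]
    rfl

theorem tr_final_nonneg (hφ : φ.IsInput n) : ∀ C ∈ A.final w n φ, 0 ≤ QMat.tr C.qubits :=
  fun C hC => (isGram_run (C := A.prog.start w φ) hφ.gram _ C hC).tr_nonneg
    ((A.prog.start_bounded w hφ.onQubits).run _ C hC).qubits (StackBound.finite _ _)

/-- Traces of Gram operators are nonnegative reals, so nothing is lost by taking real parts in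
`weight`. -/
theorem expectC_eq (hφ : φ.IsInput n) (f : List Bool → ℝ) :
    A.prog.expectC w φ (A.time.eval (w.length + n)) (fun y => (f y : ℂ)) = A.expect w n φ f := by
  have h := A.tr_final_nonneg w hφ
  unfold expect
  unfold final at h ⊢
  unfold Prog.expectC
  generalize (A.prog.start w φ).run (A.time.eval (w.length + n)) = L at h
  induction L with
  | nil => simp
  | cons C L ih =>
    have hC := h C (by simp)
    have : ((C.weight : ℝ) : ℂ) = QMat.tr C.qubits :=
      (Complex.eq_re_of_ofReal_le (r := 0) (by rwa [Complex.ofReal_zero])).symm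
    rw [List.map_cons, List.sum_cons, List.map_cons, List.sum_cons,
      ih fun C' hC' => h C' (by simp [hC']), ← this]
    push_cast
    rfl

theorem expect_const (hφ : φ.IsInput n) (a : ℝ) : A.expect w n φ (fun _ => a) = a := by
  rw [expect_eq_re, A.prog.expectC_const w hφ.onQubits, hφ.tr_eq_one]
  simp

theorem expect_mono (hφ : φ.IsInput n) {f g : List Bool → ℝ} (h : ∀ y, f y ≤ g y) :
    A.expect w n φ f ≤ A.expect w n φ g := by
  refine List.sum_le_sum fun C hC => mul_le_mul_of_nonneg_left (h _) ?_
  exact (Complex.nonneg_iff.mp (A.tr_final_nonneg w hφ C hC)).1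

/-- The possible outputs. -/
def outputs (n : ℕ) (φ : QOp) : Finset (List Bool) :=
  ((A.final w n φ).map fun C => C.bits 0).toFinset

theorem expect_eq_sum (n : ℕ) (φ : QOp) (f : List Bool → ℝ) :
    A.expect w n φ f = ∑ k ∈ A.outputs w n φ,
      A.expect w n φ (fun y => if y = k then 1 else 0) * f k := by
  unfold expect outputs
  generalize A.final w n φ = L
  have : ∀ S : Finset (List Bool), (∀ C ∈ L, C.bits 0 ∈ S) →
      (L.map fun C => C.weight * f (C.bits 0)).sum = ∑ k ∈ S,
        (L.map fun C => C.weight * if C.bits 0 = k then (1 : ℝ) else 0).sum * f k := by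
    intro S hS
    induction L with
    | nil => simp
    | cons C L ih =>
      simp only [List.map_cons, List.sum_cons, add_mul, Finset.sum_add_distrib]
      rw [ih fun C' hC' => hS C' (by simp [hC'])]
      congr 1
      simp [hS C (by simp)]
  exact this _ fun C hC => List.mem_toFinset.mpr (List.mem_map_of_mem hC)

end QPT

end

noncomputable section

open scoped ComplexOrder Classical

open Config

/-! ## The success probability of the adversary -/

theorem QOp.OnQubits.summable_diag {n : ℕ} {φ : QOp} (h : φ.OnQubits n) :
    Summable fun x => ‖φ x x‖ :=
  summable_of_hasFiniteSupport ((List.finite_length_eq Bool n).subset fun x hx =>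
    (h x x (norm_ne_zero_iff.mp hx)).1)

theorem QOp.copies_onQubits {m : ℕ} {φ : QOp} (h : φ.OnQubits m) (t : ℕ) :
    (QOp.copies m φ t).OnQubits (t * m) := by
  induction t with
  | zero => rw [Nat.zero_mul]; exact empty_onQubits
  | succ t ih =>
    intro x y hxy
    obtain ⟨h1, h2⟩ := h _ _ (left_ne_zero_of_mul hxy)
    obtain ⟨h3, h4⟩ := ih _ _ (right_ne_zero_of_mul hxy)
    rw [← List.take_append_drop m x, ← List.take_append_drop m y, List.length_append,
      List.length_append, h1, h2, h3, h4, Nat.succ_mul, Nat.add_comm]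
    exact ⟨rfl, rfl⟩

theorem QOp.copies_splits {m : ℕ} {φ : QOp} (h : φ.OnQubits m) (t : ℕ) :
    QOp.Splits m (QOp.copies m φ (t + 1)) φ (QOp.copies m φ t) := by
  have hmin : min m ((t + 1) * m) = m := by
    rw [Nat.succ_mul]; exact min_eq_left (Nat.le_add_left _ _)
  refine ⟨(t + 1) * m, copies_onQubits h _, by rwa [hmin], ?_⟩
  intro u u' x y hu hu'
  rw [hmin] at hu hu'
  simp only [copies]
  rw [List.take_left' hu, List.take_left' hu', List.drop_left' hu, List.drop_left' hu']

/-- Concatenation with a prefix of length `m` is injective and covers the support, so the trace of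
the product is the product of the traces. -/
theorem QOp.tsum_copies {m : ℕ} {φ : QOp} (h : φ.OnQubits m) (h1 : ∑' x, φ x x = 1) (t : ℕ) :
    ∑' x, QOp.copies m φ t x x = 1 := by
  induction t with
  | zero => rw [← QMat.tr_place]; exact QMat.tr_place_empty
  | succ t ih =>
    have hinj : Function.Injective
        fun z : {u : List Bool // u.length = m} × List Bool => z.1.1 ++ z.2 := by
      rintro ⟨⟨u, hu⟩, x⟩ ⟨⟨v, hv⟩, y⟩ hxy
      obtain ⟨rfl, rfl⟩ := List.append_inj hxy (hu.trans hv.symm)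
      rfl
    rw [← hinj.tsum_eq]
    · have h2 : ∑' u : {u : List Bool // u.length = m}, φ u.1 u.1 = 1 := by
        rw [← h1]
        exact tsum_subtype_eq_of_support_subset (s := {u | u.length = m})
          (f := fun u => φ u u) fun x hx => (h x x hx).1
      have h3 := tsum_mul_tsum_of_summable_norm
        (f := fun u : {u : List Bool // u.length = m} => φ u.1 u.1)
        (h.summable_diag.subtype _) (copies_onQubits h t).summable_diag
      rw [h2, ih, one_mul] at h3
      rw [h3]
      refine tsum_congr fun z => ?_
      simp only [copies]
      rw [List.take_left' z.1.2, List.drop_left' z.1.2]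
    · intro x hx
      refine ⟨⟨⟨x.take m, (h _ _ (left_ne_zero_of_mul hx)).1⟩, x.drop m⟩, ?_⟩
      simp

namespace AdvData

variable (D : AdvData) (φ : QOp) (w : List Bool) (s : ℕ)

/-- The probability that the key `k` passes a test on the state `φ`. -/
def accept (k : List Bool) : ℝ :=
  D.ver.expect k D.m φ fun y => if y.head? = some true then 1 else 0

/-- The probability that a random key passes `s` tests on the state `φ`. -/
def passProb : ℝ := D.keyGen.expect w 0 QOp.empty fun k => D.accept φ k ^ s

/-- The success probability of the adversary with `N` rounds of `s` tests each. -/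
def winValue : ℕ → ℝ
  | 0 => D.accept φ []
  -- The exponent `s + 1` counts the tests and the final verification of the output.
  | N + 1 => D.passProb φ w (s + 1) + (1 - D.passProb φ w s) * winValue N

variable {φ} (hφ : φ.IsInput D.m)

include hφ

theorem accept_nonneg (k : List Bool) : 0 ≤ D.accept φ k := by
  rw [← D.ver.expect_const k hφ 0]
  exact D.ver.expect_mono k hφ fun y => by split <;> norm_num

theorem accept_le_one (k : List Bool) : D.accept φ k ≤ 1 := by
  rw [← D.ver.expect_const k hφ 1]
  exact D.ver.expect_mono k hφ fun y => by split <;> norm_num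

theorem passProb_le_one : D.passProb φ w s ≤ 1 := by
  rw [← D.keyGen.expect_const w QOp.isInput_empty 1]
  exact D.keyGen.expect_mono w QOp.isInput_empty fun k =>
    pow_le_one₀ (D.accept_nonneg hφ k) (D.accept_le_one hφ k)

/-- A raised flag is never lowered during the tests, and the outcomes of the remaining ones sum to
probability one. -/
theorem testValue_true (F V : ℂ) (b₀ : ℕ) (k : List Bool) (j : ℕ) :
    D.testValue (fun _ => φ) (fun _ => D.m) F V b₀ k j true = V := by
  induction j with
  | zero => simp [testValue]
  | succ j ih =>
    simp only [testValue, ite_self, ih]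
    rw [D.ver.prog.expectC_const k hφ.onQubits, hφ.tr_eq_one, one_mul]

/-- The tests use separate copies and are independent, so `j` of them are passed with probability
`accept ^ j`. -/
theorem testValue_false (F V : ℂ) (b₀ : ℕ) (k : List Bool) (j : ℕ) :
    D.testValue (fun _ => φ) (fun _ => D.m) F V b₀ k j false =
      (D.accept φ k : ℂ) ^ j * F + (1 - (D.accept φ k : ℂ) ^ j) * V := by
  induction j with
  | zero => simp [testValue]
  | succ j ih =>
    simp only [testValue]
    have : (fun out : List Bool => D.testValue (fun _ => φ) (fun _ => D.m) F V b₀ k j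
        (if out.head? = some true then false else true)) = fun out =>
        ((D.accept φ k : ℂ) ^ j * F + (1 - (D.accept φ k : ℂ) ^ j) * V - V) *
          ((if out.head? = some true then 1 else 0 : ℝ) : ℂ) + V := by
      funext out
      split
      · rw [ih]; simp
      · rw [D.testValue_true hφ]; simp
    rw [this, Prog.expectC_add, Prog.expectC_smul, D.ver.expectC_eq k hφ,
      D.ver.prog.expectC_const k hφ.onQubits, hφ.tr_eq_one]
    change _ * (D.accept φ k : ℂ) + _ = _
    ring

theorem roundValue_eq (N : ℕ) :
    D.roundValue (fun _ => φ) (fun _ => D.m) (fun k => D.accept φ k) w s N =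
      D.winValue φ w s N := by
  induction N with
  | zero => rfl
  | succ N ih =>
    simp only [roundValue, ih, D.testValue_false hφ, winValue]
    have : (fun k : List Bool => (D.accept φ k : ℂ) ^ s * D.accept φ k +
        (1 - (D.accept φ k : ℂ) ^ s) * (D.winValue φ w s N : ℂ)) = fun k =>
        ((D.accept φ k ^ (s + 1) : ℝ) : ℂ) +
          ((- D.winValue φ w s N : ℝ) * ((D.accept φ k ^ s : ℝ) : ℂ) + D.winValue φ w s N) := by
      funext k
      push_cast
      ring
    have h1 := D.keyGen.expectC_eq w QOp.isInput_empty
    rw [Nat.add_zero] at h1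
    rw [this, Prog.expectC_add, Prog.expectC_add, Prog.expectC_smul, h1, h1,
      Prog.expectC_const _ _ QOp.empty_onQubits, QMat.tr_place_empty]
    push_cast [passProb]
    ring

/-- Unused copies have trace one, so `prog_exec` applies with the same function for `F` and `f`. -/
theorem expect_qpt :
    D.qpt.expect w (w.length ^ D.e₂ * w.length ^ D.e₁ * D.m)
      (QOp.copies D.m φ (w.length ^ D.e₂ * w.length ^ D.e₁)) (D.accept φ) =
      D.winValue φ w (w.length ^ D.e₁) (w.length ^ D.e₂) := by
  have h1 : ∑' x, φ x x = 1 := by rw [← QMat.tr_place, hφ.tr_eq_one]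
  have h := D.prog_exec (QOp.copies_splits hφ.onQubits) (fun _ => hφ.onQubits)
    (fun _ => le_rfl) (fun k => D.accept φ k) (fun k => D.accept φ k)
    (fun b k => by rw [QMat.tr_place, QOp.tsum_copies hφ.onQubits h1, one_mul]) w
  rw [QPT.expect_eq_re, D.qpt_time]
  have hle : D.totalTime w.length ≤
      D.totalTime (w.length + w.length ^ D.e₂ * w.length ^ D.e₁ * D.m) := by
    rw [← D.qpt_time, ← D.qpt_time]
    exact Polynomial.eval_nat_mono _ (Nat.le_add_right _ _)
  have h2 : D.qpt.prog.expectC w _ _ (fun k => (D.accept φ k : ℂ)) = _ :=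
    (Exec.halts (f := fun k => (D.accept φ k : ℂ)) (h.mono hle)).2
  rw [h2, D.roundValue_eq w _ hφ, Complex.ofReal_re]

/-- The recursion unfolds to a geometric series; the gain from the last resort `[]` is discarded. -/
theorem le_winValue (N : ℕ) :
    D.passProb φ w (s + 1) * ∑ i ∈ Finset.range N, (1 - D.passProb φ w s) ^ i ≤
      D.winValue φ w s N := by
  induction N with
  | zero => simpa [winValue] using D.accept_nonneg hφ []
  | succ N ih =>
    rw [Finset.sum_range_succ', winValue, pow_zero, mul_add, mul_one, add_comm]
    have := D.passProb_le_one w s hφ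
    simp only [pow_succ', ← Finset.mul_sum]
    have h := mul_le_mul_of_nonneg_left ih (sub_nonneg.mpr this)
    linarith

end AdvData

end

noncomputable section

/-! ## The trace of a substochastic matrix of low rank -/

/-- The trace of P = VU equals that of UV, which is the sum of at most |J| roots of a characteristic
polynomial. A nonzero eigenvalue of UV with eigenvector x is an eigenvalue of P with eigenvector Vx,
and those have modulus at most 1. -/
theorem Matrix.trace_le_of_substochastic {K J : Type*} [Fintype K] [Fintype J] [DecidableEq K]
    [DecidableEq J] {P : Matrix K K ℝ} (hP : ∀ k k', 0 ≤ P k k') (hrow : ∀ k, ∑ k', P k k' ≤ 1)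
    {V : Matrix K J ℂ} {U : Matrix J K ℂ} (hVU : P.map (fun x => (x : ℂ)) = V * U) :
    P.trace ≤ Fintype.card J := by
  have htr : (P.trace : ℂ) = (U * V).trace := by
    rw [Matrix.trace_mul_comm, ← hVU]
    simp [Matrix.trace]
  have hroot : ∀ z ∈ (U * V).charpoly.roots, ‖z‖ ≤ 1 := by
    intro z hz
    by_cases hz0 : z = 0
    · simp [hz0]
    have hdet : (Matrix.scalar J z - U * V).det = 0 := by
      rw [← Matrix.eval_charpoly]
      exact (Polynomial.mem_roots'.mp hz).2
    obtain ⟨x, hx0, hx⟩ := Matrix.exists_mulVec_eq_zero_iff.mpr hdet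
    have hx' : (U * V).mulVec x = z • x := by
      rw [Matrix.sub_mulVec, sub_eq_zero] at hx
      rw [← hx]
      funext j
      simp [Matrix.scalar_apply, Matrix.mulVec_diagonal]
    set y := V.mulVec x with hy
    have hPy : (P.map fun x => (x : ℂ)).mulVec y = z • y := by
      rw [hVU, hy, ← Matrix.mulVec_mulVec, Matrix.mulVec_mulVec x U V, hx', Matrix.mulVec_smul]
    have hUy : U.mulVec y = z • x := by rw [hy, Matrix.mulVec_mulVec, hx']
    have hy0 : y ≠ 0 := by
      intro h0
      rw [h0, Matrix.mulVec_zero] at hUy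
      exact hx0 ((smul_eq_zero.mp hUy.symm).resolve_left hz0)
    have hK : Nonempty K := by
      by_contra hK
      rw [not_nonempty_iff] at hK
      exact hy0 (Subsingleton.elim _ _)
    -- At a coordinate where `y` has largest modulus, the row sum bound gives ‖z‖ ≤ 1.
    obtain ⟨k, -, hk⟩ := Finset.exists_max_image Finset.univ (fun k => ‖y k‖)
      ⟨hK.some, Finset.mem_univ _⟩
    have hpos : 0 < ‖y k‖ := by
      obtain ⟨k', hk'⟩ := Function.ne_iff.mp hy0
      exact (norm_pos_iff.mpr hk').trans_le (hk k' (Finset.mem_univ _))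
    have h1 : ‖z‖ * ‖y k‖ ≤ 1 * ‖y k‖ := by
      have := congrFun hPy k
      rw [Pi.smul_apply, smul_eq_mul] at this
      rw [← norm_mul, ← this]
      calc ‖∑ k', (P k k' : ℂ) * y k'‖ ≤ ∑ k', ‖(P k k' : ℂ) * y k'‖ := norm_sum_le _ _
        _ ≤ ∑ k', P k k' * ‖y k‖ := Finset.sum_le_sum fun k' _ => by
            rw [norm_mul, Complex.norm_real, Real.norm_of_nonneg (hP k k')]
            exact mul_le_mul_of_nonneg_left (hk k' (Finset.mem_univ _)) (hP k k')
        _ ≤ 1 * ‖y k‖ := by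
            rw [← Finset.sum_mul]
            exact mul_le_mul_of_nonneg_right (hrow k) (norm_nonneg _)
    exact le_of_mul_le_mul_right h1 hpos
  have hcard : (U * V).charpoly.roots.card ≤ Fintype.card J :=
    (Polynomial.card_roots' _).trans (Matrix.charpoly_natDegree_eq_dim _).le
  have hsum : ∀ M : Multiset ℂ, (∀ z ∈ M, ‖z‖ ≤ 1) → ‖M.sum‖ ≤ M.card := by
    intro M
    induction M using Multiset.induction with
    | empty => simp
    | cons z M ih =>
      intro h
      rw [Multiset.sum_cons, Multiset.card_cons]
      push_cast
      have h1 := h z (Multiset.mem_cons_self z M)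
      have h2 := ih fun z' hz' => h z' (Multiset.mem_cons_of_mem hz')
      linarith [norm_add_le z M.sum]
  calc P.trace ≤ ‖(P.trace : ℂ)‖ := by rw [Complex.norm_real]; exact le_abs_self _
    _ ≤ (U * V).charpoly.roots.card := by
        rw [htr, Matrix.trace_eq_sum_roots_charpoly]
        exact hsum _ hroot
    _ ≤ Fintype.card J := by exact_mod_cast hcard

/-! ## Guessing a key that passes many tests -/

section

variable {K I : Type*} [Fintype K] [Fintype I] {p : K → ℝ} {a : K → K → ℝ}

/-- The left side is the trace of the matrix p(k') a(k', k)^s / M(k). By the multinomial theorem a^s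
is a sum over exponent vectors of total degree `s`, so the matrix factors through these. -/
theorem sum_div_passProb_le (hp : ∀ k, 0 ≤ p k) (ha : ∀ k' k, 0 ≤ a k' k) {u v : K → I → ℂ}
    (huv : ∀ k' k, (a k' k : ℂ) = ∑ i, u k' i * v k i) (s : ℕ) :
    ∑ k, p k * a k k ^ s / ∑ k', p k' * a k' k ^ s ≤ ((s + 1 : ℕ) : ℝ) ^ Fintype.card I := by
  classical
  set M : K → ℝ := fun k => ∑ k', p k' * a k' k ^ s with hM
  have hM0 : ∀ k, 0 ≤ M k := fun k =>
    Finset.sum_nonneg fun k' _ => mul_nonneg (hp k') (pow_nonneg (ha k' k) s)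
  -- Each exponent is at most `s`, which gives the crude count (s + 1)^|I|.
  set J := {x // x ∈ (Finset.univ : Finset I).piAntidiag s}
  have hJ : Fintype.card J ≤ (s + 1) ^ Fintype.card I := by
    have hf : Function.Injective fun (x : J) (i : I) => (⟨x.1 i, Nat.lt_succ_of_le (by
        exact (Finset.single_le_sum (f := x.1) (fun _ _ => Nat.zero_le _)
          (Finset.mem_univ i)).trans (Finset.mem_piAntidiag.mp x.2).1.le)⟩ :
        Fin (s + 1)) := by
      intro x y hxy
      apply Subtype.ext
      funext i
      exact congrArg Fin.val (congrFun hxy i)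
    simpa using Fintype.card_le_of_injective _ hf
  have h := Matrix.trace_le_of_substochastic (K := K) (J := J)
    (P := Matrix.of fun k k' => p k' * a k' k ^ s / M k)
    (fun k k' => div_nonneg (mul_nonneg (hp k') (pow_nonneg (ha k' k) s)) (hM0 k))
    -- The row sum is M(k)/M(k), which is `0` when M(k) = 0 and `1` otherwise.
    (fun k => by simp only [Matrix.of_apply]; rw [← Finset.sum_div]; exact div_self_le_one _)
    (V := Matrix.of fun k x => (∏ i, v k i ^ x.1 i) / M k)
    (U := Matrix.of fun x k' => Nat.multinomial Finset.univ x.1 * (∏ i, u k' i ^ x.1 i) * p k') (by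
      ext k k'
      rw [Matrix.map_apply, Matrix.mul_apply]
      simp only [Matrix.of_apply]
      push_cast
      rw [huv, Finset.sum_pow_eq_sum_piAntidiag, Finset.mul_sum, Finset.sum_div,
        ← Finset.sum_coe_sort]
      refine Finset.sum_congr rfl fun x _ => ?_
      simp only [mul_pow, Finset.prod_mul_distrib]
      ring)
  exact h.trans (by exact_mod_cast hJ)

/-- Either `1 - x ≤ η`, or `x ≤ 1 - η` and `x ^ s` is itself small. This bounds the event of passing
`s` tests and failing the next. -/
theorem pow_mul_one_sub_le {x η : ℝ} (h0 : 0 ≤ x) (hη0 : 0 ≤ η) (hη : η ≤ 1) (s : ℕ) :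
    x ^ s * (1 - x) ≤ η * x ^ s + (1 - η) ^ s := by
  have hs := pow_nonneg h0 s
  have hη' := pow_nonneg (sub_nonneg.mpr hη) s
  rcases le_total (1 - x) η with h | h
  · nlinarith [mul_le_mul_of_nonneg_left h hs]
  · have h2 := pow_le_pow_left₀ h0 (show x ≤ 1 - η by linarith) s
    have h3 := mul_nonneg hs h0
    have h4 := mul_nonneg hη0 hs
    linarith

/-- (1 - M)^N (1 + M)^N ≤ 1, and Bernoulli's inequality bounds the second factor below by 1 + NM. -/
theorem one_sub_pow_le {M : ℝ} (h0 : 0 < M) (h1 : M ≤ 1) {N : ℕ} (hN : 0 < N) :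
    (1 - M) ^ N ≤ 1 / N / M := by
  have hNM : 0 < (N : ℝ) * M := mul_pos (by exact_mod_cast hN) h0
  rw [div_div, le_div_iff₀ hNM]
  have hb : 1 + (N : ℝ) * M ≤ (1 + M) ^ N := one_add_mul_le_pow (by linarith) N
  have hpow : (1 - M) ^ N * (1 + M) ^ N ≤ 1 := by
    rw [← mul_pow]
    exact pow_le_one₀ (by nlinarith) (by nlinarith)
  have := pow_nonneg (sub_nonneg.mpr h1) N
  nlinarith [mul_le_mul_of_nonneg_left hb this]

/-- Summing the series gives the lower bound (A/M)(1 - (1 - M)^N). The first factor loses η + (1 -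
η)^s / M, the second at most 1/(NM). -/
theorem one_sub_le_of_geom {M A win η : ℝ} {s N : ℕ} (h0 : 0 < M) (h1 : M ≤ 1) (hAM : A ≤ M)
    (hA : M - η * M - (1 - η) ^ s ≤ A) (hN : 0 < N)
    (hwin : A * ∑ i ∈ Finset.range N, (1 - M) ^ i ≤ win) :
    1 - win ≤ η + ((1 - η) ^ s + 1 / N) / M := by
  have hgeom : (∑ i ∈ Finset.range N, (1 - M) ^ i) * M = 1 - (1 - M) ^ N := by
    have := geom_sum_mul_neg (1 - M) N
    rwa [sub_sub_cancel] at this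
  have hq := pow_nonneg (sub_nonneg.mpr h1) N
  have h2 := one_sub_pow_le h0 h1 hN
  have h3 : A * (1 - (1 - M) ^ N) / M ≤ win := by
    rw [← hgeom, ← mul_assoc, mul_div_assoc, div_self h0.ne', mul_one]
    exact hwin
  have h4 : A / M - (1 - M) ^ N ≤ A * (1 - (1 - M) ^ N) / M := by
    rw [mul_sub, mul_one, sub_div, mul_div_right_comm]
    have : A / M ≤ 1 := (div_le_one h0).mpr hAM
    nlinarith
  have h5 : 1 - η - (1 - η) ^ s / M ≤ A / M := by
    rw [le_div_iff₀ h0, sub_mul, div_mul_cancel₀ _ h0.ne']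
    linarith
  rw [add_div]
  linarith

/-- No single 1/M(k) is bounded. Only its average with weights p(k) a(k, k)^s is, and correctness
makes these weights nearly those of p. -/
theorem sum_win_ge (hp : ∀ k, 0 ≤ p k) (hp1 : ∑ k, p k = 1) (ha : ∀ k' k, 0 ≤ a k' k)
    (ha1 : ∀ k' k, a k' k ≤ 1) {u v : K → I → ℂ}
    (huv : ∀ k' k, (a k' k : ℂ) = ∑ i, u k' i * v k i) {s N : ℕ} (hN : 0 < N) {win : K → ℝ}
    (hwin : ∀ k, (∑ k', p k' * a k' k ^ (s + 1)) *
      ∑ i ∈ Finset.range N, (1 - ∑ k', p k' * a k' k ^ s) ^ i ≤ win k) {ν η : ℝ}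
    (hη0 : 0 ≤ η) (hη : η ≤ 1) (hν : 1 - ν ≤ ∑ k, p k * a k k) :
    1 - (η + ((1 - η) ^ s + 1 / N) * ((s + 1 : ℕ) : ℝ) ^ Fintype.card I + s * ν) ≤
      ∑ k, p k * win k := by
  set M : K → ℝ := fun k => ∑ k', p k' * a k' k ^ s with hM
  set A : K → ℝ := fun k => ∑ k', p k' * a k' k ^ (s + 1) with hA
  have hM0 : ∀ k, 0 ≤ M k := fun k =>
    Finset.sum_nonneg fun k' _ => mul_nonneg (hp k') (pow_nonneg (ha k' k) s)
  have hM1 : ∀ k, M k ≤ 1 := fun k => by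
    rw [← hp1]
    exact Finset.sum_le_sum fun k' _ =>
      mul_le_of_le_one_right (hp k') (pow_le_one₀ (ha k' k) (ha1 k' k))
  have hA0 : ∀ k, 0 ≤ A k := fun k =>
    Finset.sum_nonneg fun k' _ => mul_nonneg (hp k') (pow_nonneg (ha k' k) (s + 1))
  have hAM : ∀ k, A k ≤ M k := fun k => Finset.sum_le_sum fun k' _ =>
    mul_le_mul_of_nonneg_left (pow_le_pow_of_le_one (ha k' k) (ha1 k' k) (Nat.le_succ s)) (hp k')
  have hAge : ∀ k, M k - η * M k - (1 - η) ^ s ≤ A k := by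
    intro k
    have h1 : M k - A k ≤ ∑ k', p k' * (η * a k' k ^ s + (1 - η) ^ s) := by
      rw [hM, hA, ← Finset.sum_sub_distrib]
      refine Finset.sum_le_sum fun k' _ => ?_
      rw [← mul_sub]
      refine mul_le_mul_of_nonneg_left ?_ (hp k')
      have := pow_mul_one_sub_le (ha k' k) hη0 hη s
      rw [pow_succ]
      linarith
    have h2 : ∑ k', p k' * (η * a k' k ^ s + (1 - η) ^ s) = η * M k + (1 - η) ^ s := by
      simp only [mul_add, Finset.sum_add_distrib, ← Finset.sum_mul, hp1, one_mul, hM,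
        Finset.mul_sum]
      congr 1
      exact Finset.sum_congr rfl fun k' _ => by ring
    linarith
  have hwin0 : ∀ k, 0 ≤ win k := fun k => (mul_nonneg (hA0 k) (Finset.sum_nonneg fun i _ =>
    pow_nonneg (sub_nonneg.mpr (hM1 k)) i)).trans (hwin k)
  set c := (1 - η) ^ s + 1 / (N : ℝ) with hc
  have hc0 : 0 ≤ c := add_nonneg (pow_nonneg (sub_nonneg.mpr hη) s) (by positivity)
  -- The weight p(k) is split by 1 = a(k, k)^s + (1 - a(k, k)^s). The first part is controlled by
  -- the trace bound, the second by Bernoulli's inequality and correctness.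
  have hkey : ∀ k, p k * (1 - win k) ≤
      p k * η + c * (p k * a k k ^ s / M k) + s * (p k * (1 - a k k)) := by
    intro k
    have hs0 := pow_nonneg (ha k k) s
    have hs1 := pow_le_one₀ (n := s) (ha k k) (ha1 k k)
    have hbern : 1 - a k k ^ s ≤ s * (1 - a k k) := by
      have := one_add_mul_le_pow (a := a k k - 1) (by linarith [ha k k]) s
      rw [add_sub_cancel] at this
      linarith
    have hrest : p k * (1 - a k k ^ s) * (1 - win k) ≤ s * (p k * (1 - a k k)) := by
      have h1 : p k * (1 - a k k ^ s) * (1 - win k) ≤ p k * (1 - a k k ^ s) :=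
        mul_le_of_le_one_right (mul_nonneg (hp k) (by linarith)) (by linarith [hwin0 k])
      have h2 := mul_le_mul_of_nonneg_left hbern (hp k)
      linarith
    have hmain : p k * a k k ^ s * (1 - win k) ≤ p k * η + c * (p k * a k k ^ s / M k) := by
      -- M(k) contains the term p(k) a(k, k)^s, so that weight vanishes with M(k).
      rcases (hM0 k).eq_or_lt with h0 | h0
      · have h1 : p k * a k k ^ s ≤ M k := Finset.single_le_sum
          (f := fun k' => p k' * a k' k ^ s)
          (fun k' _ => mul_nonneg (hp k') (pow_nonneg (ha k' k) s)) (Finset.mem_univ k)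
        have h2 : p k * a k k ^ s = 0 := le_antisymm (h0 ▸ h1) (mul_nonneg (hp k) hs0)
        rw [h2, zero_mul, zero_div, mul_zero, add_zero]
        exact mul_nonneg (hp k) hη0
      · have h1 := mul_le_mul_of_nonneg_left
          (one_sub_le_of_geom h0 (hM1 k) (hAM k) (hAge k) hN (hwin k)) (mul_nonneg (hp k) hs0)
        have h2 : p k * a k k ^ s * η ≤ p k * η :=
          mul_le_mul_of_nonneg_right (mul_le_of_le_one_right (hp k) hs1) hη0
        rw [mul_add] at h1
        have h3 : p k * a k k ^ s * (c / M k) = c * (p k * a k k ^ s / M k) := by ring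
        linarith
    linarith
  have hsum := Finset.sum_le_sum fun k (_ : k ∈ Finset.univ) => hkey k
  simp only [mul_sub, mul_one, Finset.sum_add_distrib, Finset.sum_sub_distrib, ← Finset.sum_mul,
    ← Finset.mul_sum, hp1, one_mul] at hsum
  have h1 := mul_le_mul_of_nonneg_left (sum_div_passProb_le hp ha huv s) hc0
  have h2 : (s : ℝ) * (1 - ∑ k, p k * a k k) ≤ s * ν :=
    mul_le_mul_of_nonneg_left (by linarith) (Nat.cast_nonneg s)
  linarith

end

end

/-! ### Choice of parameters and the lower bound on the winning probability. -/

noncomputable section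

open scoped ComplexOrder Classical

open Config Filter Asymptotics

/-- After multiplication by n^c every term tends to zero. With η = n^{-(c+1)} and s = n^{c+2}, ηs =
n gives (1 - η)^s ≤ e^{-n}. The exponent of N exceeds that of n^c (s + 1)^d by one, which leaves a
factor 1/n. -/
theorem eventually_error_lt {ν : ℕ → ℝ}
    (hν : SuperpolynomialDecay atTop (fun n : ℕ => (n : ℝ)) ν) (c d : ℕ) :
    ∀ᶠ n : ℕ in atTop,
      ((n : ℝ) ^ (c + 1))⁻¹ + ((1 - ((n : ℝ) ^ (c + 1))⁻¹) ^ (n ^ (c + 2)) +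
        1 / ((n ^ ((c + 2) * d + c + 1) : ℕ) : ℝ)) * ((n ^ (c + 2) + 1 : ℕ) : ℝ) ^ d +
        ((n ^ (c + 2) : ℕ) : ℝ) * ν n < ((n : ℝ) ^ c)⁻¹ := by
  have hinv : Tendsto (fun n : ℕ => ((n : ℝ))⁻¹) atTop (nhds 0) :=
    tendsto_inv_atTop_zero.comp tendsto_natCast_atTop_atTop
  have hexp : Tendsto (fun n : ℕ => (n : ℝ) ^ (c + (c + 2) * d) * Real.exp (-(n : ℝ))) atTop
      (nhds 0) :=
    (Real.tendsto_pow_mul_exp_neg_atTop_nhds_zero _).comp tendsto_natCast_atTop_atTop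
  have hlim : Tendsto (fun n : ℕ => (n : ℝ)⁻¹ +
      2 ^ d * ((n : ℝ) ^ (c + (c + 2) * d) * Real.exp (-(n : ℝ)) + (n : ℝ)⁻¹) +
      (n : ℝ) ^ (c + (c + 2)) * ν n) atTop (nhds 0) := by
    simpa using (hinv.add ((hexp.add hinv).const_mul (2 ^ d))).add (hν (c + (c + 2)))
  filter_upwards [hlim.eventually (gt_mem_nhds zero_lt_one), eventually_ge_atTop 1] with n hn hn1
  have hn0 : (0 : ℝ) < n := by exact_mod_cast hn1
  have hn1' : (1 : ℝ) ≤ n := by exact_mod_cast hn1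
  have hnc : (0 : ℝ) < (n : ℝ) ^ c := pow_pos hn0 c
  rw [← one_div ((n : ℝ) ^ c), lt_div_iff₀ hnc]
  refine lt_of_le_of_lt ?_ hn
  set η : ℝ := ((n : ℝ) ^ (c + 1))⁻¹ with hη
  have hη1 : η ≤ 1 := inv_le_one_of_one_le₀ (one_le_pow₀ hn1')
  have h1 : η * (n : ℝ) ^ c = (n : ℝ)⁻¹ := by
    rw [hη, pow_succ]
    field_simp
  have h2 : (1 - η) ^ (n ^ (c + 2)) ≤ Real.exp (-(n : ℝ)) := by
    refine (pow_le_pow_left₀ (sub_nonneg.mpr hη1) (Real.one_sub_le_exp_neg η) _).trans_eq ?_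
    rw [← Real.exp_nat_mul, hη]
    congr 1
    push_cast
    rw [pow_succ]
    field_simp
  have h3 : ((n ^ (c + 2) + 1 : ℕ) : ℝ) ^ d ≤ 2 ^ d * (n : ℝ) ^ ((c + 2) * d) := by
    rw [pow_mul, ← mul_pow]
    refine pow_le_pow_left₀ (Nat.cast_nonneg _) ?_ _
    push_cast
    linarith [one_le_pow₀ (n := c + 2) hn1']
  have h4 : ((1 - η) ^ (n ^ (c + 2)) + 1 / ((n ^ ((c + 2) * d + c + 1) : ℕ) : ℝ)) *
      ((n ^ (c + 2) + 1 : ℕ) : ℝ) ^ d ≤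
      (Real.exp (-(n : ℝ)) + 1 / (n : ℝ) ^ ((c + 2) * d + c + 1)) *
        (2 ^ d * (n : ℝ) ^ ((c + 2) * d)) := by
    push_cast at h3 ⊢
    gcongr
  have h5 : (Real.exp (-(n : ℝ)) + 1 / (n : ℝ) ^ ((c + 2) * d + c + 1)) *
      (2 ^ d * (n : ℝ) ^ ((c + 2) * d)) * (n : ℝ) ^ c =
      2 ^ d * ((n : ℝ) ^ (c + (c + 2) * d) * Real.exp (-(n : ℝ)) + (n : ℝ)⁻¹) := by
    rw [pow_succ, pow_add, pow_add]
    field_simp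
  have h6 : ((n ^ (c + 2) : ℕ) : ℝ) * ν n * (n : ℝ) ^ c = (n : ℝ) ^ (c + (c + 2)) * ν n := by
    push_cast
    ring
  rw [add_mul, add_mul, h1, h6, ← h5]
  gcongr

namespace QPT

variable (A : QPT) (w : List Bool) {n : ℕ} {φ : QOp}

/-- The outputs of nonzero probability. -/
def supp (n : ℕ) (φ : QOp) : Finset (List Bool) :=
  (A.outputs w n φ).filter fun k => A.expect w n φ (fun y => if y = k then 1 else 0) ≠ 0

theorem expect_eq_sum_supp (n : ℕ) (φ : QOp) (f : List Bool → ℝ) :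
    A.expect w n φ f = ∑ k : A.supp w n φ,
      A.expect w n φ (fun y => if y = k.1 then 1 else 0) * f k := by
  rw [A.expect_eq_sum, Finset.sum_coe_sort (A.supp w n φ) fun k =>
    A.expect w n φ (fun y => if y = k then 1 else 0) * f k, supp]
  refine (Finset.sum_filter_of_ne fun k _ h => left_ne_zero_of_mul h).symm

end QPT

/-- The first factor depends only on the key that is tested, the second only on the state: a
factorisation of the acceptance matrix with 4^m terms. -/
theorem AdvData.accept_eq_sum (D : AdvData) {φ : QOp} (hφ : φ.IsInput D.m) (k : List Bool) :
    (D.accept φ k : ℂ) =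
      ∑ i : {i // i ∈ (List.finite_length_eq Bool D.m).toFinset ×ˢ
        (List.finite_length_eq Bool D.m).toFinset},
        D.ver.prog.expectC k (QOp.unit i.1.1 i.1.2) (D.ver.time.eval (k.length + D.m))
          (fun y => ((if y.head? = some true then 1 else 0 : ℝ) : ℂ)) * φ i.1.1 i.1.2 := by
  rw [accept, ← D.ver.expectC_eq k hφ, Prog.expectC_eq_sum _ _ hφ.onQubits, ← Finset.sum_product',
    ← Finset.sum_coe_sort]
  exact Finset.sum_congr rfl fun i _ => mul_comm _ _

theorem winProb_ge (G : StateGenerator) (m : ℕ → ℕ) (e₁ e₂ n : ℕ) (hout : G.HasQubitOutputs m)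
    (hn : 1 ≤ n) {ν η : ℝ} (hη0 : 0 ≤ η) (hη : η ≤ 1)
    (hν : 1 - ν ≤ G.keyGen.expect (unary n) 0 QOp.empty fun k => G.acceptProb k (m n) (G.state k)) :
    1 - (η + ((1 - η) ^ (n ^ e₁) + 1 / ((n ^ e₂ : ℕ) : ℝ)) * ((n ^ e₁ + 1 : ℕ) : ℝ) ^
      Fintype.card {i // i ∈ (List.finite_length_eq Bool (m n)).toFinset ×ˢ
        (List.finite_length_eq Bool (m n)).toFinset} + ((n ^ e₁ : ℕ) : ℝ) * ν) ≤
      G.winProb m (AdvData.mk G.keyGen G.ver (m n) e₁ e₂).qpt (n ^ e₂ * n ^ e₁) n := by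
  set D := AdvData.mk G.keyGen G.ver (m n) e₁ e₂ with hD
  -- Keys are restricted to the support, where alone `φ_k` is known to be a state.
  set S := G.keyGen.supp (unary n) 0 QOp.empty with hS
  have hexp := G.keyGen.expect_eq_sum_supp (unary n) 0 QOp.empty
  have hin : ∀ k : S, (G.state k).IsInput D.m := fun k =>
    (hout n k.1 (Finset.mem_filter.mp k.2).2).isInput
  have hlen : (unary n).length = n := List.length_replicate
  have hpass : ∀ (k : S) s, ∑ k' : S, G.keyProb n k' * D.accept (G.state k) k' ^ s =
      D.passProb (G.state k) (unary n) s :=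
    fun k s => (hexp fun k' => D.accept (G.state k) k' ^ s).symm
  rw [hexp] at hν
  rw [StateGenerator.winProb, hexp]
  refine sum_win_ge (p := fun k : S => G.keyProb n k)
    (a := fun k' k : S => D.accept (G.state k) k') (fun k => ?_) ?_
    (fun k' k => D.accept_nonneg (hin k) k') (fun k' k => D.accept_le_one (hin k) k')
    (fun k' k => D.accept_eq_sum (hin k) k') (Nat.pow_pos hn) (fun k => ?_) hη0 hη hν
  · exact (G.keyGen.expect_const (unary n) QOp.isInput_empty 0).symm.trans_le
      (G.keyGen.expect_mono _ QOp.isInput_empty fun y => by split <;> norm_num)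
  · have h := hexp fun _ => 1
    rw [G.keyGen.expect_const _ QOp.isInput_empty] at h
    simp only [mul_one] at h
    exact h.symm
  · rw [hpass, hpass]
    refine (D.le_winValue (unary n) _ (hin k) (n ^ e₂)).trans (le_of_eq ?_)
    have h := D.expect_qpt (unary n) (hin k)
    rw [hlen] at h
    exact h.symm

end

theorem mainTheorem4 :
    ¬ ∃ (G : StateGenerator) (m : ℕ → ℕ),
      (fun n : ℕ => (m n : ℝ)) =O[Filter.atTop] (fun _ : ℕ => (1 : ℝ)) ∧
      G.IsWeakOWSG m := by
  rintro ⟨G, m, hm, c, hout, ⟨ν, hν, hcorr⟩, hone⟩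
  obtain ⟨B, hB⟩ := hm.bound
  -- The adversary is a single program and needs the block size as a constant; by pigeonhole a
  -- bounded `m` takes some value infinitely often.
  obtain ⟨m₀, hm₀⟩ : ∃ m₀, ∃ᶠ n in Filter.atTop, m n = m₀ := by
    by_contra! hno
    have hall : ∀ᶠ n in Filter.atTop, ∀ m₀ ∈ Finset.range (⌊B⌋₊ + 1), m n ≠ m₀ := by
      rw [Filter.eventually_all_finset]
      exact fun m₀ _ => hno m₀
    obtain ⟨n, h1, h2⟩ := (hB.and hall).exists
    refine h2 (m n) (Finset.mem_range.mpr (Nat.lt_succ_of_le (Nat.le_floor ?_))) rfl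
    simpa using h1
  set d := Fintype.card {i // i ∈ (List.finite_length_eq Bool m₀).toFinset ×ˢ
        (List.finite_length_eq Bool m₀).toFinset} with hd
  have hwin := hone (AdvData.mk G.keyGen G.ver m₀ (c + 2) ((c + 2) * d + c + 1)).qpt
    (Polynomial.X ^ ((c + 2) * d + c + 1) * Polynomial.X ^ (c + 2))
  -- One-wayness holds for all large `n`, so it meets the infinitely many `n` with `m n = m₀`.
  obtain ⟨n, hn, ⟨herr, hwin⟩, hn1⟩ := (hm₀.and_eventually
    (((eventually_error_lt hν c d).and hwin).and (Filter.eventually_ge_atTop 1))).exists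
  have hn1' : (1 : ℝ) ≤ n := by exact_mod_cast hn1
  have h := winProb_ge G m (c + 2) ((c + 2) * d + c + 1) n hout hn1
    (η := ((n : ℝ) ^ (c + 1))⁻¹) (by positivity) (inv_le_one_of_one_le₀ (one_le_pow₀ hn1'))
    (hcorr n)
  simp only [Polynomial.eval_mul, Polynomial.eval_pow, Polynomial.eval_X] at hwin
  subst hn
  rw [← hd] at h
  linarith
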